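/- Let $f=f(w,v):\mathbb R^2\to\mathbb R$ be of class $C^3$ with all partial derivatives of order $\le 3$ bounded, let $\varepsilon>0$, and let $w_0,v_0:\mathbb R\to\mathbb Z\varepsilon$ be right continuous, piecewise constant with finitely many jumps, and compactly supported. Let $A,B\subseteq\mathbb R$ be intervals containing the values of $w_0$ and $v_0$ respectively, such that $\partial_w f>-1$ on $A\times B$. For $g:\mathbb R\to\mathbb R$ let $g_\varepsilon$ be the piecewise affine interpolation of $g$ with nodes $\mathbb Z\varepsilon$, and let $\operatorname{conv}_{[a,b]}$, $\operatorname{conc}_{[a,b]}$ denote convex and concave envelopes on $[a,b]$. Consider the wavefront tracking solution $(w,v)$ of $w_t+\partial_wf(w,v)\,w_x=0$, $v_t-v_x=0$ with datum $(w_0,v_0)$: $v(t,x)=v_0(x+t)$, and at time $0$ and at every collision time each jump $(w^-,w^+)$ of $w$ at a point $y$ is resolved by the right continuous entropy solution of the scalar Riemann problem $(w^-,w^+)$ with flux $f_\varepsilon(\cdot,v(t,y))$, whose wavefronts then travel at constant speed until the next collision. Wavefronts of the first (second) family are the discontinuity lines of $v$ (of $w$); a collision is a meeting of at least two wavefronts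 at a positive time. Let $t_0=0$ and let $(t_1,x_1),\dots,(t_J,x_J)$, $t_1<\dots<t_J$, be all the collision points, or the first $J$ of them; assume that $(t_j,x_j)$ is the only collision point at time $t_j$ and that exactly two wavefronts meet there. Call $(t_j,x_j)$ an interaction point if these two wavefronts are both of the second family and have jumps of the same sign. Let $\mathcal W=\{1,\dots,\frac1\varepsilon\mathrm{Tot.Var.}(w_0)\}$ be the set of waves and $V(x)=\mathrm{Tot.Var.}(w_0;(-\infty,x])$. The wave $s$ has initial position $\mathtt x(0,s)=\inf\{x:\varepsilon s\le V(x)\}$, sign $\mathcal S(s)=\operatorname{sign}[w_0(\mathtt x(0,s))-w_0(\mathtt x(0,s)-)]$ and right state $\hat w(s)=w_0(\mathtt x(0,s)-)+\mathcal S(s)[\varepsilon s-V(\mathtt x(0,s)-)]$. If $\mathtt x(t_j,s)=y<+\infty$, its speed $\sigma(t_j,s)$ is the constant value of $\frac{d}{dw}\operatorname{conv}_{[w(t_j,y-),w(t_j,y)]}f_\varepsilon(\cdot,v(t_j,y))$ on $(\hat w(s)-\varepsilon,\hat w(s))$ if $\mathcal S(s)=1$, and of $\frac{d}{dw}\operatorname{conc}_{[w(t_j,y),w(t_j,y-)]}f_\varepsilon(\cdot,v(t_j,y))$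 on $(\hat w(s),\hat w(s)+\varepsilon)$ if $\mathcal S(s)=-1$. Its next position is $\mathtt x(t_{j+1},s)=y+\sigma(t_j,s)(t_{j+1}-t_j)$, except that $\mathtt x(t_{j+1},s)=+\infty$ (the wave is canceled, and stays so) if that point is $x_{j+1}$ and the condition $\mathcal S(s)w(t_{j+1},x_{j+1}-)\le\mathcal S(s)\hat w(s)-\varepsilon$, $\mathcal S(s)\hat w(s)\le\mathcal S(s)w(t_{j+1},x_{j+1})$ fails. Let $\mathcal W(t_j)=\{s\in\mathcal W:\mathtt x(t_j,s)<+\infty\}$. Then $$\sum_{\substack{1\le j\le J\\ (t_j,x_j)\ \text{interaction point}}}\ \sum_{s\in\mathcal W(t_j)}|\sigma(t_j,s)-\sigma(t_{j-1},s)|\,\varepsilon\ \le\ 2\Big[\|D^2_{ww}f\|_{L^\infty}+6\log(2)\,\|D^3_{wwv}f\|_{L^\infty}\,\mathrm{Tot.Var.}(v_0)\Big]\mathrm{Tot.Var.}(w_0)^2 .$$ -/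

import Mathlib

open Set

noncomputable section

namespace WavefrontTracking

/-! ### Fluxes and their derivatives -/

/-- `‖D²_{ww} f‖_{L^∞}` for `f = f(w, v)`. -/
def normDww (f : ℝ × ℝ → ℝ) : ℝ :=
  ⨆ p : ℝ × ℝ, |iteratedDeriv 2 (fun w => f (w, p.2)) p.1|

/-- `‖D³_{wwv} f‖_{L^∞}` for `f = f(w, v)`. -/
def normDwwv (f : ℝ × ℝ → ℝ) : ℝ :=
  ⨆ p : ℝ × ℝ, |deriv (fun v => iteratedDeriv 2 (fun w => f (w, v)) p.1) p.2|

/-- The piecewise affine interpolation `g_ε` of `g` with nodes `m ε`, `m ∈ ℤ`. -/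
def gridInterp (ε : ℝ) (g : ℝ → ℝ) (w : ℝ) : ℝ :=
  g (⌊w / ε⌋ * ε) +
    (w / ε - ⌊w / ε⌋) * (g ((⌊w / ε⌋ + 1) * ε) - g (⌊w / ε⌋ * ε))

/-- The convex envelope `conv_{[a,b]} g` (meaningful on `[a,b]`). -/
def convEnv (g : ℝ → ℝ) (a b u : ℝ) : ℝ :=
  sSup {y | ∃ h : ℝ → ℝ, ConvexOn ℝ (Icc a b) h ∧ (∀ z ∈ Icc a b, h z ≤ g z) ∧ h u = y}

/-- The concave envelope `conc_{[a,b]} g` (meaningful on `[a,b]`). -/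
def concEnv (g : ℝ → ℝ) (a b u : ℝ) : ℝ :=
  sInf {y | ∃ h : ℝ → ℝ, ConcaveOn ℝ (Icc a b) h ∧ (∀ z ∈ Icc a b, g z ≤ h z) ∧ h u = y}

/-! ### The scalar Riemann problem with flux `g_ε` -/

/-- The grid cells `(k ε, (k+1) ε)` contained in the interval with end points `a`, `b`. -/
def cells (ε a b : ℝ) : Set ℤ :=
  {k | min a b ≤ k * ε ∧ (k + 1) * ε ≤ max a b}

/-- The speed which the Riemann problem `(a, b)` with flux `g_ε` gives to the grid cell
`(k ε, (k+1) ε)`: the constant value on that cell of the derivative of the convex envelope of `g_ε`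
on `[a,b]` if `a ≤ b`, and of the concave envelope on `[b,a]` if `b < a`.
It is read off at the midpoint of the cell. -/
def cellSpeed (ε : ℝ) (g : ℝ → ℝ) (a b : ℝ) (k : ℤ) : ℝ :=
  if a ≤ b then deriv (convEnv (gridInterp ε g) a b) ((k + 1 / 2) * ε)
  else deriv (concEnv (gridInterp ε g) b a) ((k + 1 / 2) * ε)

/-- The right continuous entropy solution of the Riemann problem `(a, b)`, `a, b ∈ ℤ ε`, with flux
`g_ε`, as a function of `ξ = x / t`: all the cells whose speed is at most `ξ` have been passed. -/
def riemann (ε : ℝ) (g : ℝ → ℝ) (a b ξ : ℝ) : ℝ :=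
  a + Real.sign (b - a) * (ε * ({k ∈ cells ε a b | cellSpeed ε g a b k ≤ ξ}.ncard : ℝ))

/-! ### Wavefront tracking -/

/-- Admissible discretized data: right continuous, piecewise constant with finitely many jumps,
compactly supported, with values in `ℤ ε`. -/
structure GridData (ε : ℝ) (g : ℝ → ℝ) : Prop where
  /-- the values lie on the grid -/
  mem_grid : ∀ x, ∃ m : ℤ, g x = m * ε
  /-- `g` is constant on each `[d, d')` between consecutive points `d < d'` of a finite set, and
  on the two unbounded intervals that are left -/
  piecewise_const : ∃ D : Finset ℝ, ∀ x y, x < y → (∀ d ∈ D, d ∉ Ioc x y) → g x = g y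
  /-- the support is compact -/
  compact_support : HasCompactSupport g

/-- The discontinuity points of a right continuous piecewise constant function. -/
def jumpSet (g : ℝ → ℝ) : Set ℝ := {y | Function.leftLim g y ≠ g y}

/-- Let `p` and `q` be the profiles of `w` and `v` at some time. Starting from them, the Riemann
problem at every discontinuity `y` of `p` is solved with flux `f_ε(·, q y)` (`q y` is the right
state of `v`), and the solutions are glued. As `p` vanishes near `-∞`, up to and including the first
time at which wavefronts meet the glued function is the sum of the increments of all the Riemann
solutions. This is the profile of `w` after the elapsed time `τ > 0`. -/
def glue (f : ℝ × ℝ → ℝ) (ε : ℝ) (q p : ℝ → ℝ) (τ x : ℝ) : ℝ :=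
  ∑ᶠ y : ℝ,
    (riemann ε (fun w => f (w, q y)) (Function.leftLim p y) (p y) ((x - y) / τ)
      - Function.leftLim p y)

/-- The profile `v(t_j, ·)`; the first family is transported with speed `-1`. -/
def vAt (v₀ : ℝ → ℝ) (t : ℕ → ℝ) (j : ℕ) (x : ℝ) : ℝ := v₀ (x + t j)

/-- The profile `w(t_j, ·)` of the wavefront solution with collision times `t_1 < t_2 < ⋯`. -/
def wAt (f : ℝ × ℝ → ℝ) (ε : ℝ) (w₀ v₀ : ℝ → ℝ) (t : ℕ → ℝ) : ℕ → ℝ → ℝ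
  | 0 => w₀
  | j + 1 => glue f ε (vAt v₀ t j) (wAt f ε w₀ v₀ t j) (t (j + 1) - t j)

/-- The two families of wavefronts: discontinuities of `v`, discontinuities of `w`. -/
inductive Family
  | first
  | second

/-- A wavefront leaving the point `pos` with speed `speed`. -/
structure Front where
  /-- the family of the wavefront -/
  family : Family
  /-- its starting point -/
  pos : ℝ
  /-- its speed -/
  speed : ℝ

/-- `F` is one of the wavefronts leaving the profiles `p` of `w` and `q` of `v`. -/
def IsFront (f : ℝ × ℝ → ℝ) (ε : ℝ) (q p : ℝ → ℝ) (F : Front) : Prop :=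
  match F.family with
  | Family.first => F.pos ∈ jumpSet q ∧ F.speed = -1
  | Family.second =>
      ∃ k ∈ cells ε (Function.leftLim p F.pos) (p F.pos),
        F.speed = cellSpeed ε (fun w => f (w, q F.pos)) (Function.leftLim p F.pos) (p F.pos) k

/-- The wavefronts leaving the profiles `q`, `p` which are at the point `x` after the
elapsed time `τ`. -/
def arriving (f : ℝ × ℝ → ℝ) (ε : ℝ) (q p : ℝ → ℝ) (τ x : ℝ) : Set Front :=
  {F | IsFront f ε q p F ∧ F.pos + F.speed * τ = x}

/-- Two or more wavefronts meet at the point `x` after the elapsed time `τ > 0`. -/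
def IsCollision (f : ℝ × ℝ → ℝ) (ε : ℝ) (q p : ℝ → ℝ) (τ x : ℝ) : Prop :=
  0 < τ ∧ (arriving f ε q p τ x).Nontrivial

/-- `(t_1, x_1), …, (t_J, x_J)` are the first `J` collision points of the wavefront solution with
initial datum `(w₀, v₀)` (possibly all of them), and `t_0 = 0`. Moreover collisions are simple: for
each `j` there is only one collision point at time `t_j`, and exactly two wavefronts meet there. -/
structure IsCollisionSequence (f : ℝ × ℝ → ℝ) (ε : ℝ) (w₀ v₀ : ℝ → ℝ) (J : ℕ) (t x : ℕ → ℝ) :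
    Prop where
  /-- the initial time -/
  zero : t 0 = 0
  /-- `t_{j+1}` is the first collision time after `t_j` -/
  next : ∀ j < J,
    IsLeast {s | ∃ y, IsCollision f ε (vAt v₀ t j) (wAt f ε w₀ v₀ t j) (s - t j) y} (t (j + 1))
  /-- all the collisions at time `t_{j+1}` take place at `x_{j+1}` -/
  unique : ∀ j < J, ∀ y,
    IsCollision f ε (vAt v₀ t j) (wAt f ε w₀ v₀ t j) (t (j + 1) - t j) y → y = x (j + 1)
  /-- exactly two wavefronts meet at `(t_{j+1}, x_{j+1})` -/
  binary : ∀ j < J,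
    (arriving f ε (vAt v₀ t j) (wAt f ε w₀ v₀ t j) (t (j + 1) - t j) (x (j + 1))).ncard = 2

/-- `(t_{j+1}, x_{j+1})` is an interaction point: the wavefronts which collide there are of the
second family and have the same sign. (All the wavefronts leaving a jump `y` of a profile `p`
of `w` have the sign of `p y - p (y-)`.) -/
def IsInteraction (f : ℝ × ℝ → ℝ) (ε : ℝ) (w₀ v₀ : ℝ → ℝ) (t x : ℕ → ℝ) (j : ℕ) : Prop :=
  ∀ F ∈ arriving f ε (vAt v₀ t j) (wAt f ε w₀ v₀ t j) (t (j + 1) - t j) (x (j + 1)),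
  ∀ G ∈ arriving f ε (vAt v₀ t j) (wAt f ε w₀ v₀ t j) (t (j + 1) - t j) (x (j + 1)),
    F.family = Family.second ∧ G.family = Family.second ∧
    Real.sign (wAt f ε w₀ v₀ t j F.pos - Function.leftLim (wAt f ε w₀ v₀ t j) F.pos) =
      Real.sign (wAt f ε w₀ v₀ t j G.pos - Function.leftLim (wAt f ε w₀ v₀ t j) G.pos)

/-! ### Waves of the second family -/

/-- The total variation on `ℝ`. -/
def totVar (g : ℝ → ℝ) : ℝ := (eVariationOn g univ).toReal

/-- The total variation function `x ↦ Tot.Var.(g; (-∞, x])`. -/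
def variationFn (g : ℝ → ℝ) (x : ℝ) : ℝ := (eVariationOn g (Iic x)).toReal

/-- The set of waves `{1, …, Tot.Var.(w₀) / ε}`. -/
def waves (ε : ℝ) (w₀ : ℝ → ℝ) : Finset ℕ := Finset.Icc 1 ⌊totVar w₀ / ε⌋₊

/-- The initial position of the wave `s`. -/
def initPos (ε : ℝ) (w₀ : ℝ → ℝ) (s : ℕ) : ℝ := sInf {x | ε * s ≤ variationFn w₀ x}

/-- The sign of the wave `s`. -/
def waveSign (ε : ℝ) (w₀ : ℝ → ℝ) (s : ℕ) : ℝ :=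
  Real.sign (w₀ (initPos ε w₀ s) - Function.leftLim w₀ (initPos ε w₀ s))

/-- The right state of the wave `s`. -/
def rightState (ε : ℝ) (w₀ : ℝ → ℝ) (s : ℕ) : ℝ :=
  Function.leftLim w₀ (initPos ε w₀ s) +
    waveSign ε w₀ s * (ε * s - Function.leftLim (variationFn w₀) (initPos ε w₀ s))

/-- The speed at time `t_j` of the wave `s` if its position is `y`: the derivative of the convex
envelope of `f_ε(·, v(t_j, y))` on `[w(t_j, y-), w(t_j, y)]` on the cell `(ŵ(s) - ε, ŵ(s))` if `s` is
positive, of the concave envelope on `[w(t_j, y), w(t_j, y-)]` on the cell `(ŵ(s), ŵ(s) + ε)` if `s`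
is negative. It is read off at the midpoint of the cell. -/
def speedAt (f : ℝ × ℝ → ℝ) (ε : ℝ) (w₀ v₀ : ℝ → ℝ) (t : ℕ → ℝ) (j s : ℕ) (y : ℝ) : ℝ :=
  if 0 < waveSign ε w₀ s then
    deriv (convEnv (gridInterp ε fun w => f (w, vAt v₀ t j y))
      (Function.leftLim (wAt f ε w₀ v₀ t j) y) (wAt f ε w₀ v₀ t j y)) (rightState ε w₀ s - ε / 2)
  else
    deriv (concEnv (gridInterp ε fun w => f (w, vAt v₀ t j y))
      (wAt f ε w₀ v₀ t j y) (Function.leftLim (wAt f ε w₀ v₀ t j) y)) (rightState ε w₀ s + ε / 2)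

/-- The wave `s`, if it arrives at the collision point `(t_j, x_j)`, survives the collision. -/
def Survives (f : ℝ × ℝ → ℝ) (ε : ℝ) (w₀ v₀ : ℝ → ℝ) (t x : ℕ → ℝ) (j s : ℕ) : Prop :=
  waveSign ε w₀ s * Function.leftLim (wAt f ε w₀ v₀ t j) (x j)
      ≤ waveSign ε w₀ s * rightState ε w₀ s - ε ∧
  waveSign ε w₀ s * rightState ε w₀ s ≤ waveSign ε w₀ s * wAt f ε w₀ v₀ t j (x j)

open Classical in
/-- The position `x(t_j, s) ∈ (-∞, +∞]` of the wave `s` at time `t_j`; the value `⊤` means that the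
wave has been canceled. -/
def wavePos (f : ℝ × ℝ → ℝ) (ε : ℝ) (w₀ v₀ : ℝ → ℝ) (t x : ℕ → ℝ) : ℕ → ℕ → WithTop ℝ
  | 0, s => (initPos ε w₀ s : WithTop ℝ)
  | j + 1, s =>
    match wavePos f ε w₀ v₀ t x j s with
    | ⊤ => ⊤
    | (y : ℝ) =>
      if y + speedAt f ε w₀ v₀ t j s y * (t (j + 1) - t j) = x (j + 1) ∧
          ¬ Survives f ε w₀ v₀ t x (j + 1) s
      then ⊤
      else ((y + speedAt f ε w₀ v₀ t j s y * (t (j + 1) - t j) : ℝ) : WithTop ℝ)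

/-- The speed `σ(t_j, s)` of the wave `s` at time `t_j`. It is only used for waves that
have not been canceled; for the others the value `0` is a placeholder. -/
def waveSpeed (f : ℝ × ℝ → ℝ) (ε : ℝ) (w₀ v₀ : ℝ → ℝ) (t x : ℕ → ℝ) (j s : ℕ) : ℝ :=
  match wavePos f ε w₀ v₀ t x j s with
  | ⊤ => 0
  | (y : ℝ) => speedAt f ε w₀ v₀ t j s y

open Classical in
/-- The set `W(t_j)` of the waves which have not been canceled at time `t_j`. -/
def realWaves (f : ℝ × ℝ → ℝ) (ε : ℝ) (w₀ v₀ : ℝ → ℝ) (t x : ℕ → ℝ) (j : ℕ) : Finset ℕ :=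
  {s ∈ waves ε w₀ | wavePos f ε w₀ v₀ t x j s ≠ ⊤}

open Classical in
/-- The indices `j < J` such that `(t_{j+1}, x_{j+1})` is an interaction point. -/
def interactionIndices (f : ℝ × ℝ → ℝ) (ε : ℝ) (w₀ v₀ : ℝ → ℝ) (t x : ℕ → ℝ) (J : ℕ) :
    Finset ℕ :=
  {j ∈ Finset.range J | IsInteraction f ε w₀ v₀ t x j}

end WavefrontTracking

end

open WavefrontTracking

/-! Since $v(t,x)=v_0(x+t)$, the flux seen at $(t,x)$ depends only on the label $z=x+t$. The speed
of a wavefront is the average slope of $f_\varepsilon$ on its cells. These have end points in $A$,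
so the speed exceeds $-1$ and labels of waves increase in time. Let $\varphi_z(s)$ be the slope of
$f_\varepsilon(\cdot,v_0(z))$ on the cell of $s$, let $d(s,s')$ be the distance of two cells, $K$
and $M$ the sup norms of $D^2_{ww}f$ and $D^3_{wwv}f$, and $T(z)$ the variation of $v_0$ on
$[z,\infty)$.

If wavefronts $L$, $R$ of the same sign meet at the label $z$, then all their waves get the average
speed and no other wave changes its speed (`Step.interaction`). Hence $(|L|+|R|)\sum|\Delta\sigma| =
2\sum_{L\times R}(\varphi_z(s)-\varphi_z(s'))$, and it remains to bound this double sum.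

Each pair of waves gets a weight `pot`: it is $K+M\,\mathrm{Tot.Var.}(v_0)$ as long as the two waves
have not been at the same position at any observed time, and then $M\,T(\zeta)$ with $\zeta$ their
last common label at such a time. Weights never increase. At the meeting those of the pairs in
$L\times R$ drop to $M\,T(z)$. The heart of the proof (`frontOrdered`) is that the total `excess`
$\sum_{L\times R}[\varphi_z(s)-\varphi_z(s')-(\mathrm{pot}-M\,T(z))\,d(s,s')]$ is not positive. As
$d\le(|L|+|R|)\varepsilon$ on the merged jump, the factor $|L|+|R|$ cancels and
$\varepsilon\sum|\Delta\sigma|$ is at most $2\varepsilon^2$ times the drop of the weights.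
Telescoping over all pairs gives $2[K+M\,\mathrm{Tot.Var.}(v_0)]\mathrm{Tot.Var.}(w_0)^2$, which is
stronger than the claim because $6\log 2\ge1$.

The inequality for the excess is proved by induction on the collisions. A pair that has never been
together has nonpositive excess by the bound on $D^2_{ww}f$. For waves at the same position, the
bound on $D^3_{wwv}f$ brings the slopes back to the present label, where the envelope separates the
slopes of slower waves from those of faster ones on average (`sum_excess_same_pos`). The excess is
subadditive along the line of waves as long as no sign changes (`excess_triangle`), so intermediate
waves can be inserted and averaged over (`sum_chain_nonpos`). Thus the inequality passes from
groups, that is, all waves at a point, to wavefronts. It passes back to the groups after the next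
collision because these are unions of wavefronts. A cancellation leaves a witness of the opposite
sign between the waves concerned; they have then never been together. -/

namespace WavefrontTracking

/-! ### Discrete convex hulls -/

/-- `σ` is the sequence of slopes of the convex envelope of the partial sums of `ψ` on `[0, n]`. -/
structure IsHull (n : ℕ) (ψ σ : ℕ → ℝ) : Prop where
  mono : ∀ i j, i ≤ j → j < n → σ i ≤ σ j
  sum_le : ∀ i ≤ n, ∑ l ∈ Finset.range i, σ l ≤ ∑ l ∈ Finset.range i, ψ l
  sum_eq : ∑ l ∈ Finset.range n, σ l = ∑ l ∈ Finset.range n, ψ l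
  touch : ∀ i, i + 1 < n → σ i < σ (i + 1) →
    ∑ l ∈ Finset.range (i + 1), σ l = ∑ l ∈ Finset.range (i + 1), ψ l

/-- The hull starts with the segment of smallest average slope and continues with the hull of what
is left. The lower bound by constants is carried along because the induction needs it: applied to
the rest, it shows that the later slopes are not below that smallest average. -/
theorem exists_isHull_aux (n : ℕ) : ∀ ψ : ℕ → ℝ, ∃ σ : ℕ → ℝ, IsHull n ψ σ ∧
    ∀ c : ℝ, (∀ i ≤ n, i * c ≤ ∑ l ∈ Finset.range i, ψ l) → ∀ i < n, c ≤ σ i := by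
  induction n using Nat.strong_induction_on with
  | _ n ih =>
    intro ψ
    rcases Nat.eq_zero_or_pos n with rfl | hn
    · exact ⟨ψ, ⟨fun i j _ h => absurd h (by omega), fun i hi => le_rfl, rfl,
        fun i h => absurd h (by omega)⟩, fun c _ i h => absurd h (by omega)⟩
    obtain ⟨m, hm, hmin⟩ := (Finset.Icc 1 n).exists_min_image
      (fun i => (∑ l ∈ Finset.range i, ψ l) / (i : ℝ)) ⟨1, by simp; omega⟩
    rw [Finset.mem_Icc] at hm
    set c₀ := (∑ l ∈ Finset.range m, ψ l) / (m : ℝ) with hc₀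
    have hm0 : (0 : ℝ) < m := by exact_mod_cast hm.1
    have hsum : ∑ l ∈ Finset.range m, ψ l = m * c₀ := by rw [hc₀]; field_simp
    have hle : ∀ i ≤ n, i * c₀ ≤ ∑ l ∈ Finset.range i, ψ l := by
      intro i hi
      rcases Nat.eq_zero_or_pos i with rfl | hi0
      · simp
      have := hmin i (Finset.mem_Icc.2 ⟨hi0, hi⟩)
      have hi0' : (0 : ℝ) < i := by exact_mod_cast hi0
      rw [le_div_iff₀ hi0'] at this
      linarith
    obtain ⟨σ', hσ', hlow⟩ := ih (n - m) (by omega) (fun l => ψ (m + l))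
    have hc' : ∀ i < n - m, c₀ ≤ σ' i := by
      apply hlow
      intro i hi
      have h1 := hle (m + i) (by omega)
      rw [Finset.sum_range_add, hsum] at h1
      push_cast at h1
      linarith
    let σ : ℕ → ℝ := fun l => if l < m then c₀ else σ' (l - m)
    have hσlt : ∀ l, l < m → σ l = c₀ := fun l hl => if_pos hl
    have hσge : ∀ l, σ (m + l) = σ' l := fun l => by simp [σ]
    have hs1 : ∀ i ≤ m, ∑ l ∈ Finset.range i, σ l = i * c₀ := by
      intro i hi
      rw [Finset.sum_congr rfl (fun l hl => hσlt l (by have := Finset.mem_range.1 hl; omega))]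
      simp
    have hs2 : ∀ i, ∑ l ∈ Finset.range (m + i), σ l =
        ∑ l ∈ Finset.range m, ψ l + ∑ l ∈ Finset.range i, σ' l := by
      intro i
      rw [Finset.sum_range_add, hs1 m le_rfl, hsum]
      simp only [hσge]
    refine ⟨σ, ⟨?_, ?_, ?_, ?_⟩, ?_⟩
    · intro i j hij hj
      rcases lt_or_ge j m with h | h
      · rw [hσlt i (by omega), hσlt j h]
      obtain ⟨j, rfl⟩ := Nat.exists_eq_add_of_le h
      rw [hσge]
      rcases lt_or_ge i m with h' | h'
      · rw [hσlt i h']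
        exact hc' j (by omega)
      · obtain ⟨i, rfl⟩ := Nat.exists_eq_add_of_le h'
        rw [hσge]
        exact hσ'.mono i j (by omega) (by omega)
    · intro i hi
      rcases le_or_gt i m with h | h
      · rw [hs1 i h]; exact hle i hi
      obtain ⟨i, rfl⟩ := Nat.exists_eq_add_of_le h.le
      rw [hs2, Finset.sum_range_add]
      have := hσ'.sum_le i (by omega)
      linarith
    · obtain ⟨k, rfl⟩ := Nat.exists_eq_add_of_le hm.2
      rw [hs2, Finset.sum_range_add]
      have := hσ'.sum_eq
      simp only [Nat.add_sub_cancel_left] at this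
      rw [this]
    · intro i hi hlt
      rcases lt_trichotomy (i + 1) m with h | h | h
      · rw [hσlt i (by omega), hσlt _ h] at hlt
        exact absurd hlt (lt_irrefl _)
      · rw [h, hs1 m le_rfl, hsum]
      · obtain ⟨i, rfl⟩ := Nat.exists_eq_add_of_le (show m ≤ i by omega)
        rw [add_assoc, hσge, hσge] at hlt
        rw [add_assoc, hs2, hσ'.touch i (by omega) hlt, ← Finset.sum_range_add]
    · intro c hc i hi
      have hcc : c ≤ c₀ := by
        have := hc m hm.2
        rw [hsum] at this
        exact le_of_mul_le_mul_left this hm0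
      rcases lt_or_ge i m with h | h
      · rw [hσlt i h]; exact hcc
      · obtain ⟨i, rfl⟩ := Nat.exists_eq_add_of_le h
        rw [hσge]
        exact hcc.trans (hc' i (by omega))

theorem exists_isHull (n : ℕ) (ψ : ℕ → ℝ) : ∃ σ : ℕ → ℝ, IsHull n ψ σ :=
  let ⟨σ, h, _⟩ := exists_isHull_aux n ψ
  ⟨σ, h⟩

/-- A constant is the hull as soon as it lies below all the averages of initial segments. -/
theorem IsHull.const {n : ℕ} {ψ : ℕ → ℝ} {c : ℝ}
    (hle : ∀ i ≤ n, i * c ≤ ∑ l ∈ Finset.range i, ψ l)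
    (heq : n * c = ∑ l ∈ Finset.range n, ψ l) : IsHull n ψ (fun _ => c) :=
  ⟨fun _ _ _ _ => le_rfl, fun i hi => by simpa using hle i hi, by simpa using heq,
    fun _ _ h => absurd h (lt_irrefl _)⟩

/-- Every index lies in a segment on which the slope is constant and at the end points of which the
hull touches. -/
theorem IsHull.exists_segment {n : ℕ} {ψ σ : ℕ → ℝ} (h : IsHull n ψ σ) {i : ℕ} (hi : i < n) :
    ∃ i₁ i₂, i₁ ≤ i ∧ i < i₂ ∧ i₂ ≤ n ∧ (∀ l, i₁ ≤ l → l < i₂ → σ l = σ i) ∧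
      ∑ l ∈ Finset.range i₁, σ l = ∑ l ∈ Finset.range i₁, ψ l ∧
      ∑ l ∈ Finset.range i₂, σ l = ∑ l ∈ Finset.range i₂, ψ l := by
  classical
  let T : ℕ → Prop := fun j => ∑ l ∈ Finset.range j, σ l = ∑ l ∈ Finset.range j, ψ l
  have hstep : ∀ l, l + 1 < n → ¬ T (l + 1) → σ l = σ (l + 1) := by
    intro l hl hT
    by_contra hne
    exact hT (h.touch l hl (lt_of_le_of_ne (h.mono _ _ (by omega) hl) hne))
  have hex : ∃ j, i < j ∧ T j := ⟨n, hi, h.sum_eq⟩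
  have h2 := Nat.find_spec hex
  have h2n : Nat.find hex ≤ n := Nat.find_min' hex ⟨hi, h.sum_eq⟩
  have h2m : ∀ j, i < j → j < Nat.find hex → ¬ T j := fun j hj hj' hT =>
    Nat.find_min hex hj' ⟨hj, hT⟩
  have h1 : T (Nat.findGreatest T i) := Nat.findGreatest_spec (m := 0) (Nat.zero_le _) (by simp [T])
  have h1m : ∀ j, Nat.findGreatest T i < j → j ≤ i → ¬ T j := fun j hj hj' =>
    Nat.findGreatest_is_greatest hj hj'
  refine ⟨Nat.findGreatest T i, Nat.find hex, Nat.findGreatest_le i, h2.1, h2n, ?_, h1, h2.2⟩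
  have hall : ∀ d l, Nat.findGreatest T i ≤ l → l + d < Nat.find hex → σ l = σ (l + d) := by
    intro d
    induction d with
    | zero => intro l _ _; rfl
    | succ d ihd =>
      intro l hl hd
      rw [ihd l hl (by omega)]
      refine hstep (l + d) (by omega) ?_
      rcases le_or_gt (l + d + 1) i with h' | h'
      · exact h1m _ (by omega) h'
      · exact h2m _ h' (by omega)
  intro l hl hl2
  rcases le_total l i with hli | hli
  · obtain ⟨d, rfl⟩ := Nat.exists_eq_add_of_le hli
    exact hall d l hl h2.1
  · obtain ⟨d, rfl⟩ := Nat.exists_eq_add_of_le hli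
    exact (hall d i (Nat.findGreatest_le i) hl2).symm

/-! ### Envelopes of piecewise affine functions -/

/-- The polygon with slopes `σ` is the maximum of the lines through its edges, hence convex, and it
lies below `G` at the nodes, hence everywhere. Conversely, `u` lies between two nodes at which the
polygon touches `G` and between which it is affine, so no convex minorant of `G` exceeds it at `u`.
-/
theorem convEnv_eq_of_hull {ε : ℝ} (hε : 0 < ε) {G : ℝ → ℝ} {a : ℝ} {n : ℕ} {ψ σ : ℕ → ℝ}
    (hG : ∀ i < n, ∀ u ∈ Icc (a + i * ε) (a + (i + 1) * ε),
      G u = G (a + i * ε) + ψ i * (u - (a + i * ε)))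
    (hull : IsHull n ψ σ) {i : ℕ} (hi : i < n) {u : ℝ}
    (hu : u ∈ Icc (a + i * ε) (a + (i + 1) * ε)) :
    convEnv G a (a + n * ε) u =
      G a + ε * ∑ l ∈ Finset.range i, σ l + σ i * (u - (a + i * ε)) := by
  have hGnode : ∀ j ≤ n, G (a + j * ε) = G a + ε * ∑ l ∈ Finset.range j, ψ l := by
    intro j
    induction j with
    | zero => intro _; simp
    | succ j ih =>
      intro hj
      have := hG j (by omega) (a + (j + 1) * ε) ⟨by nlinarith, le_rfl⟩
      push_cast
      rw [this, ih (by omega), Finset.sum_range_succ]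
      ring
  let N : ℕ → ℝ := fun j => G a + ε * ∑ l ∈ Finset.range j, σ l
  let ℓ : ℕ → ℝ → ℝ := fun j x => N j + σ j * (x - (a + j * ε))
  have hNsucc : ∀ j, N (j + 1) = N j + ε * σ j := by
    intro j; simp only [N, Finset.sum_range_succ]; ring
  have hNle : ∀ j ≤ n, N j ≤ G (a + j * ε) := by
    intro j hj
    rw [hGnode j hj]
    have := mul_le_mul_of_nonneg_left (hull.sum_le j hj) hε.le
    simp only [N]; linarith
  have hup : ∀ i d, i + d ≤ n → i < n → ℓ i (a + (i + d : ℕ) * ε) ≤ N (i + d) := by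
    intro i d
    induction d with
    | zero => intro _ _; simp [ℓ]
    | succ d ih =>
      intro h1 h2
      have h3 := ih (by omega) h2
      have h4 := mul_le_mul_of_nonneg_left (hull.mono i (i + d) (by omega) (by omega)) hε.le
      rw [← add_assoc, hNsucc]
      simp only [ℓ] at h3 ⊢
      push_cast at h3 ⊢
      nlinarith
  have hdown : ∀ d j, j + d < n → ℓ (j + d) (a + j * ε) ≤ N j := by
    intro d
    induction d with
    | zero => intro j _; simp [ℓ]
    | succ d ih =>
      intro j h1
      have h3 := ih (j + 1) (by omega)
      have h4 := mul_le_mul_of_nonneg_left (hull.mono j (j + (d + 1)) (by omega) (by omega)) hε.le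
      have h5 : j + 1 + d = j + (d + 1) := by omega
      rw [h5, hNsucc] at h3
      simp only [ℓ] at h3 ⊢
      push_cast at h3 ⊢
      nlinarith
  have hnode : ∀ i < n, ∀ j ≤ n, ℓ i (a + j * ε) ≤ N j := by
    intro i hi j hj
    rcases le_total i j with h | h
    · obtain ⟨d, rfl⟩ := Nat.exists_eq_add_of_le h
      exact hup i d hj hi
    · obtain ⟨d, rfl⟩ := Nat.exists_eq_add_of_le h
      exact hdown d j hi
  have haff : ∀ (α β γ δ : ℝ) (j : ℕ) (x : ℝ), x ∈ Icc (a + j * ε) (a + (j + 1) * ε) →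
      α + β * (a + j * ε) ≤ γ + δ * (a + j * ε) →
      α + β * (a + (j + 1) * ε) ≤ γ + δ * (a + (j + 1) * ε) → α + β * x ≤ γ + δ * x := by
    intro α β γ δ j x hx h1 h2
    rcases le_total β δ with h | h
    · nlinarith [hx.1, hx.2]
    · nlinarith [hx.1, hx.2]
  have hℓle : ∀ i < n, ∀ j < n, ∀ x ∈ Icc (a + j * ε) (a + (j + 1) * ε), ℓ i x ≤ ℓ j x := by
    intro i hi j hj x hx
    have h1 := hnode i hi j hj.le
    have h2 := hnode i hi (j + 1) hj
    rw [hNsucc] at h2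
    push_cast at h2
    have := haff (N i - σ i * (a + i * ε)) (σ i) (N j - σ j * (a + j * ε)) (σ j) j x hx
      (by simp only [ℓ] at h1; linarith) (by simp only [ℓ] at h2; linarith)
    simp only [ℓ]; linarith
  have hℓG : ∀ j < n, ∀ x ∈ Icc (a + j * ε) (a + (j + 1) * ε), ℓ j x ≤ G x := by
    intro j hj x hx
    have h1 := hNle j hj.le
    have h2 := hNle (j + 1) hj
    have h3 := hG j hj (a + (j + 1) * ε) ⟨by nlinarith, le_rfl⟩
    rw [hG j hj x hx]
    rw [hNsucc] at h2
    push_cast at h2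
    rw [h3] at h2
    have := haff (N j - σ j * (a + j * ε)) (σ j) (G (a + j * ε) - ψ j * (a + j * ε)) (ψ j) j x hx
      (by linarith) (by linarith)
    simp only [ℓ]; linarith
  have hcell : ∀ x ∈ Icc a (a + n * ε), ∃ j < n, x ∈ Icc (a + j * ε) (a + (j + 1) * ε) := by
    intro x hx
    -- The right end point needs its own case: the floor would give the index `n`, which is no cell.
    rcases eq_or_lt_of_le hx.2 with h | h
    · refine ⟨n - 1, by omega, ?_⟩
      have : ((n - 1 : ℕ) : ℝ) = n - 1 := by rw [Nat.cast_sub (by omega)]; simp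
      rw [this, h]
      constructor <;> nlinarith
    · have hx0 : 0 ≤ (x - a) / ε := div_nonneg (by linarith [hx.1]) hε.le
      refine ⟨⌊(x - a) / ε⌋₊, ?_, ?_, ?_⟩
      · rw [Nat.floor_lt hx0, div_lt_iff₀ hε]; linarith
      · have := Nat.floor_le hx0
        rw [le_div_iff₀ hε] at this; linarith
      · have := (Nat.lt_floor_add_one ((x - a) / ε)).le
        rw [div_le_iff₀ hε] at this; linarith
  have hne : (Finset.range n).Nonempty := ⟨i, Finset.mem_range.2 hi⟩
  -- The candidate for the envelope is written as a maximum of lines, so that convexity is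
  -- immediate.
  let S : ℝ → ℝ := (Finset.range n).sup' hne ℓ
  have hSapp : ∀ x, S x = (Finset.range n).sup' hne (fun j => ℓ j x) := fun x => by
    simp [S, Finset.sup'_apply]
  have hS : ∀ j < n, ∀ x ∈ Icc (a + j * ε) (a + (j + 1) * ε), S x = ℓ j x := by
    intro j hj x hx
    rw [hSapp]
    refine le_antisymm (Finset.sup'_le _ _ fun i hi => hℓle i (Finset.mem_range.1 hi) j hj x hx) ?_
    exact Finset.le_sup' (fun j => ℓ j x) (Finset.mem_range.2 hj)
  have hSconv : ConvexOn ℝ (Icc a (a + n * ε)) S := by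
    refine Finset.sup'_induction hne ℓ (p := fun h => ConvexOn ℝ (Icc a (a + n * ε)) h)
      (fun _ h₁ _ h₂ => h₁.sup h₂) ?_
    intro j _
    refine ⟨convex_Icc _ _, fun x _ y _ α β _ _ hαβ => le_of_eq ?_⟩
    simp only [ℓ, smul_eq_mul]
    linear_combination (-(N j) + σ j * (a + j * ε)) * hαβ
  -- Maximality: after the slope `σ i` is subtracted, the polygon is constant between the touching
  -- nodes, and a convex function is at most the larger of its values at the two ends.
  have hval : ∀ h : ℝ → ℝ, ConvexOn ℝ (Icc a (a + n * ε)) h →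
      (∀ z ∈ Icc a (a + n * ε), h z ≤ G z) → h u ≤ ℓ i u := by
    intro h hc hle
    obtain ⟨i₁, i₂, h1, h2, h2n, hconst, ht1, ht2⟩ := hull.exists_segment hi
    have hmem : ∀ j ≤ n, a + j * ε ∈ Icc a (a + n * ε) := by
      intro j hj
      have : (j : ℝ) ≤ n := by exact_mod_cast hj
      constructor <;> nlinarith [(Nat.cast_nonneg j : (0 : ℝ) ≤ j)]
    have hsum : ∀ d, i₁ + d ≤ i₂ → N (i₁ + d) = N i₁ + ε * (d * σ i) := by
      intro d
      induction d with
      | zero => intro _; simp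
      | succ d ih =>
        intro hd
        rw [← add_assoc, hNsucc, ih (by omega), hconst (i₁ + d) (by omega) (by omega)]
        push_cast; ring
    have hbound : ∀ j ≤ n, ∑ l ∈ Finset.range j, σ l = ∑ l ∈ Finset.range j, ψ l →
        h (a + j * ε) ≤ N j := by
      intro j hj ht
      refine (hle _ (hmem j hj)).trans (le_of_eq ?_)
      rw [hGnode j hj, ← ht]
    have hb1 := hbound i₁ (by omega) ht1
    have hb2 := hbound i₂ h2n ht2
    have hNi : N i = N i₁ + ε * ((i - i₁ : ℝ) * σ i) := by
      have := hsum (i - i₁) (by omega)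
      rw [show i₁ + (i - i₁) = i by omega, Nat.cast_sub h1] at this
      exact this
    have hN2 : N i₂ = N i₁ + ε * ((i₂ - i₁ : ℝ) * σ i) := by
      have := hsum (i₂ - i₁) (by omega)
      rw [show i₁ + (i₂ - i₁) = i₂ by omega, Nat.cast_sub (by omega)] at this
      exact this
    have h1' : (i₁ : ℝ) ≤ i := by exact_mod_cast h1
    have h2' : (i : ℝ) + 1 ≤ i₂ := by exact_mod_cast h2
    have hx1 : a + i₁ * ε ≤ u := by nlinarith [hu.1]
    have hx2 : u ≤ a + i₂ * ε := by nlinarith [hu.2]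
    have hc' : ConvexOn ℝ (Icc a (a + n * ε)) (fun x => h x + (-σ i * x)) := by
      refine hc.add ⟨convex_Icc _ _, fun x _ y _ α β _ _ _ => le_of_eq ?_⟩
      simp only [smul_eq_mul]; ring
    have hmax := hc'.le_max_of_mem_Icc (hmem i₁ (by omega)) (hmem i₂ h2n) ⟨hx1, hx2⟩
    have hM : max (h (a + i₁ * ε) + (-σ i * (a + i₁ * ε)))
        (h (a + i₂ * ε) + (-σ i * (a + i₂ * ε))) ≤ N i - σ i * (a + i * ε) := by
      refine max_le ?_ ?_
      · rw [hNi]; linarith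
      · rw [hNi]; rw [hN2] at hb2; linarith
    simp only [ℓ]
    linarith
  have huab : u ∈ Icc a (a + n * ε) := by
    have h1 : (0 : ℝ) ≤ i := Nat.cast_nonneg i
    have h2 : (i : ℝ) + 1 ≤ n := by exact_mod_cast hi
    constructor
    · nlinarith [hu.1]
    · nlinarith [hu.2]
  refine IsGreatest.csSup_eq ⟨⟨S, hSconv, ?_, hS i hi u hu⟩, ?_⟩
  · intro z hz
    obtain ⟨j, hj, hzj⟩ := hcell z hz
    rw [hS j hj z hzj]
    exact hℓG j hj z hzj
  · rintro y ⟨h, hc, hle, rfl⟩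
    exact hval h hc hle

theorem deriv_convEnv_of_hull {ε : ℝ} (hε : 0 < ε) {G : ℝ → ℝ} {a : ℝ} {n : ℕ} {ψ σ : ℕ → ℝ}
    (hG : ∀ i < n, ∀ u ∈ Icc (a + i * ε) (a + (i + 1) * ε),
      G u = G (a + i * ε) + ψ i * (u - (a + i * ε)))
    (hull : IsHull n ψ σ) {i : ℕ} (hi : i < n) :
    deriv (convEnv G a (a + n * ε)) (a + (i + 1 / 2) * ε) = σ i := by
  have hev : convEnv G a (a + n * ε) =ᶠ[nhds (a + (i + 1 / 2) * ε)]
      fun u => G a + ε * ∑ l ∈ Finset.range i, σ l + σ i * (u - (a + i * ε)) := by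
    filter_upwards [Icc_mem_nhds (a := a + i * ε) (b := a + (i + 1) * ε)
      (by nlinarith) (by nlinarith)] with u hu
    exact convEnv_eq_of_hull hε hG hull hi hu
  rw [hev.deriv_eq]
  have : HasDerivAt (fun u : ℝ => G a + ε * ∑ l ∈ Finset.range i, σ l + σ i * (u - (a + i * ε)))
      (σ i * 1) (a + (i + 1 / 2) * ε) :=
    (((hasDerivAt_id _).sub_const _).const_mul _).const_add _
  rw [this.deriv, mul_one]

/-- The point reflection keeps slopes and reverses the order of the cells. Read from its right end,
a concave envelope therefore has nondecreasing slopes, and one notion of hull serves both signs. -/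
theorem concEnv_eq_neg_convEnv (G : ℝ → ℝ) (a b u : ℝ) :
    concEnv G a b u = -convEnv (fun x => -G (-x)) (-b) (-a) (-u) := by
  unfold concEnv convEnv
  rw [← Real.sInf_neg]
  congr 1
  have hreflect : ∀ {h : ℝ → ℝ} {c d : ℝ}, ConvexOn ℝ (Icc c d) h →
      ConcaveOn ℝ (Icc (-d) (-c)) (fun x => -h (-x)) := by
    intro h c d hh
    refine ⟨convex_Icc _ _, fun x hx y hy α β hα hβ hαβ => ?_⟩
    have := hh.2 (x := -x) ⟨by linarith [hx.2], by linarith [hx.1]⟩ (y := -y)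
      ⟨by linarith [hy.2], by linarith [hy.1]⟩ hα hβ hαβ
    simp only [smul_eq_mul] at this ⊢
    rw [show -(α * x + β * y) = α * -x + β * -y by ring]
    linarith
  ext y
  simp only [mem_ofPred_eq, Set.mem_neg]
  constructor
  · rintro ⟨h, hc, hle, rfl⟩
    refine ⟨fun x => -h (-x), ?_, fun z hz => ?_, by simp⟩
    · refine ⟨convex_Icc _ _, fun x hx y hy α β hα hβ hαβ => ?_⟩
      have := hc.2 (x := -x) ⟨by linarith [hx.2], by linarith [hx.1]⟩ (y := -y)
        ⟨by linarith [hy.2], by linarith [hy.1]⟩ hα hβ hαβ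
      simp only [smul_eq_mul] at this ⊢
      rw [show -(α * x + β * y) = α * -x + β * -y by ring]
      linarith
    · have := hle (-z) ⟨by linarith [hz.2], by linarith [hz.1]⟩
      simpa using this
  · rintro ⟨h, hc, hle, hy⟩
    refine ⟨fun x => -h (-x), ?_, fun z hz => ?_, by simp [hy]⟩
    · simpa using hreflect hc
    · have := hle (-z) ⟨by linarith [hz.2], by linarith [hz.1]⟩
      simp only [neg_neg] at this
      linarith

theorem deriv_concEnv_of_hull {ε : ℝ} (hε : 0 < ε) {G : ℝ → ℝ} {a : ℝ} {n : ℕ} {ψ σ : ℕ → ℝ}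
    (hG : ∀ i < n, ∀ u ∈ Icc (a - (i + 1) * ε) (a - i * ε),
      G u = G (a - i * ε) + ψ i * (u - (a - i * ε)))
    (hull : IsHull n ψ σ) {i : ℕ} (hi : i < n) :
    deriv (concEnv G (a - n * ε) a) (a - (i + 1 / 2) * ε) = σ i := by
  have h1 : concEnv G (a - n * ε) a =
      fun u => -convEnv (fun x => -G (-x)) (-a) (-a + n * ε) (-u) := by
    ext u
    rw [concEnv_eq_neg_convEnv]
    congr 2
    ring
  rw [h1, deriv.fun_neg, deriv_comp_neg, neg_neg,
    show -(a - (i + 1 / 2) * ε) = -a + (i + 1 / 2) * ε by ring]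
  refine deriv_convEnv_of_hull hε (fun i hi u hu => ?_) hull hi
  have := hG i hi (-u) ⟨by linarith [hu.2], by linarith [hu.1]⟩
  rw [this, show -(-a + i * ε) = a - i * ε by ring]
  ring

theorem gridInterp_eq {ε : ℝ} (hε : 0 < ε) (g : ℝ → ℝ) (k : ℤ) {u : ℝ}
    (hu : u ∈ Icc (k * ε) ((k + 1) * ε)) :
    gridInterp ε g u = g (k * ε) + (g ((k + 1) * ε) - g (k * ε)) / ε * (u - k * ε) := by
  -- At the right end point the floor is already `k + 1`, and both formulas give the value at that
  -- node.
  rcases eq_or_lt_of_le hu.2 with h | h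
  · have hf : ⌊u / ε⌋ = k + 1 := by
      rw [h, mul_div_cancel_right₀ _ hε.ne']
      exact_mod_cast Int.floor_intCast (k + 1)
    have hd : u / ε = k + 1 := by rw [h, mul_div_cancel_right₀ _ hε.ne']
    unfold gridInterp
    rw [hf, hd, h]
    push_cast
    field_simp
    ring
  · have hf : ⌊u / ε⌋ = k := by
      rw [Int.floor_eq_iff, le_div_iff₀ hε, div_lt_iff₀ hε]
      exact ⟨hu.1, h⟩
    unfold gridInterp
    rw [hf]
    field_simp

/-! ### The quadratic potential of a system of waves -/

/-- A system of waves on an ordered line, observed at the times `t 0, …, t J`: the finite sets of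
the waves which are alive, their positions `X` and speeds `σ`, their signs and cells; `φ z s` is the
slope on the cell of `s` of the flux seen at the label `z = X + t`, and `T z` is the variation
of the flux parameter beyond `z`. -/
structure WaveDynamics (J : ℕ) where
  W : ℕ → Finset ℕ
  X : ℕ → ℕ → ℝ
  σ : ℕ → ℕ → ℝ
  t : ℕ → ℝ
  sgn : ℕ → ℤ
  k : ℕ → ℤ
  φ : ℝ → ℕ → ℝ
  T : ℝ → ℝ
  ε : ℝ
  K : ℝ
  M : ℝ
  Tinf : ℝ
  ε_nonneg : 0 ≤ ε
  K_nonneg : 0 ≤ K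
  M_nonneg : 0 ≤ M
  T_anti : Antitone T
  T_le : ∀ z, T z ≤ Tinf
  mono_pos : ∀ j ≤ J, ∀ s ∈ W j, ∀ s' ∈ W j, s ≤ s' → X j s ≤ X j s'
  sgn_eq : ∀ j ≤ J, ∀ s ∈ W j, ∀ s' ∈ W j, X j s = X j s' → sgn s = sgn s'
  dist_add : ∀ j ≤ J, ∀ s ∈ W j, ∀ m ∈ W j, ∀ s' ∈ W j, s ≤ m → m ≤ s' →
    (∀ i ∈ W j, s ≤ i → i ≤ s' → sgn i = sgn s) → |k s - k s'| = |k s - k m| + |k m - k s'|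
  speed_mono : ∀ j ≤ J, ∀ s ∈ W j, ∀ s' ∈ W j, X j s = X j s' → s ≤ s' → σ j s ≤ σ j s'
  -- `A` is a final part of the waves at `y` with speed at most `c`. At its right end the envelope
  -- touches the flux, at its left end it lies on the side which gives this inequality; `head` is
  -- the mirror image.
  tail : ∀ j ≤ J, ∀ (y c : ℝ) (A : Finset ℕ), (∀ s ∈ A, s ∈ W j ∧ X j s = y ∧ σ j s ≤ c) →
    (∀ s ∈ A, ∀ i ∈ W j, X j i = y → s ≤ i → σ j i ≤ c → i ∈ A) →
    ∑ s ∈ A, φ (y + t j) s ≤ ∑ s ∈ A, σ j s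
  head : ∀ j ≤ J, ∀ (y c : ℝ) (A : Finset ℕ), (∀ s ∈ A, s ∈ W j ∧ X j s = y ∧ c ≤ σ j s) →
    (∀ s ∈ A, ∀ i ∈ W j, X j i = y → i ≤ s → c ≤ σ j i → i ∈ A) →
    ∑ s ∈ A, σ j s ≤ ∑ s ∈ A, φ (y + t j) s
  alive_succ : ∀ j < J, W (j + 1) ⊆ W j
  label_mono : ∀ j < J, ∀ s ∈ W (j + 1), X j s + t j ≤ X (j + 1) s + t (j + 1)
  pos_succ : ∀ j < J, ∀ s ∈ W (j + 1), ∀ s' ∈ W (j + 1), X j s = X j s' → σ j s = σ j s' →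
    X (j + 1) s = X (j + 1) s'
  -- Only opposite waves cancel. The witness `m` is a wave of the opposite wavefront; it separates
  -- the survivors at the collision point from everything further right.
  cancel_right : ∀ j < J, ∀ s ∈ W (j + 1), ∀ i ∈ W j, s ≤ i → X j i = X j s → σ j i = σ j s →
    i ∉ W (j + 1) → ∃ m ∈ W j, sgn m ≠ sgn s ∧
      (∀ s₀ ∈ W (j + 1), X (j + 1) s₀ = X (j + 1) s → s₀ ≤ m) ∧
      ∀ s' ∈ W (j + 1), X (j + 1) s < X (j + 1) s' → m ≤ s'
  cancel_left : ∀ j < J, ∀ s ∈ W (j + 1), ∀ i ∈ W j, i ≤ s → X j i = X j s → σ j i = σ j s →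
    i ∉ W (j + 1) → ∃ m ∈ W j, sgn m ≠ sgn s ∧
      (∀ s₀ ∈ W (j + 1), X (j + 1) s₀ = X (j + 1) s → m ≤ s₀) ∧
      ∀ s' ∈ W (j + 1), X (j + 1) s' < X (j + 1) s → s' ≤ m
  flux_le : ∀ z s s', φ z s - φ z s' ≤ K * (|k s - k s'| * ε)
  flux_diff_le : ∀ z z', z ≤ z' → ∀ s s', φ z' s - φ z' s' ≤
    φ z s - φ z s' + M * (T z - T z') * (|k s - k s'| * ε)

namespace WaveDynamics

/-! ### The weight of a pair of waves. -/

variable {J : ℕ} (D : WaveDynamics J)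

open Classical in
/-- The weight of a pair of waves: the variation of the flux which is still to be met, counted from
the last label at which the two waves had the same position. -/
noncomputable def pot : ℕ → ℕ → ℕ → ℝ
  | 0, s, s' => if s ∈ D.W 0 ∧ s' ∈ D.W 0 ∧ D.X 0 s = D.X 0 s' then D.M * D.T (D.X 0 s + D.t 0)
      else D.K + D.M * D.Tinf
  | j + 1, s, s' => if s ∈ D.W (j + 1) ∧ s' ∈ D.W (j + 1) ∧ D.X (j + 1) s = D.X (j + 1) s' then
      D.M * D.T (D.X (j + 1) s + D.t (j + 1)) else pot j s s'

variable {D}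

theorem pot_together {j s s' : ℕ} (hs : s ∈ D.W j) (hs' : s' ∈ D.W j) (h : D.X j s = D.X j s') :
    D.pot j s s' = D.M * D.T (D.X j s + D.t j) := by
  cases j <;> simp [pot, hs, hs', h]

theorem pot_succ_apart {j s s' : ℕ} (h : D.X (j + 1) s ≠ D.X (j + 1) s') :
    D.pot (j + 1) s s' = D.pot j s s' := by
  simp [pot, h]

theorem T_mul_le (z : ℝ) : D.M * D.T z ≤ D.K + D.M * D.Tinf := by
  have := mul_le_mul_of_nonneg_left (D.T_le z) D.M_nonneg
  linarith [D.K_nonneg]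

/-- Labels grow and `T` decreases, so the present value of `M T` is at most the one frozen at the
last common label. -/
theorem T_label_le_pot {j : ℕ} (hj : j ≤ J) : ∀ {s s' : ℕ}, s ∈ D.W j → s' ∈ D.W j →
    D.M * D.T (D.X j s + D.t j) ≤ D.pot j s s' := by
  induction j with
  | zero =>
    intro s s' hs hs'
    by_cases h : D.X 0 s = D.X 0 s'
    · rw [pot_together hs hs' h]
    · simpa [pot, h] using T_mul_le _
  | succ j ih =>
    intro s s' hs hs'
    by_cases h : D.X (j + 1) s = D.X (j + 1) s'
    · rw [pot_together hs hs' h]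
    · rw [pot_succ_apart h]
      have := ih (by omega) (D.alive_succ j hj hs) (D.alive_succ j hj hs')
      exact (mul_le_mul_of_nonneg_left (D.T_anti (D.label_mono j hj s hs)) D.M_nonneg).trans this

theorem pot_zero_le (s s' : ℕ) : D.pot 0 s s' ≤ D.K + D.M * D.Tinf := by
  simp only [pot]
  split_ifs
  · exact T_mul_le _
  · exact le_rfl

theorem pot_succ_le {j : ℕ} (hj : j < J) (s s' : ℕ) : D.pot (j + 1) s s' ≤ D.pot j s s' := by
  by_cases h : s ∈ D.W (j + 1) ∧ s' ∈ D.W (j + 1) ∧ D.X (j + 1) s = D.X (j + 1) s'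
  · obtain ⟨hs, hs', h⟩ := h
    rw [pot_together hs hs' h]
    exact (mul_le_mul_of_nonneg_left (D.T_anti (D.label_mono j hj s hs)) D.M_nonneg).trans
      (T_label_le_pot hj.le (D.alive_succ j hj hs) (D.alive_succ j hj hs'))
  · simp only [pot]
    rw [if_neg h]

theorem pot_nonneg (hT : ∀ z, 0 ≤ D.T z) (j s s' : ℕ) : 0 ≤ D.pot j s s' := by
  have h0 : 0 ≤ D.Tinf := (hT 0).trans (D.T_le 0)
  induction j with
  | zero =>
    simp only [pot]
    split_ifs
    · exact mul_nonneg D.M_nonneg (hT _)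
    · exact add_nonneg D.K_nonneg (mul_nonneg D.M_nonneg h0)
  | succ j ih =>
    simp only [pot]
    split_ifs
    · exact mul_nonneg D.M_nonneg (hT _)
    · exact ih

theorem pos_eq_of_mem {j s m s' : ℕ} (hj : j ≤ J) (hs : s ∈ D.W j) (hm : m ∈ D.W j)
    (hs' : s' ∈ D.W j) (h1 : s ≤ m) (h2 : m ≤ s') (h : D.X j s = D.X j s') :
    D.X j m = D.X j s :=
  le_antisymm (h ▸ D.mono_pos j hj m hm s' hs' h2) (D.mono_pos j hj s hs m hm h1)

/-- Whenever the outer waves are at the same position, so is every living wave between them. The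
inner pairs have thus been together at least as recently. -/
theorem pot_inclusion {j : ℕ} (hj : j ≤ J) : ∀ {s m s' : ℕ}, s ∈ D.W j → m ∈ D.W j → s' ∈ D.W j →
    s ≤ m → m ≤ s' → D.pot j s m ≤ D.pot j s s' ∧ D.pot j m s' ≤ D.pot j s s' := by
  induction j with
  | zero =>
    intro s m s' hs hm hs' h1 h2
    by_cases h : D.X 0 s = D.X 0 s'
    · have h3 := pos_eq_of_mem hj hs hm hs' h1 h2 h
      rw [pot_together hs hs' h, pot_together hs hm h3.symm, pot_together hm hs' (h3.trans h), h3]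
      exact ⟨le_rfl, le_rfl⟩
    · have : D.pot 0 s s' = D.K + D.M * D.Tinf := by simp [pot, h]
      rw [this]
      exact ⟨pot_zero_le _ _, pot_zero_le _ _⟩
  | succ j ih =>
    intro s m s' hs hm hs' h1 h2
    by_cases h : D.X (j + 1) s = D.X (j + 1) s'
    · have h3 := pos_eq_of_mem hj hs hm hs' h1 h2 h
      rw [pot_together hs hs' h, pot_together hs hm h3.symm, pot_together hm hs' (h3.trans h), h3]
      exact ⟨le_rfl, le_rfl⟩
    · have hi := ih (by omega) (D.alive_succ j hj hs) (D.alive_succ j hj hm)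
        (D.alive_succ j hj hs') h1 h2
      rw [pot_succ_apart h]
      exact ⟨(pot_succ_le hj s m).trans hi.1, (pot_succ_le hj m s').trans hi.2⟩

/-- A wave between two others that is alive now has been alive and between them at all earlier
times. If its sign is opposite, it has kept the two apart since the beginning, so their weight is
still the initial one. -/
theorem pot_of_opposite {j : ℕ} (hj : j ≤ J) : ∀ {s m s' : ℕ}, s ∈ D.W j → m ∈ D.W j →
    s' ∈ D.W j → s ≤ m → m ≤ s' → D.sgn m ≠ D.sgn s → D.pot j s s' = D.K + D.M * D.Tinf := by
  induction j with
  | zero =>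
    intro s m s' hs hm hs' h1 h2 hne
    have h : D.X 0 s ≠ D.X 0 s' := fun h =>
      hne (D.sgn_eq 0 hj m hm s hs (pos_eq_of_mem hj hs hm hs' h1 h2 h))
    simp [pot, h]
  | succ j ih =>
    intro s m s' hs hm hs' h1 h2 hne
    have h : D.X (j + 1) s ≠ D.X (j + 1) s' := fun h =>
      hne (D.sgn_eq _ hj m hm s hs (pos_eq_of_mem hj hs hm hs' h1 h2 h))
    rw [pot_succ_apart h]
    exact ih (by omega) (D.alive_succ j hj hs) (D.alive_succ j hj hm) (D.alive_succ j hj hs')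
      h1 h2 hne

theorem pot_of_opposite' {j : ℕ} (hj : j ≤ J) {s m s' : ℕ} (hs : s ∈ D.W j) (hm : m ∈ D.W j)
    (hs' : s' ∈ D.W j) (h1 : s ≤ m) (h2 : m ≤ s') (hne : D.sgn m ≠ D.sgn s') :
    D.pot j s s' = D.K + D.M * D.Tinf := by
  by_cases h : D.sgn m = D.sgn s
  · exact pot_of_opposite hj hs hs' hs' (h1.trans h2) le_rfl (fun h' => hne (h.trans h'.symm))
  · exact pot_of_opposite hj hs hm hs' h1 h2 h

/-! ### The excess of a pair of waves. -/

variable (D) in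
/-- The difference of the slopes on the cells of `s` and `s'`, seen at the label `z`, minus what the
weight of the pair allows. -/
noncomputable def excess (j : ℕ) (z : ℝ) (s s' : ℕ) : ℝ :=
  D.φ z s - D.φ z s' - (D.pot j s s' - D.M * D.T z) * (|D.k s - D.k s'| * D.ε)

theorem dist_nonneg (s s' : ℕ) : (0 : ℝ) ≤ |D.k s - D.k s'| * D.ε :=
  mul_nonneg (by positivity) D.ε_nonneg

/-- The initial weight minus `M T z` is still at least `K`, the Lipschitz constant of the slopes. -/
theorem excess_nonpos_of_pot_eq {j : ℕ} {z : ℝ} {s s' : ℕ}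
    (h : D.pot j s s' = D.K + D.M * D.Tinf) : D.excess j z s s' ≤ 0 := by
  have h1 := D.flux_le z s s'
  have h2 : D.K ≤ D.pot j s s' - D.M * D.T z := by
    have := mul_le_mul_of_nonneg_left (D.T_le z) D.M_nonneg
    linarith
  have := mul_le_mul_of_nonneg_right h2 (dist_nonneg (D := D) s s')
  unfold excess
  linarith

/-- The slope differences telescope, the distances add because there is no change of sign in
between, and the two inner weights are at most the outer one. -/
theorem excess_triangle {j : ℕ} (hj : j ≤ J) {z : ℝ} {s m s' : ℕ} (hs : s ∈ D.W j)
    (hm : m ∈ D.W j) (hs' : s' ∈ D.W j) (h1 : s ≤ m) (h2 : m ≤ s')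
    (hsgn : ∀ i ∈ D.W j, s ≤ i → i ≤ s' → D.sgn i = D.sgn s) :
    D.excess j z s s' ≤ D.excess j z s m + D.excess j z m s' := by
  obtain ⟨hp1, hp2⟩ := pot_inclusion hj hs hm hs' h1 h2
  have hd := D.dist_add j hj s hs m hm s' hs' h1 h2 hsgn
  have hd' : (|D.k s - D.k s'| : ℤ) * D.ε =
      (|D.k s - D.k m| : ℤ) * D.ε + (|D.k m - D.k s'| : ℤ) * D.ε := by
    rw [hd]; push_cast; ring
  have e1 := mul_le_mul_of_nonneg_right hp1 (dist_nonneg (D := D) s m)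
  have e2 := mul_le_mul_of_nonneg_right hp2 (dist_nonneg (D := D) m s')
  unfold excess
  rw [hd']
  linarith

/-- The triangle inequality is summed over all triples, that is, averaged over the intermediate
group `C`. -/
theorem sum_chain_nonpos {H : ℕ → ℕ → ℝ} {A C B : Finset ℕ} (hC : C.Nonempty)
    (hH : ∀ s ∈ A, ∀ m ∈ C, ∀ s' ∈ B, H s s' ≤ H s m + H m s')
    (h1 : ∑ s ∈ A, ∑ m ∈ C, H s m ≤ 0) (h2 : ∑ m ∈ C, ∑ s' ∈ B, H m s' ≤ 0) :
    ∑ s ∈ A, ∑ s' ∈ B, H s s' ≤ 0 := by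
  have hsum : ∑ s ∈ A, ∑ m ∈ C, ∑ s' ∈ B, H s s' ≤
      ∑ s ∈ A, ∑ m ∈ C, ∑ s' ∈ B, (H s m + H m s') :=
    Finset.sum_le_sum fun s hs => Finset.sum_le_sum fun m hm => Finset.sum_le_sum fun s' hs' =>
      hH s hs m hm s' hs'
  have e1 : ∑ s ∈ A, ∑ m ∈ C, ∑ s' ∈ B, H s s' = C.card * ∑ s ∈ A, ∑ s' ∈ B, H s s' := by
    rw [Finset.mul_sum]
    exact Finset.sum_congr rfl fun s _ => by simp
  have e2 : ∑ s ∈ A, ∑ m ∈ C, ∑ s' ∈ B, (H s m + H m s') =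
      B.card * ∑ s ∈ A, ∑ m ∈ C, H s m + A.card * ∑ m ∈ C, ∑ s' ∈ B, H m s' := by
    simp only [Finset.sum_add_distrib, Finset.sum_const, nsmul_eq_mul, Finset.mul_sum]
  rw [e1, e2] at hsum
  have hCpos : (0 : ℝ) < C.card := by exact_mod_cast hC.card_pos
  have h3 : (C.card : ℝ) * ∑ s ∈ A, ∑ s' ∈ B, H s s' ≤ 0 := by
    have := mul_nonpos_of_nonneg_of_nonpos (Nat.cast_nonneg B.card : (0 : ℝ) ≤ B.card) h1
    have := mul_nonpos_of_nonneg_of_nonpos (Nat.cast_nonneg A.card : (0 : ℝ) ≤ A.card) h2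
    linarith
  exact nonpos_of_mul_nonpos_right h3 hCpos

/-- The weight of such a pair is `M T` at the present label, which is what moving the slopes from
`z` back to that label costs. There the mean slope of `A` is at most its mean speed, and the mean
speed of `B` is at most its mean slope. -/
theorem sum_excess_same_pos {j : ℕ} {y z : ℝ} (hz : y + D.t j ≤ z) {A B : Finset ℕ}
    (hA : ∀ s ∈ A, s ∈ D.W j ∧ D.X j s = y) (hB : ∀ s ∈ B, s ∈ D.W j ∧ D.X j s = y)
    (hAB : ∀ s ∈ A, ∀ s' ∈ B, D.σ j s ≤ D.σ j s')
    (h1 : ∑ s ∈ A, D.φ (y + D.t j) s ≤ ∑ s ∈ A, D.σ j s)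
    (h2 : ∑ s ∈ B, D.σ j s ≤ ∑ s ∈ B, D.φ (y + D.t j) s) :
    ∑ s ∈ A, ∑ s' ∈ B, D.excess j z s s' ≤ 0 := by
  have hle : ∀ s ∈ A, ∀ s' ∈ B, D.excess j z s s' ≤ D.φ (y + D.t j) s - D.φ (y + D.t j) s' := by
    intro s hs s' hs'
    have := D.flux_diff_le _ _ hz s s'
    unfold excess
    rw [pot_together (hA s hs).1 (hB s' hs').1 ((hA s hs).2.trans (hB s' hs').2.symm), (hA s hs).2]
    linarith
  refine (Finset.sum_le_sum fun s hs => Finset.sum_le_sum fun s' hs' => hle s hs s' hs').trans ?_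
  have e : ∀ g : ℕ → ℝ, ∑ s ∈ A, ∑ s' ∈ B, (g s - g s') =
      B.card * ∑ s ∈ A, g s - A.card * ∑ s' ∈ B, g s' := by
    intro g
    simp only [Finset.sum_sub_distrib, Finset.sum_const, nsmul_eq_mul, Finset.mul_sum]
  rw [e]
  have h3 : ∑ s ∈ A, ∑ s' ∈ B, (D.σ j s - D.σ j s') ≤ 0 :=
    Finset.sum_nonpos fun s hs => Finset.sum_nonpos fun s' hs' => by
      linarith [hAB s hs s' hs']
  rw [e] at h3
  have h4 := mul_le_mul_of_nonneg_left h1 (Nat.cast_nonneg B.card : (0 : ℝ) ≤ B.card)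
  have h5 := mul_le_mul_of_nonneg_left h2 (Nat.cast_nonneg A.card : (0 : ℝ) ≤ A.card)
  linarith

/-! ### Ordering of groups and of wavefronts. -/

variable (D) in
/-- Between two groups of waves at different positions the total excess of a final part of
the first and an initial part of the second one is not positive. -/
def GroupOrdered (j : ℕ) : Prop :=
  ∀ (y y' z : ℝ) (A B : Finset ℕ), y < y' → y' + D.t j ≤ z →
    (∀ s ∈ A, s ∈ D.W j ∧ D.X j s = y) → (∀ s ∈ B, s ∈ D.W j ∧ D.X j s = y') →
    (∀ s ∈ A, ∀ i ∈ D.W j, D.X j i = y → s ≤ i → i ∈ A) →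
    (∀ s ∈ B, ∀ i ∈ D.W j, D.X j i = y' → i ≤ s → i ∈ B) →
    ∑ s ∈ A, ∑ s' ∈ B, D.excess j z s s' ≤ 0

variable (D) in
/-- The same as `GroupOrdered` for two wavefronts. -/
def FrontOrdered (j : ℕ) : Prop :=
  ∀ (y c y' c' z : ℝ) (A B : Finset ℕ), y < y' ∨ (y = y' ∧ c < c') → y' + D.t j ≤ z →
    (∀ s ∈ A, s ∈ D.W j ∧ D.X j s = y ∧ D.σ j s = c) →
    (∀ s ∈ B, s ∈ D.W j ∧ D.X j s = y' ∧ D.σ j s = c') →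
    (∀ s ∈ A, ∀ i ∈ D.W j, D.X j i = y → D.σ j i = c → s ≤ i → i ∈ A) →
    (∀ s ∈ B, ∀ i ∈ D.W j, D.X j i = y' → D.σ j i = c' → i ≤ s → i ∈ B) →
    ∑ s ∈ A, ∑ s' ∈ B, D.excess j z s s' ≤ 0

theorem groupOrdered_zero : D.GroupOrdered 0 := by
  intro y y' z A B hy _ hA hB _ _
  refine Finset.sum_nonpos fun s hs => Finset.sum_nonpos fun s' hs' => excess_nonpos_of_pot_eq ?_
  have : D.X 0 s ≠ D.X 0 s' := by rw [(hA s hs).2, (hB s' hs').2]; exact hy.ne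
  simp [pot, this]

theorem lt_of_pos_lt {j s s' : ℕ} (hj : j ≤ J) (hs : s ∈ D.W j) (hs' : s' ∈ D.W j)
    (h : D.X j s < D.X j s') : s < s' := by
  by_contra hle
  exact absurd (D.mono_pos j hj s' hs' s hs (not_lt.1 hle)) (not_le.2 h)

theorem lt_of_speed_lt {j s s' : ℕ} (hj : j ≤ J) (hs : s ∈ D.W j) (hs' : s' ∈ D.W j)
    (hX : D.X j s = D.X j s') (h : D.σ j s < D.σ j s') : s < s' := by
  by_contra hle
  exact absurd (D.speed_mono j hj s' hs' s hs hX.symm (not_lt.1 hle)) (not_le.2 h)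

theorem tail_front {j : ℕ} (hj : j ≤ J) {y c : ℝ} {A : Finset ℕ}
    (hA : ∀ s ∈ A, s ∈ D.W j ∧ D.X j s = y ∧ D.σ j s = c)
    (hA' : ∀ s ∈ A, ∀ i ∈ D.W j, D.X j i = y → D.σ j i = c → s ≤ i → i ∈ A) :
    ∑ s ∈ A, D.φ (y + D.t j) s ≤ ∑ s ∈ A, D.σ j s :=
  D.tail j hj y c A (fun s hs => ⟨(hA s hs).1, (hA s hs).2.1, (hA s hs).2.2.le⟩)
    fun s hs i hi hX hsi hσ => hA' s hs i hi hX (le_antisymm hσ ((hA s hs).2.2 ▸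
      D.speed_mono j hj s (hA s hs).1 i hi ((hA s hs).2.1.trans hX.symm) hsi)) hsi

theorem head_front {j : ℕ} (hj : j ≤ J) {y c : ℝ} {B : Finset ℕ}
    (hB : ∀ s ∈ B, s ∈ D.W j ∧ D.X j s = y ∧ D.σ j s = c)
    (hB' : ∀ s ∈ B, ∀ i ∈ D.W j, D.X j i = y → D.σ j i = c → i ≤ s → i ∈ B) :
    ∑ s ∈ B, D.σ j s ≤ ∑ s ∈ B, D.φ (y + D.t j) s :=
  D.head j hj y c B (fun s hs => ⟨(hB s hs).1, (hB s hs).2.1, (hB s hs).2.2.ge⟩)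
    fun s hs i hi hX hsi hσ => hB' s hs i hi hX (le_antisymm ((hB s hs).2.2 ▸
      D.speed_mono j hj i hi s (hB s hs).1 (hX.trans (hB s hs).2.1.symm) hsi) hσ) hsi

/-- A wavefront need not be at the end of its group. The waves faster than `A` in the left group
form a final part of that group and serve as intermediate waves; then the waves slower than `B` in
the right group do the same on the other side. -/
theorem GroupOrdered.frontOrdered {j : ℕ} (hj : j ≤ J) (hG : D.GroupOrdered j) :
    D.FrontOrdered j := by
  classical
  intro y c y' c' z A B hlt hz hA hB hA' hB'
  have hAφ := tail_front hj hA hA'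
  have hBφ := head_front hj hB hB'
  rcases hlt with hy | ⟨rfl, hc⟩
  swap
  · exact sum_excess_same_pos hz (fun s hs => ⟨(hA s hs).1, (hA s hs).2.1⟩)
      (fun s hs => ⟨(hB s hs).1, (hB s hs).2.1⟩)
      (fun s hs s' hs' => by rw [(hA s hs).2.2, (hB s' hs').2.2]; exact hc.le) hAφ hBφ
  -- If a sign changes between the two groups, every single pair has its initial weight. Otherwise
  -- the triangle inequality holds throughout.
  by_cases hopp : ∃ s ∈ D.W j, ∃ m ∈ D.W j, ∃ s' ∈ D.W j, D.X j s = y ∧ D.X j s' = y' ∧ s ≤ m ∧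
      m ≤ s' ∧ D.sgn m ≠ D.sgn s
  · obtain ⟨s₀, hs₀, m, hm, s₁, hs₁, hX₀, hX₁, h1, h2, hne⟩ := hopp
    refine Finset.sum_nonpos fun s hs => Finset.sum_nonpos fun s' hs' =>
      excess_nonpos_of_pot_eq ?_
    obtain ⟨hsW, hsX, -⟩ := hA s hs
    obtain ⟨hsW', hsX', -⟩ := hB s' hs'
    have hss : D.sgn s = D.sgn s₀ := D.sgn_eq j hj s hsW s₀ hs₀ (hsX.trans hX₀.symm)
    have hss' : D.sgn s' = D.sgn s₁ := D.sgn_eq j hj s' hsW' s₁ hs₁ (hsX'.trans hX₁.symm)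
    have hmy : D.X j m ≠ y := fun h => hne (D.sgn_eq j hj m hm s₀ hs₀ (h.trans hX₀.symm))
    have hsm : s ≤ m := (lt_of_pos_lt hj hsW hm (hsX ▸ lt_of_le_of_ne
      (hX₀ ▸ D.mono_pos j hj s₀ hs₀ m hm h1) hmy.symm)).le
    have hslt : s ≤ s' := (lt_of_pos_lt hj hsW hsW' (by rw [hsX, hsX']; exact hy)).le
    by_cases hmy' : D.X j m = y'
    -- The wave of opposite sign belongs to the right group, so `s'` itself can take its place.
    · refine pot_of_opposite hj hsW hsW' hsW' hslt le_rfl ?_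
      rw [hss, D.sgn_eq j hj s' hsW' m hm (hsX'.trans hmy'.symm)]
      exact hne
    · have hms' : m ≤ s' := (lt_of_pos_lt hj hm hsW' (hsX' ▸ lt_of_le_of_ne
        (hX₁ ▸ D.mono_pos j hj m hm s₁ hs₁ h2) hmy')).le
      exact pot_of_opposite hj hsW hm hsW' hsm hms' (hss ▸ hne)
  push Not at hopp
  have htri : ∀ s ∈ D.W j, ∀ m ∈ D.W j, ∀ s' ∈ D.W j, D.X j s = y → D.X j s' = y' → s ≤ m →
      m ≤ s' → D.excess j z s s' ≤ D.excess j z s m + D.excess j z m s' :=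
    fun s hs m hm s' hs' hX hX' h1 h2 => excess_triangle hj hs hm hs' h1 h2
      fun i hi hi1 hi2 => hopp s hs i hi s' hs' hX hX' hi1 hi2
  have hzy : y + D.t j ≤ z := by linarith
  -- The right side is kept general here, an initial part of its group: it is used both for `B` and
  -- for the slower waves before `B`.
  have hfirst : ∀ B' : Finset ℕ, (∀ s ∈ B', s ∈ D.W j ∧ D.X j s = y') →
      (∀ s ∈ B', ∀ i ∈ D.W j, D.X j i = y' → i ≤ s → i ∈ B') →
      ∑ s ∈ A, ∑ s' ∈ B', D.excess j z s s' ≤ 0 := by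
    intro B' hB1 hB2
    let C : Finset ℕ := {s ∈ D.W j | D.X j s = y ∧ c < D.σ j s}
    have hCmem : ∀ s, s ∈ C ↔ s ∈ D.W j ∧ D.X j s = y ∧ c < D.σ j s := fun s => by simp [C]
    rcases C.eq_empty_or_nonempty with hCe | hCne
    · refine hG y y' z A B' hy hz (fun s hs => ⟨(hA s hs).1, (hA s hs).2.1⟩) hB1 ?_ hB2
      intro s hs i hi hX hsi
      refine hA' s hs i hi hX (le_antisymm ?_ ?_) hsi
      · by_contra hlt
        have : i ∈ C := (hCmem i).2 ⟨hi, hX, not_le.1 hlt⟩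
        rw [hCe] at this
        simp at this
      · rw [← (hA s hs).2.2]
        exact D.speed_mono j hj s (hA s hs).1 i hi ((hA s hs).2.1.trans hX.symm) hsi
    · refine sum_chain_nonpos hCne ?_ ?_ ?_
      · intro s hs m hm s' hs'
        obtain ⟨hmW, hmX, hmσ⟩ := (hCmem m).1 hm
        refine htri s (hA s hs).1 m hmW s' (hB1 s' hs').1 (hA s hs).2.1 (hB1 s' hs').2 ?_ ?_
        · exact (lt_of_speed_lt hj (hA s hs).1 hmW ((hA s hs).2.1.trans hmX.symm)
            (by rw [(hA s hs).2.2]; exact hmσ)).le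
        · exact (lt_of_pos_lt hj hmW (hB1 s' hs').1 (by rw [hmX, (hB1 s' hs').2]; exact hy)).le
      · refine sum_excess_same_pos hzy (fun s hs => ⟨(hA s hs).1, (hA s hs).2.1⟩)
          (fun s hs => ⟨((hCmem s).1 hs).1, ((hCmem s).1 hs).2.1⟩)
          (fun s hs s' hs' => by rw [(hA s hs).2.2]; exact ((hCmem s').1 hs').2.2.le) hAφ ?_
        obtain ⟨m, hm, hmin⟩ := C.exists_min_image (D.σ j) hCne
        refine D.head j hj y (D.σ j m) C (fun s hs => ⟨((hCmem s).1 hs).1, ((hCmem s).1 hs).2.1,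
          hmin s hs⟩) fun s hs i hi hX _ hσ => (hCmem i).2 ⟨hi, hX, ((hCmem m).1 hm).2.2.trans_le hσ⟩
      · refine hG y y' z C B' hy hz (fun s hs => ⟨((hCmem s).1 hs).1, ((hCmem s).1 hs).2.1⟩) hB1
          ?_ hB2
        intro s hs i hi hX hsi
        obtain ⟨hsW, hsX, hsσ⟩ := (hCmem s).1 hs
        exact (hCmem i).2 ⟨hi, hX, hsσ.trans_le
          (D.speed_mono j hj s hsW i hi (hsX.trans hX.symm) hsi)⟩
  let C : Finset ℕ := {s ∈ D.W j | D.X j s = y' ∧ D.σ j s < c'}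
  have hCmem : ∀ s, s ∈ C ↔ s ∈ D.W j ∧ D.X j s = y' ∧ D.σ j s < c' := fun s => by simp [C]
  rcases C.eq_empty_or_nonempty with hCe | hCne
  · refine hfirst B (fun s hs => ⟨(hB s hs).1, (hB s hs).2.1⟩) ?_
    intro s hs i hi hX hsi
    refine hB' s hs i hi hX (le_antisymm ?_ ?_) hsi
    · rw [← (hB s hs).2.2]
      exact D.speed_mono j hj i hi s (hB s hs).1 (hX.trans (hB s hs).2.1.symm) hsi
    · by_contra hlt
      have : i ∈ C := (hCmem i).2 ⟨hi, hX, not_le.1 hlt⟩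
      rw [hCe] at this
      simp at this
  · refine sum_chain_nonpos hCne ?_ ?_ ?_
    · intro s hs m hm s' hs'
      obtain ⟨hmW, hmX, hmσ⟩ := (hCmem m).1 hm
      refine htri s (hA s hs).1 m hmW s' (hB s' hs').1 (hA s hs).2.1 (hB s' hs').2.1 ?_ ?_
      · exact (lt_of_pos_lt hj (hA s hs).1 hmW (by rw [hmX, (hA s hs).2.1]; exact hy)).le
      · exact (lt_of_speed_lt hj hmW (hB s' hs').1 (hmX.trans (hB s' hs').2.1.symm)
          (by rw [(hB s' hs').2.2]; exact hmσ)).le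
    · refine hfirst C (fun s hs => ⟨((hCmem s).1 hs).1, ((hCmem s).1 hs).2.1⟩) ?_
      intro s hs i hi hX hsi
      obtain ⟨hsW, hsX, hsσ⟩ := (hCmem s).1 hs
      exact (hCmem i).2 ⟨hi, hX, lt_of_le_of_lt
        (D.speed_mono j hj i hi s hsW (hX.trans hsX.symm) hsi) hsσ⟩
    · refine sum_excess_same_pos hz (fun s hs => ⟨((hCmem s).1 hs).1, ((hCmem s).1 hs).2.1⟩)
        (fun s hs => ⟨(hB s hs).1, (hB s hs).2.1⟩)
        (fun s hs s' hs' => by rw [(hB s' hs').2.2]; exact ((hCmem s).1 hs).2.2.le) ?_ hBφ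
      obtain ⟨m, hm, hmax⟩ := C.exists_max_image (D.σ j) hCne
      refine D.tail j hj y' (D.σ j m) C (fun s hs => ⟨((hCmem s).1 hs).1, ((hCmem s).1 hs).2.1,
        hmax s hs⟩) fun s hs i hi hX _ hσ =>
          (hCmem i).2 ⟨hi, hX, lt_of_le_of_lt hσ ((hCmem m).1 hm).2.2⟩

/-- Waves that are apart after the collision keep their weights, so the double sum may be split
along the wavefronts from which the waves come. Unless waves were canceled, a final part of a new
group meets each old wavefront in a final part of it; this is why final and initial parts are
considered instead of whole groups. -/
theorem FrontOrdered.groupOrdered_succ {j : ℕ} (hj : j < J) (hF : D.FrontOrdered j) :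
    D.GroupOrdered (j + 1) := by
  classical
  intro y y' z A B hy hz hA hB hA' hB'
  have hsub := D.alive_succ j hj
  have hXne : ∀ s ∈ A, ∀ s' ∈ B, D.X (j + 1) s ≠ D.X (j + 1) s' := fun s hs s' hs' => by
    rw [(hA s hs).2, (hB s' hs').2]; exact hy.ne
  have hXlt : ∀ s ∈ A, ∀ s' ∈ B, D.X (j + 1) s < D.X (j + 1) s' := fun s hs s' hs' => by
    rw [(hA s hs).2, (hB s' hs').2]; exact hy
  have hex : ∀ s ∈ A, ∀ s' ∈ B, D.excess (j + 1) z s s' = D.excess j z s s' := fun s hs s' hs' => by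
    unfold excess
    rw [pot_succ_apart (hXne s hs s' hs')]
  rw [Finset.sum_congr rfl fun s hs => Finset.sum_congr rfl fun s' hs' => hex s hs s' hs']
  -- After a cancellation in a wavefront of `A`, the witness of the opposite sign shows that no pair
  -- in `A × B` has ever been together.
  by_cases hcA : ∃ s ∈ A, ∃ i ∈ D.W j, s ≤ i ∧ D.X j i = D.X j s ∧ D.σ j i = D.σ j s ∧
      i ∉ D.W (j + 1)
  · obtain ⟨s₀, hs₀, i, hi, h1, h2, h3, h4⟩ := hcA
    obtain ⟨m, hm, hne, hm1, hm2⟩ := D.cancel_right j hj s₀ (hA s₀ hs₀).1 i hi h1 h2 h3 h4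
    refine Finset.sum_nonpos fun s hs => Finset.sum_nonpos fun s' hs' =>
      excess_nonpos_of_pot_eq ?_
    refine pot_of_opposite hj.le (hsub (hA s hs).1) hm (hsub (hB s' hs').1)
      (hm1 s (hA s hs).1 ((hA s hs).2.trans (hA s₀ hs₀).2.symm))
      (hm2 s' (hB s' hs').1 (hXlt s₀ hs₀ s' hs')) ?_
    rwa [D.sgn_eq (j + 1) hj s (hA s hs).1 s₀ (hA s₀ hs₀).1 ((hA s hs).2.trans (hA s₀ hs₀).2.symm)]
  by_cases hcB : ∃ s ∈ B, ∃ i ∈ D.W j, i ≤ s ∧ D.X j i = D.X j s ∧ D.σ j i = D.σ j s ∧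
      i ∉ D.W (j + 1)
  · obtain ⟨s₀, hs₀, i, hi, h1, h2, h3, h4⟩ := hcB
    obtain ⟨m, hm, hne, hm1, hm2⟩ := D.cancel_left j hj s₀ (hB s₀ hs₀).1 i hi h1 h2 h3 h4
    refine Finset.sum_nonpos fun s hs => Finset.sum_nonpos fun s' hs' =>
      excess_nonpos_of_pot_eq ?_
    refine pot_of_opposite' hj.le (hsub (hA s hs).1) hm (hsub (hB s' hs').1)
      (hm2 s (hA s hs).1 (hXlt s hs s₀ hs₀))
      (hm1 s' (hB s' hs').1 ((hB s' hs').2.trans (hB s₀ hs₀).2.symm)) ?_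
    rwa [D.sgn_eq (j + 1) hj s' (hB s' hs').1 s₀ (hB s₀ hs₀).1
      ((hB s' hs').2.trans (hB s₀ hs₀).2.symm)]
  push Not at hcA hcB
  -- Position and speed identify the old wavefront.
  let key : ℕ → ℝ × ℝ := fun s => (D.X j s, D.σ j s)
  have hfib : ∀ (A : Finset ℕ) (g : ℕ → ℝ),
      ∑ s ∈ A, g s = ∑ b ∈ A.image key, ∑ s ∈ A with key s = b, g s := fun A g =>
    (Finset.sum_fiberwise_of_maps_to (fun s hs => Finset.mem_image_of_mem key hs) g).symm
  rw [hfib A]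
  refine Finset.sum_nonpos fun a ha => ?_
  rw [Finset.sum_comm, hfib B]
  refine Finset.sum_nonpos fun b hb => ?_
  rw [Finset.sum_comm]
  obtain ⟨s₀, hs₀, rfl⟩ := Finset.mem_image.1 ha
  obtain ⟨s₁, hs₁, rfl⟩ := Finset.mem_image.1 hb
  have hs₀W := hsub (hA s₀ hs₀).1
  have hs₁W := hsub (hB s₁ hs₁).1
  have hlt : s₀ < s₁ := lt_of_pos_lt hj (hA s₀ hs₀).1 (hB s₁ hs₁).1 (hXlt s₀ hs₀ s₁ hs₁)
  have hmemA : ∀ s, s ∈ ({s ∈ A | key s = key s₀} : Finset ℕ) ↔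
      s ∈ A ∧ D.X j s = D.X j s₀ ∧ D.σ j s = D.σ j s₀ := fun s => by simp [key]
  have hmemB : ∀ s, s ∈ ({s ∈ B | key s = key s₁} : Finset ℕ) ↔
      s ∈ B ∧ D.X j s = D.X j s₁ ∧ D.σ j s = D.σ j s₁ := fun s => by simp [key]
  refine hF (D.X j s₀) (D.σ j s₀) (D.X j s₁) (D.σ j s₁) z _ _ ?_ ?_ ?_ ?_ ?_ ?_
  · rcases (D.mono_pos j hj.le s₀ hs₀W s₁ hs₁W hlt.le).lt_or_eq with h | h
    · exact Or.inl h
    -- With equal positions and equal speeds the two waves would not have separated.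
    · refine Or.inr ⟨h, lt_of_le_of_ne (D.speed_mono j hj.le s₀ hs₀W s₁ hs₁W h hlt.le) fun h' => ?_⟩
      exact hXne s₀ hs₀ s₁ hs₁ (D.pos_succ j hj s₀ (hA s₀ hs₀).1 s₁ (hB s₁ hs₁).1 h h')
  · have := D.label_mono j hj s₁ (hB s₁ hs₁).1
    rw [(hB s₁ hs₁).2] at this
    linarith
  · intro s hs
    obtain ⟨h1, h2⟩ := (hmemA s).1 hs
    exact ⟨hsub (hA s h1).1, h2⟩
  · intro s hs
    obtain ⟨h1, h2⟩ := (hmemB s).1 hs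
    exact ⟨hsub (hB s h1).1, h2⟩
  · intro s hs i hi hX hσ hsi
    obtain ⟨h1, h2, h3⟩ := (hmemA s).1 hs
    have hi' : i ∈ D.W (j + 1) := hcA s h1 i hi hsi (hX.trans h2.symm) (hσ.trans h3.symm)
    refine (hmemA i).2 ⟨hA' s h1 i hi' ?_ hsi, hX, hσ⟩
    rw [← (hA s h1).2]
    exact D.pos_succ j hj i hi' s (hA s h1).1 (hX.trans h2.symm) (hσ.trans h3.symm)
  · intro s hs i hi hX hσ hsi
    obtain ⟨h1, h2, h3⟩ := (hmemB s).1 hs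
    have hi' : i ∈ D.W (j + 1) := hcB s h1 i hi hsi (hX.trans h2.symm) (hσ.trans h3.symm)
    refine (hmemB i).2 ⟨hB' s h1 i hi' ?_ hsi, hX, hσ⟩
    rw [← (hB s h1).2]
    exact D.pos_succ j hj i hi' s (hB s h1).1 (hX.trans h2.symm) (hσ.trans h3.symm)

theorem frontOrdered {j : ℕ} (hj : j ≤ J) : D.FrontOrdered j := by
  induction j with
  | zero => exact groupOrdered_zero.frontOrdered hj
  | succ j ih => exact ((ih (by omega)).groupOrdered_succ hj).frontOrdered hj

/-! ### Slopes and the decrease of the potential. -/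

/-- When two wavefronts `L`, `R` meet and their waves stay together, the difference of the slopes is
controlled by the decrease of the potential. -/
theorem sum_slope_le_pot_drop {j : ℕ} (hj : j < J) {L R : Finset ℕ} {y c y' c' x l : ℝ}
    (hyy : y < y') (hL : ∀ s, s ∈ L ↔ s ∈ D.W j ∧ D.X j s = y ∧ D.σ j s = c)
    (hR : ∀ s, s ∈ R ↔ s ∈ D.W j ∧ D.X j s = y' ∧ D.σ j s = c')
    (hL' : ∀ s ∈ L, s ∈ D.W (j + 1) ∧ D.X (j + 1) s = x)
    (hR' : ∀ s ∈ R, s ∈ D.W (j + 1) ∧ D.X (j + 1) s = x) (hRne : R.Nonempty)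
    (hd : ∀ s ∈ L, ∀ s' ∈ R, |D.k s - D.k s'| * D.ε ≤ l) :
    ∑ s ∈ L, ∑ s' ∈ R, (D.φ (x + D.t (j + 1)) s - D.φ (x + D.t (j + 1)) s') ≤
      l * ∑ s ∈ L, ∑ s' ∈ R, (D.pot j s s' - D.pot (j + 1) s s') := by
  have hz : y' + D.t j ≤ x + D.t (j + 1) := by
    obtain ⟨s, hs⟩ := hRne
    have := D.label_mono j hj s (hR' s hs).1
    rwa [((hR s).1 hs).2.1, (hR' s hs).2] at this
  have h := frontOrdered hj.le y c y' c' (x + D.t (j + 1)) L R (Or.inl hyy) hz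
    (fun s hs => (hL s).1 hs) (fun s hs => (hR s).1 hs)
    (fun s _ i hi hX hσ _ => (hL i).2 ⟨hi, hX, hσ⟩) (fun s _ i hi hX hσ _ => (hR i).2 ⟨hi, hX, hσ⟩)
  -- The new weight is `M T` at the collision label, so the amount subtracted in the excess is
  -- exactly the drop of the weight times the distance of the cells.
  have h2 : ∀ s ∈ L, ∀ s' ∈ R, D.φ (x + D.t (j + 1)) s - D.φ (x + D.t (j + 1)) s' ≤
      D.excess j (x + D.t (j + 1)) s s' + l * (D.pot j s s' - D.pot (j + 1) s s') := by
    intro s hs s' hs'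
    have hp := pot_together (hL' s hs).1 (hR' s' hs').1 ((hL' s hs).2.trans (hR' s' hs').2.symm)
    rw [(hL' s hs).2] at hp
    have hdrop : 0 ≤ D.pot j s s' - D.pot (j + 1) s s' := by linarith [pot_succ_le (D := D) hj s s']
    have := mul_le_mul_of_nonneg_left (hd s hs s' hs') hdrop
    unfold excess
    rw [← hp]
    linarith
  calc _ ≤ ∑ s ∈ L, ∑ s' ∈ R, (D.excess j (x + D.t (j + 1)) s s' +
        l * (D.pot j s s' - D.pot (j + 1) s s')) :=
        Finset.sum_le_sum fun s hs => Finset.sum_le_sum fun s' hs' => h2 s hs s' hs'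
    _ ≤ _ := by
      simp only [Finset.sum_add_distrib, ← Finset.mul_sum]
      linarith

/-- The total decrease of the potential is at most its maximal initial value. -/
theorem sum_pot_drop_le (hT : ∀ z, 0 ≤ D.T z) {I : Finset ℕ} (hI : I ⊆ Finset.range J)
    (L R : ℕ → Finset ℕ) (S : Finset ℕ) (hL : ∀ j ∈ I, L j ⊆ S) (hR : ∀ j ∈ I, R j ⊆ S) :
    ∑ j ∈ I, ∑ s ∈ L j, ∑ s' ∈ R j, (D.pot j s s' - D.pot (j + 1) s s') ≤
      (D.K + D.M * D.Tinf) * (S.card : ℝ) ^ 2 := by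
  have hdrop : ∀ j < J, ∀ s s', 0 ≤ D.pot j s s' - D.pot (j + 1) s s' := fun j hj s s' => by
    linarith [pot_succ_le (D := D) hj s s']
  calc ∑ j ∈ I, ∑ s ∈ L j, ∑ s' ∈ R j, (D.pot j s s' - D.pot (j + 1) s s')
      ≤ ∑ j ∈ I, ∑ s ∈ S, ∑ s' ∈ S, (D.pot j s s' - D.pot (j + 1) s s') := by
        refine Finset.sum_le_sum fun j hj => ?_
        have hjJ := Finset.mem_range.1 (hI hj)
        refine (Finset.sum_le_sum fun s _ => Finset.sum_le_sum_of_subset_of_nonneg (hR j hj)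
          fun s' _ _ => hdrop j hjJ s s').trans ?_
        exact Finset.sum_le_sum_of_subset_of_nonneg (hL j hj)
          fun s _ _ => Finset.sum_nonneg fun s' _ => hdrop j hjJ s s'
    _ ≤ ∑ j ∈ Finset.range J, ∑ s ∈ S, ∑ s' ∈ S, (D.pot j s s' - D.pot (j + 1) s s') :=
        Finset.sum_le_sum_of_subset_of_nonneg hI fun j hj _ => Finset.sum_nonneg fun s _ =>
          Finset.sum_nonneg fun s' _ => hdrop j (Finset.mem_range.1 hj) s s'
    _ = ∑ s ∈ S, ∑ s' ∈ S, (D.pot 0 s s' - D.pot J s s') := by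
        rw [Finset.sum_comm]
        refine Finset.sum_congr rfl fun s _ => ?_
        rw [Finset.sum_comm]
        exact Finset.sum_congr rfl fun s' _ => Finset.sum_range_sub' (fun j => D.pot j s s') J
    _ ≤ ∑ s ∈ S, ∑ s' ∈ S, (D.K + D.M * D.Tinf) :=
        Finset.sum_le_sum fun s _ => Finset.sum_le_sum fun s' _ => by
          linarith [pot_zero_le (D := D) s s', pot_nonneg (D := D) hT J s s']
    _ = _ := by simp only [Finset.sum_const, nsmul_eq_mul]; ring

end WaveDynamics

/-! ### Estimates for the flux -/

/-- The slope of `g_ε` on the cell `(k ε, (k+1) ε)`. -/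
noncomputable def cellSlope (ε : ℝ) (g : ℝ → ℝ) (k : ℤ) : ℝ :=
  (g ((k + 1) * ε) - g (k * ε)) / ε

/-- With `δ` the displacement between the cells, the mean value inequality is applied to `u (w + δ)
- u w` over one cell. This gives the distance `|k - k'| ε` of the cells with no loss. -/
theorem cellSlope_sub_le {ε : ℝ} (hε : 0 < ε) {u : ℝ → ℝ} (hu : ContDiff ℝ 2 u) {C : ℝ}
    (hC : ∀ x, |iteratedDeriv 2 u x| ≤ C) (k k' : ℤ) :
    cellSlope ε u k - cellSlope ε u k' ≤ C * (|k - k'| * ε) := by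
  have hd : Differentiable ℝ u := hu.differentiable (by norm_num)
  have hu' : ContDiff ℝ 1 (deriv u) := by
    have : ContDiff ℝ (1 + 1) u := hu
    exact (contDiff_succ_iff_deriv.1 this).2.2
  have hd' : Differentiable ℝ (deriv u) := hu'.differentiable (by norm_num)
  have hlip : ∀ x y, |deriv u y - deriv u x| ≤ C * |y - x| := by
    intro x y
    have := Convex.norm_image_sub_le_of_norm_deriv_le (f := deriv u) (s := univ) (C := C)
      (fun x _ => hd' x) (fun x _ => by
        have := hC x
        rwa [iteratedDeriv_succ, iteratedDeriv_one] at this) convex_univ (mem_univ x) (mem_univ y)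
    simpa using this
  set δ : ℝ := (k - k') * ε with hδ
  let F : ℝ → ℝ := fun w => u (w + δ) - u w
  have hF : ∀ w, HasDerivAt F (deriv u (w + δ) - deriv u w) w := by
    intro w
    exact ((hd (w + δ)).hasDerivAt.comp_add_const w δ).sub (hd w).hasDerivAt
  have hFle := Convex.norm_image_sub_le_of_norm_deriv_le (f := F) (s := univ) (C := C * |δ|)
      (fun x _ => (hF x).differentiableAt) (fun x _ => by
        rw [(hF x).deriv]
        simpa using hlip x (x + δ)) convex_univ (mem_univ (k' * ε)) (mem_univ ((k' + 1) * ε))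
  have e1 : (k' + 1) * ε + δ = (k + 1) * ε := by rw [hδ]; ring
  have e2 : k' * ε + δ = k * ε := by rw [hδ]; ring
  have e3 : ((k' : ℝ) + 1) * ε - k' * ε = ε := by ring
  simp only [F, e1, e2, e3, Real.norm_eq_abs] at hFle
  have hδabs : |δ| = |k - k'| * ε := by
    rw [hδ, abs_mul, abs_of_pos hε]
    push_cast
    rfl
  rw [hδabs, abs_of_pos hε] at hFle
  unfold cellSlope
  rw [← sub_div, div_le_iff₀ hε]
  have := (le_abs_self _).trans hFle
  linarith

theorem neg_one_lt_cellSlope {ε : ℝ} (hε : 0 < ε) {u : ℝ → ℝ} (hu : Differentiable ℝ u) {A : Set ℝ}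
    (hA : A.OrdConnected) (hyp : ∀ a ∈ A, -1 < deriv u a) {k : ℤ} (h1 : k * ε ∈ A)
    (h2 : (k + 1) * ε ∈ A) : -1 < cellSlope ε u k := by
  have hlt : (k : ℝ) * ε < (k + 1) * ε := by nlinarith
  obtain ⟨c, hc, hc'⟩ := exists_deriv_eq_slope u hlt hu.continuous.continuousOn
    hu.differentiableOn
  have := hyp c (hA.out h1 h2 ⟨hc.1.le, hc.2.le⟩)
  rw [hc'] at this
  unfold cellSlope
  convert this using 2
  ring

/-! ### Partial derivatives and the two norms of the flux. -/

/-- The partial derivative in the direction `e`. -/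
noncomputable def partialDeriv (e : ℝ × ℝ) (f : ℝ × ℝ → ℝ) (p : ℝ × ℝ) : ℝ := fderiv ℝ f p e

theorem partialDeriv_eq_comp (e : ℝ × ℝ) (f : ℝ × ℝ → ℝ) :
    partialDeriv e f = ContinuousLinearMap.apply ℝ ℝ e ∘ fderiv ℝ f := rfl

theorem contDiff_partialDeriv {n : ℕ} {f : ℝ × ℝ → ℝ} (hf : ContDiff ℝ (n + 1) f) (e : ℝ × ℝ) :
    ContDiff ℝ n (partialDeriv e f) :=
  (ContinuousLinearMap.apply ℝ ℝ e).contDiff.comp (hf.fderiv_right (by norm_cast))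

theorem bounded_partialDeriv {n : ℕ} {f : ℝ × ℝ → ℝ} (hf : ContDiff ℝ (n + 1) f)
    (hb : ∀ k ≤ n + 1, ∃ C : ℝ, ∀ p, ‖iteratedFDeriv ℝ k f p‖ ≤ C) (e : ℝ × ℝ) :
    ∀ k ≤ n, ∃ C : ℝ, ∀ p, ‖iteratedFDeriv ℝ k (partialDeriv e f) p‖ ≤ C := by
  intro k hk
  obtain ⟨C, hC⟩ := hb (k + 1) (by omega)
  refine ⟨‖ContinuousLinearMap.apply ℝ ℝ e‖ * C, fun p => ?_⟩
  have h1 : ContDiff ℝ k (fderiv ℝ f) := hf.fderiv_right (by norm_cast; omega)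
  rw [partialDeriv_eq_comp]
  refine ((ContinuousLinearMap.apply ℝ ℝ e).norm_iteratedFDeriv_comp_left h1.contDiffAt
    le_rfl).trans ?_
  rw [norm_iteratedFDeriv_fderiv]
  exact mul_le_mul_of_nonneg_left (hC p) (norm_nonneg _)

theorem hasDerivAt_section_left {f : ℝ × ℝ → ℝ} (hf : Differentiable ℝ f) (w v : ℝ) :
    HasDerivAt (fun w => f (w, v)) (partialDeriv (1, 0) f (w, v)) w := by
  have h := (hf (w, v)).hasFDerivAt.comp_hasDerivAt w
    ((hasDerivAt_id w).prodMk (hasDerivAt_const w v))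
  simpa [partialDeriv, Function.comp_def] using h

theorem hasDerivAt_section_right {f : ℝ × ℝ → ℝ} (hf : Differentiable ℝ f) (w v : ℝ) :
    HasDerivAt (fun v => f (w, v)) (partialDeriv (0, 1) f (w, v)) v := by
  have h := (hf (w, v)).hasFDerivAt.comp_hasDerivAt v
    ((hasDerivAt_const v w).prodMk (hasDerivAt_id v))
  simpa [partialDeriv, Function.comp_def] using h

theorem abs_le_of_iteratedFDeriv_zero {f : ℝ × ℝ → ℝ}
    (hb : ∃ C : ℝ, ∀ p, ‖iteratedFDeriv ℝ 0 f p‖ ≤ C) : ∃ C : ℝ, ∀ p, |f p| ≤ C := by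
  obtain ⟨C, hC⟩ := hb
  exact ⟨C, fun p => by simpa using hC p⟩

theorem iteratedDeriv_two_section {f : ℝ × ℝ → ℝ} (hf : ContDiff ℝ 3 f) (w v : ℝ) :
    iteratedDeriv 2 (fun w => f (w, v)) w =
      partialDeriv (1, 0) (partialDeriv (1, 0) f) (w, v) := by
  have h1 : ContDiff ℝ (2 : ℕ) (partialDeriv (1, 0) f) := contDiff_partialDeriv (n := 2) hf _
  have e1 : deriv (fun w => f (w, v)) = fun w => partialDeriv (1, 0) f (w, v) := by
    ext w
    exact (hasDerivAt_section_left (hf.differentiable (by norm_num)) w v).deriv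
  rw [iteratedDeriv_succ, iteratedDeriv_one, e1]
  exact (hasDerivAt_section_left (h1.differentiable (by norm_num)) w v).deriv

/-- Boundedness of the derivatives enters here: the real supremum of an unbounded set is `0`, so it
would not be an upper bound. -/
theorem abs_iteratedDeriv_le_normDww {f : ℝ × ℝ → ℝ} (hf : ContDiff ℝ 3 f)
    (hbdd : ∀ k : ℕ, k ≤ 3 → ∃ C : ℝ, ∀ p : ℝ × ℝ, ‖iteratedFDeriv ℝ k f p‖ ≤ C) (w v : ℝ) :
    |iteratedDeriv 2 (fun w => f (w, v)) w| ≤ normDww f := by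
  have h1 : ContDiff ℝ (2 : ℕ) (partialDeriv (1, 0) f) := contDiff_partialDeriv (n := 2) hf _
  have b1 := bounded_partialDeriv (n := 2) hf hbdd (1, 0)
  have b2 := bounded_partialDeriv (n := 1) h1 b1 (1, 0)
  obtain ⟨C, hC⟩ := abs_le_of_iteratedFDeriv_zero (b2 0 (by omega))
  refine le_ciSup (f := fun p : ℝ × ℝ => |iteratedDeriv 2 (fun w => f (w, p.2)) p.1|)
    ⟨C, ?_⟩ (w, v)
  rintro _ ⟨p, rfl⟩
  simp only
  rw [iteratedDeriv_two_section hf]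
  exact hC _

theorem abs_iteratedDeriv_sub_le_normDwwv {f : ℝ × ℝ → ℝ} (hf : ContDiff ℝ 3 f)
    (hbdd : ∀ k : ℕ, k ≤ 3 → ∃ C : ℝ, ∀ p : ℝ × ℝ, ‖iteratedFDeriv ℝ k f p‖ ≤ C) (w v v' : ℝ) :
    |iteratedDeriv 2 (fun w => f (w, v')) w - iteratedDeriv 2 (fun w => f (w, v)) w| ≤
      normDwwv f * |v' - v| := by
  have h1 : ContDiff ℝ (2 : ℕ) (partialDeriv (1, 0) f) := contDiff_partialDeriv (n := 2) hf _
  have h2 : ContDiff ℝ (1 : ℕ) (partialDeriv (1, 0) (partialDeriv (1, 0) f)) :=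
    contDiff_partialDeriv (n := 1) h1 _
  have b1 := bounded_partialDeriv (n := 2) hf hbdd (1, 0)
  have b2 := bounded_partialDeriv (n := 1) h1 b1 (1, 0)
  have b3 := bounded_partialDeriv (n := 0) h2 b2 (0, 1)
  obtain ⟨C, hC⟩ := abs_le_of_iteratedFDeriv_zero (b3 0 le_rfl)
  have hder : ∀ w v, HasDerivAt (fun v => iteratedDeriv 2 (fun w => f (w, v)) w)
      (partialDeriv (0, 1) (partialDeriv (1, 0) (partialDeriv (1, 0) f)) (w, v)) v := by
    intro w v
    have e : (fun v => iteratedDeriv 2 (fun w => f (w, v)) w) =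
        fun v => partialDeriv (1, 0) (partialDeriv (1, 0) f) (w, v) := by
      ext v
      exact iteratedDeriv_two_section hf w v
    rw [e]
    exact hasDerivAt_section_right (h2.differentiable (by norm_num)) w v
  have hle : ∀ v, |deriv (fun v => iteratedDeriv 2 (fun w => f (w, v)) w) v| ≤ normDwwv f := by
    intro v
    refine le_ciSup (f := fun p : ℝ × ℝ =>
      |deriv (fun v => iteratedDeriv 2 (fun w => f (w, v)) p.1) p.2|) ⟨C, ?_⟩ (w, v)
    rintro _ ⟨p, rfl⟩
    simp only
    rw [(hder p.1 p.2).deriv]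
    exact hC _
  have := Convex.norm_image_sub_le_of_norm_deriv_le
    (f := fun v => iteratedDeriv 2 (fun w => f (w, v)) w) (s := univ) (C := normDwwv f)
    (fun v _ => (hder w v).differentiableAt) (fun v _ => hle v) convex_univ (mem_univ v)
    (mem_univ v')
  simpa using this

theorem normDww_nonneg (f : ℝ × ℝ → ℝ) : 0 ≤ normDww f := Real.iSup_nonneg fun _ => abs_nonneg _

theorem normDwwv_nonneg (f : ℝ × ℝ → ℝ) : 0 ≤ normDwwv f := Real.iSup_nonneg fun _ => abs_nonneg _

theorem contDiff_section {f : ℝ × ℝ → ℝ} (hf : ContDiff ℝ 3 f) (v : ℝ) :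
    ContDiff ℝ 2 (fun w => f (w, v)) :=
  (hf.of_le (by norm_num)).comp (contDiff_id.prodMk contDiff_const)

theorem cellSlope_section_sub_le {f : ℝ × ℝ → ℝ} (hf : ContDiff ℝ 3 f)
    (hbdd : ∀ k : ℕ, k ≤ 3 → ∃ C : ℝ, ∀ p : ℝ × ℝ, ‖iteratedFDeriv ℝ k f p‖ ≤ C)
    {ε : ℝ} (hε : 0 < ε) (v : ℝ) (k k' : ℤ) :
    cellSlope ε (fun w => f (w, v)) k - cellSlope ε (fun w => f (w, v)) k' ≤
      normDww f * (|k - k'| * ε) :=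
  cellSlope_sub_le hε (contDiff_section hf v)
    (fun w => abs_iteratedDeriv_le_normDww hf hbdd w v) k k'

/-- The estimate for one function, applied to `f(·, v') - f(·, v)`, whose second derivative is
controlled by the mixed third derivative. -/
theorem cellSlope_section_diff_le {f : ℝ × ℝ → ℝ} (hf : ContDiff ℝ 3 f)
    (hbdd : ∀ k : ℕ, k ≤ 3 → ∃ C : ℝ, ∀ p : ℝ × ℝ, ‖iteratedFDeriv ℝ k f p‖ ≤ C)
    {ε : ℝ} (hε : 0 < ε) (v v' : ℝ) (k k' : ℤ) :
    cellSlope ε (fun w => f (w, v')) k - cellSlope ε (fun w => f (w, v')) k' ≤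
      cellSlope ε (fun w => f (w, v)) k - cellSlope ε (fun w => f (w, v)) k' +
      normDwwv f * |v' - v| * (|k - k'| * ε) := by
  have hu := (contDiff_section hf v').sub (contDiff_section hf v)
  have h := cellSlope_sub_le hε hu (C := normDwwv f * |v' - v|) (fun w => by
    have e : iteratedDeriv 2 ((fun w => f (w, v')) - fun w => f (w, v)) w =
        iteratedDeriv 2 (fun w => f (w, v')) w - iteratedDeriv 2 (fun w => f (w, v)) w :=
      iteratedDeriv_sub (contDiff_section hf v').contDiffAt (contDiff_section hf v).contDiffAt
    rw [show (fun x => f (x, v') - f (x, v)) = ((fun w => f (w, v')) - fun w => f (w, v)) from rfl,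
      e]
    exact abs_iteratedDeriv_sub_le_normDwwv hf hbdd w v v') k k'
  have e : ∀ k, cellSlope ε (fun x => f (x, v') - f (x, v)) k =
      cellSlope ε (fun w => f (w, v')) k - cellSlope ε (fun w => f (w, v)) k := by
    intro k
    simp only [cellSlope]
    ring
  simp only [e] at h
  linarith

/-! ### Step functions -/

/-- `g` is constant on the intervals between consecutive points of `D`, right continuous. -/
def IsStep (D : Finset ℝ) (g : ℝ → ℝ) : Prop :=
  ∀ x y, x < y → (∀ d ∈ D, d ∉ Ioc x y) → g x = g y

theorem exists_lt_forall_notMem_Ico (D : Finset ℝ) (y : ℝ) : ∃ x < y, ∀ d ∈ D, d ∉ Ico x y := by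
  classical
  rcases (D.filter (· < y)).eq_empty_or_nonempty with h | h
  · refine ⟨y - 1, by linarith, fun d hd hd' => ?_⟩
    have : d ∈ D.filter (· < y) := Finset.mem_filter.2 ⟨hd, hd'.2⟩
    rw [h] at this
    simp at this
  · have hm := Finset.max'_mem _ h
    have hlt : (D.filter (· < y)).max' h < y := (Finset.mem_filter.1 hm).2
    obtain ⟨x, hx1, hx2⟩ := exists_between hlt
    refine ⟨x, hx2, fun d hd hd' => ?_⟩
    have := Finset.le_max' (D.filter (· < y)) d (Finset.mem_filter.2 ⟨hd, hd'.2⟩)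
    linarith [hd'.1]

theorem exists_forall_lt (D : Finset ℝ) (y : ℝ) : ∃ m < y, ∀ d ∈ D, m < d := by
  classical
  have hne : (insert y D).Nonempty := ⟨y, Finset.mem_insert_self _ _⟩
  refine ⟨(insert y D).min' hne - 1, ?_, fun d hd => ?_⟩
  · linarith [Finset.min'_le (insert y D) y (Finset.mem_insert_self _ _)]
  · linarith [Finset.min'_le (insert y D) d (Finset.mem_insert_of_mem hd)]

theorem leftLim_of_const {g : ℝ → ℝ} {x y c : ℝ} (hxy : x < y) (h : ∀ z ∈ Ico x y, g z = c) :
    Function.leftLim g y = c := by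
  apply leftLim_eq_of_tendsto
  refine tendsto_const_nhds.congr' ?_
  filter_upwards [Ico_mem_nhdsLT hxy] with z hz
  exact (h z hz).symm

theorem IsStep.eq_of_le {D : Finset ℝ} {g : ℝ → ℝ} (hg : IsStep D g) {x y : ℝ} (hxy : x ≤ y)
    (h : ∀ d ∈ D, d ∉ Ioc x y) : g x = g y := by
  rcases hxy.eq_or_lt with rfl | hlt
  · rfl
  · exact hg x y hlt h

theorem IsStep.leftLim_eq {D : Finset ℝ} {g : ℝ → ℝ} (hg : IsStep D g) {x y : ℝ} (hxy : x < y)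
    (h : ∀ d ∈ D, d ∉ Ioo x y) : Function.leftLim g y = g x :=
  leftLim_of_const hxy fun _ hz => (hg.eq_of_le hz.1
    fun d hd hd' => h d hd ⟨hd'.1, hd'.2.trans_lt hz.2⟩).symm

/-- `D` may contain points where `g` does not jump. The induction on the number of points of `D` in
`(x, y]` removes the last of them, which by assumption is no jump. -/
theorem IsStep.exists_jump {D : Finset ℝ} {g : ℝ → ℝ} (hg : IsStep D g) {x y : ℝ} (hxy : x ≤ y)
    (hne : g x ≠ g y) : ∃ d ∈ Ioc x y, d ∈ jumpSet g := by
  classical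
  by_contra hcon
  push Not at hcon
  have key : ∀ n : ℕ, ∀ y, x ≤ y → (∀ d ∈ Ioc x y, d ∉ jumpSet g) →
      (D.filter (· ∈ Ioc x y)).card ≤ n → g x = g y := by
    intro n
    induction n with
    | zero =>
      intro y hxy _ hc
      refine hg.eq_of_le hxy fun d hd hd' => ?_
      have : d ∈ D.filter (· ∈ Ioc x y) := Finset.mem_filter.2 ⟨hd, hd'⟩
      rw [Finset.card_eq_zero.1 (Nat.le_zero.1 hc)] at this
      simp at this
    | succ n ih =>
      intro y hxy hj hc
      rcases (D.filter (· ∈ Ioc x y)).eq_empty_or_nonempty with h | h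
      · exact ih y hxy hj (by rw [h]; simp)
      set d := (D.filter (· ∈ Ioc x y)).max' h with hd
      have hdm := Finset.mem_filter.1 (Finset.max'_mem _ h)
      rw [← hd] at hdm
      have hdy : g d = g y := hg.eq_of_le hdm.2.2 fun e he he' => by
        have := Finset.le_max' (D.filter (· ∈ Ioc x y)) e (Finset.mem_filter.2 ⟨he, hdm.2.1.trans he'.1, he'.2⟩)
        linarith [he'.1]
      obtain ⟨x', hx', hx''⟩ := exists_lt_forall_notMem_Ico D d
      have hm : max x x' < d := max_lt hdm.2.1 hx'
      have hl : Function.leftLim g d = g (max x x') := hg.leftLim_eq hm fun e he he' =>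
        hx'' e he ⟨(le_max_right _ _).trans he'.1.le, he'.2⟩
      have hnj : g (max x x') = g d := by
        have := hj d hdm.2
        rw [← hl]
        simpa [jumpSet] using this
      rw [← hdy, ← hnj]
      refine ih _ (le_max_left _ _) (fun e he => hj e ⟨he.1, he.2.trans (hm.le.trans hdm.2.2)⟩) ?_
      refine Nat.le_of_lt_succ (lt_of_lt_of_le (Finset.card_lt_card ?_) hc)
      refine ⟨fun e he => ?_, fun hsub => ?_⟩
      · rw [Finset.mem_filter] at he ⊢
        exact ⟨he.1, he.2.1, he.2.2.trans (hm.le.trans hdm.2.2)⟩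
      · have := (Finset.mem_filter.1 (hsub (Finset.mem_filter.2 hdm))).2.2
        linarith
  exact hne (key _ y hxy hcon le_rfl)

/-- `g = g ∘ ρ`, where the monotone map `ρ` sends a point to the last element of `D` before or at
it, and to a fixed point left of `D` if there is none. So the variation is that over a finite set.
-/
theorem IsStep.boundedVariationOn {D : Finset ℝ} {g : ℝ → ℝ} (hg : IsStep D g) :
    BoundedVariationOn g univ := by
  classical
  obtain ⟨m, -, hm⟩ := exists_forall_lt D 0
  have hne : ∀ x, (insert m (D.filter (· ≤ x))).Nonempty := fun x => ⟨m, Finset.mem_insert_self _ _⟩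
  let ρ : ℝ → ℝ := fun x => (insert m (D.filter (· ≤ x))).max' (hne x)
  have hmem : ∀ x, ρ x ∈ insert m (D.filter (· ≤ x)) := fun x => Finset.max'_mem _ _
  have hρ : Monotone ρ := fun x y hxy => Finset.max'_subset _ (by
    refine Finset.insert_subset_insert _ fun d hd => ?_
    rw [Finset.mem_filter] at hd ⊢
    exact ⟨hd.1, hd.2.trans hxy⟩)
  have hcomp : g = g ∘ ρ := by
    ext x
    rcases Finset.mem_insert.1 (hmem x) with h | h
    · have hD : ∀ d ∈ D, x < d := by
        intro d hd
        by_contra hle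
        have := Finset.le_max' (insert m (D.filter (· ≤ x))) d
          (Finset.mem_insert_of_mem (Finset.mem_filter.2 ⟨hd, not_lt.1 hle⟩))
        have h' : (insert m (D.filter (· ≤ x))).max' (hne x) = m := h
        linarith [hm d hd]
      simp only [Function.comp, h]
      rcases le_total m x with hmx | hmx
      · exact (hg.eq_of_le hmx fun d hd hd' => absurd hd'.2 (not_le.2 (hD d hd))).symm
      · exact hg.eq_of_le hmx fun d hd hd' => absurd hd'.2 (not_le.2 (hm d hd))
    · have h2 := (Finset.mem_filter.1 h).2
      refine (hg.eq_of_le h2 fun d hd hd' => ?_).symm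
      have := Finset.le_max' (insert m (D.filter (· ≤ x))) d
        (Finset.mem_insert_of_mem (Finset.mem_filter.2 ⟨hd, hd'.2⟩))
      exact absurd hd'.1 (not_lt.2 this)
  have hfin : BoundedVariationOn g (↑(insert m D) : Set ℝ) :=
    BoundedVariationOn.of_finite g _
  unfold BoundedVariationOn at hfin ⊢
  have h1 := eVariationOn.comp_le_of_monotoneOn g (s := (↑(insert m D) : Set ℝ)) (t := univ) ρ
    (hρ.monotoneOn _) (fun x _ => by
      rcases Finset.mem_insert.1 (hmem x) with h | h
      · rw [h]; simp
      · have := (Finset.mem_filter.1 h).1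
        simp [this])
  rw [← hcomp] at h1
  exact ne_top_of_le_ne_top hfin h1

theorem variationFn_add {g : ℝ → ℝ} (hbv : BoundedVariationOn g univ) {x y : ℝ} (hxy : x ≤ y) :
    variationFn g y = variationFn g x + (eVariationOn g (Icc x y)).toReal := by
  have h1 : Iic y = Iic x ∪ Icc x y := (Iic_union_Icc_eq_Iic hxy).symm
  unfold variationFn
  rw [h1, eVariationOn.union g (x := x) isGreatest_Iic (isLeast_Icc hxy),
    ENNReal.toReal_add (hbv.mono (subset_univ _)) (hbv.mono (subset_univ _))]

theorem variationFn_mono {g : ℝ → ℝ} (hbv : BoundedVariationOn g univ) :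
    Monotone (variationFn g) := fun x y hxy => by
  rw [variationFn_add hbv hxy]
  linarith [(ENNReal.toReal_nonneg : 0 ≤ (eVariationOn g (Icc x y)).toReal)]

/-- On `[x, y]` the function factors through a monotone map onto the two points `x` and `y`. -/
theorem IsStep.variationFn_eq_add {D : Finset ℝ} {g : ℝ → ℝ} (hg : IsStep D g) {x y : ℝ}
    (hxy : x < y) (h : ∀ d ∈ D, d ∉ Ioo x y) :
    variationFn g y = variationFn g x + |g y - g x| := by
  classical
  rw [variationFn_add hg.boundedVariationOn hxy.le]
  congr 1
  have hle : eVariationOn g (Icc x y) ≤ edist (g x) (g y) := by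
    let ρ : ℝ → ℝ := fun z => if z < y then x else y
    have hρ : Monotone ρ := by
      intro a b hab
      simp only [ρ]
      split_ifs with h1 h2
      · exact le_rfl
      · exact hxy.le
      · exact absurd (hab.trans_lt ‹_›) h1
      · exact le_rfl
    have hcongr : EqOn g (g ∘ ρ) (Icc x y) := by
      intro z hz
      simp only [Function.comp, ρ]
      split_ifs with h1
      · exact (hg.eq_of_le hz.1 fun d hd hd' => h d hd ⟨hd'.1, hd'.2.trans_lt h1⟩).symm
      · rw [le_antisymm hz.2 (not_lt.1 h1)]
    rw [eVariationOn.congr hcongr, ← eVariationOn.pair]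
    refine eVariationOn.comp_le_of_monotoneOn g ρ (hρ.monotoneOn _) fun z _ => ?_
    simp only [ρ]
    split_ifs <;> simp
  have hge := eVariationOn.edist_le g (left_mem_Icc.2 hxy.le) (right_mem_Icc.2 hxy.le)
  rw [le_antisymm hle hge, edist_dist, ENNReal.toReal_ofReal dist_nonneg, dist_comm,
    Real.dist_eq]

theorem IsStep.variationFn_eq_zero {D : Finset ℝ} {g : ℝ → ℝ} (hg : IsStep D g) {x : ℝ}
    (h : ∀ d ∈ D, x < d) : variationFn g x = 0 := by
  have : eVariationOn g (Iic x) = 0 := by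
    apply eVariationOn.constant_on
    rintro _ ⟨a, ha, rfl⟩ _ ⟨b, hb, rfl⟩
    rw [hg.eq_of_le ha fun d hd hd' => absurd hd'.2 (not_le.2 (h d hd)),
      hg.eq_of_le hb fun d hd hd' => absurd hd'.2 (not_le.2 (h d hd))]
  unfold variationFn
  rw [this]
  simp

theorem IsStep.variationFn_eq_totVar {D : Finset ℝ} {g : ℝ → ℝ} (hg : IsStep D g) {x : ℝ}
    (h : ∀ d ∈ D, d ≤ x) : variationFn g x = totVar g := by
  have h0 : eVariationOn g (Ici x) = 0 := by
    apply eVariationOn.constant_on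
    rintro _ ⟨a, ha, rfl⟩ _ ⟨b, hb, rfl⟩
    rw [← hg.eq_of_le ha fun d hd hd' => absurd hd'.1 (not_lt.2 (h d hd)),
      ← hg.eq_of_le hb fun d hd hd' => absurd hd'.1 (not_lt.2 (h d hd))]
  unfold variationFn totVar
  rw [← Iic_union_Ici (a := x), eVariationOn.union g (x := x) isGreatest_Iic isLeast_Ici, h0,
    add_zero]

theorem GridData.eq_zero {ε : ℝ} {g : ℝ → ℝ} (hg : GridData ε g) {D : Finset ℝ} (hD : IsStep D g)
    {x : ℝ} (h : ∀ d ∈ D, x < d) : g x = 0 := by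
  obtain ⟨m, hm⟩ := hg.compact_support.isBounded.bddBelow
  have hz : min x (m - 1) ∉ tsupport g := fun hmem => by
    have := hm hmem
    linarith [min_le_right x (m - 1)]
  rw [← hD.eq_of_le (min_le_left x (m - 1)) fun d hd hd' => absurd hd'.2 (not_le.2 (h d hd))]
  exact image_eq_zero_of_notMem_tsupport hz

/-! ### The variation beyond a point -/

/-- The total variation of `g` on `[z, +∞)`. -/
noncomputable def variationBeyond (g : ℝ → ℝ) (z : ℝ) : ℝ := (eVariationOn g (Ici z)).toReal

theorem variationBeyond_nonneg (g : ℝ → ℝ) (z : ℝ) : 0 ≤ variationBeyond g z :=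
  ENNReal.toReal_nonneg

theorem variationBeyond_le_totVar {g : ℝ → ℝ} (hbv : BoundedVariationOn g univ) (z : ℝ) :
    variationBeyond g z ≤ totVar g :=
  ENNReal.toReal_mono hbv (eVariationOn.mono g (subset_univ _))

theorem abs_sub_le_variationBeyond {g : ℝ → ℝ} (hbv : BoundedVariationOn g univ) {z z' : ℝ}
    (h : z ≤ z') : |g z' - g z| ≤ variationBeyond g z - variationBeyond g z' := by
  have h1 : Ici z = Icc z z' ∪ Ici z' := (Icc_union_Ici_eq_Ici h).symm
  have h2 : variationBeyond g z = (eVariationOn g (Icc z z')).toReal + variationBeyond g z' := by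
    unfold variationBeyond
    rw [h1, eVariationOn.union g (x := z') (isGreatest_Icc h) isLeast_Ici,
      ENNReal.toReal_add (hbv.mono (subset_univ _)) (hbv.mono (subset_univ _))]
  have h3 := (hbv.mono (subset_univ (Icc z z'))).dist_le (right_mem_Icc.2 h) (left_mem_Icc.2 h)
  rw [Real.dist_eq] at h3
  linarith

theorem variationBeyond_anti {g : ℝ → ℝ} (hbv : BoundedVariationOn g univ) :
    Antitone (variationBeyond g) := fun z z' h => by
  linarith [abs_sub_le_variationBeyond hbv h, abs_nonneg (g z' - g z)]

/-! ### The initial configuration of the waves -/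

open Classical in
/-- The sign of a wave as an integer. -/
noncomputable def intSign (ε : ℝ) (w₀ : ℝ → ℝ) (s : ℕ) : ℤ := if 0 < waveSign ε w₀ s then 1 else -1

theorem intSign_eq (ε : ℝ) (w₀ : ℝ → ℝ) (s : ℕ) : intSign ε w₀ s = 1 ∨ intSign ε w₀ s = -1 := by
  unfold intSign
  split_ifs <;> simp

/-- The properties of a wave at the initial time. -/
structure InitialWave (ε : ℝ) (w₀ : ℝ → ℝ) (A : Set ℝ) (s : ℕ) : Prop where
  le_variation : ε * s ≤ variationFn w₀ (initPos ε w₀ s)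
  variation_lt : ∀ z < initPos ε w₀ s, variationFn w₀ z < ε * s
  sign_eq : waveSign ε w₀ s = intSign ε w₀ s
  rightState_eq : rightState ε w₀ s = ε * (∑ i ∈ Finset.Icc 1 s, intSign ε w₀ i : ℤ)
  right_mem : rightState ε w₀ s ∈ A
  left_mem : rightState ε w₀ s - waveSign ε w₀ s * ε ∈ A

/-- Induction on the number of points of `D` up to `x`. Nothing changes after the last such point
`y`; a jump from `a ε` to `b ε` at `y` contributes the next `|b - a|` waves, all of the sign of `b -
a`. -/
theorem initial_waves_aux {ε : ℝ} (hε : 0 < ε) {w₀ : ℝ → ℝ} (hw : GridData ε w₀) {A : Set ℝ}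
    (hA : A.OrdConnected) (hwA : ∀ x, w₀ x ∈ A) {D : Finset ℝ} (hD : IsStep D w₀) (c : ℕ) :
    ∀ x, (D.filter (· ≤ x)).card ≤ c → ∃ n : ℕ, variationFn w₀ x = ε * n ∧
      w₀ x = ε * (∑ i ∈ Finset.Icc 1 n, intSign ε w₀ i : ℤ) ∧
      ∀ s ∈ Finset.Icc 1 n, InitialWave ε w₀ A s := by
  classical
  induction c with
  | zero =>
    intro x hx
    have hlt : ∀ d ∈ D, x < d := by
      intro d hd
      by_contra hle
      have : d ∈ D.filter (· ≤ x) := Finset.mem_filter.2 ⟨hd, not_lt.1 hle⟩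
      rw [Finset.card_eq_zero.1 (Nat.le_zero.1 hx)] at this
      simp at this
    exact ⟨0, by simp [hD.variationFn_eq_zero hlt], by simp [hw.eq_zero hD hlt], by simp⟩
  | succ c ih =>
    intro x hx
    rcases (D.filter (· ≤ x)).eq_empty_or_nonempty with h | h
    · exact ih x (by rw [h]; simp)
    set y := (D.filter (· ≤ x)).max' h with hy
    have hym := Finset.mem_filter.1 (Finset.max'_mem _ h)
    rw [← hy] at hym
    have hno : ∀ d ∈ D, d ∉ Ioc y x := fun d hd hd' => by
      have := Finset.le_max' (D.filter (· ≤ x)) d (Finset.mem_filter.2 ⟨hd, hd'.2⟩)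
      exact absurd hd'.1 (not_lt.2 this)
    have hwx : w₀ y = w₀ x := hD.eq_of_le hym.2 hno
    have hbv := hD.boundedVariationOn
    have hVx : variationFn w₀ x = variationFn w₀ y := by
      rcases hym.2.eq_or_lt with h' | h'
      · rw [h']
      · rw [hD.variationFn_eq_add h' fun d hd hd' => hno d hd ⟨hd'.1, hd'.2.le⟩, hwx]
        simp
    obtain ⟨x', hx', hx''⟩ := exists_lt_forall_notMem_Ico D y
    have hIoo : ∀ z, x' ≤ z → ∀ d ∈ D, d ∉ Ioo z y := fun z hz d hd hd' =>
      hx'' d hd ⟨hz.trans hd'.1.le, hd'.2⟩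
    obtain ⟨n, hn1, hn2, hn3⟩ := ih x' (by
      refine Nat.le_of_lt_succ (lt_of_lt_of_le (Finset.card_lt_card ?_) hx)
      refine ⟨fun e he => ?_, fun hsub => ?_⟩
      · rw [Finset.mem_filter] at he ⊢
        exact ⟨he.1, he.2.trans (hx'.le.trans hym.2)⟩
      · have := (Finset.mem_filter.1 (hsub (Finset.mem_filter.2 hym))).2
        linarith)
    have hVlt : ∀ z < y, variationFn w₀ z ≤ variationFn w₀ x' := by
      intro z hz
      rcases le_total z x' with h' | h'
      · exact variationFn_mono hbv h'
      · rcases h'.eq_or_lt with h'' | h''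
        · rw [h'']
        · rw [hD.variationFn_eq_add h'' fun d hd hd' => hx'' d hd ⟨hd'.1.le, hd'.2.trans hz⟩,
            hD.eq_of_le h' fun d hd hd' => hx'' d hd ⟨hd'.1.le, hd'.2.trans_lt hz⟩]
          simp
    have hVeq : ∀ z ∈ Ico x' y, variationFn w₀ z = variationFn w₀ x' := fun z hz =>
      le_antisymm (hVlt z hz.2) (variationFn_mono hbv hz.1)
    have hleft : Function.leftLim w₀ y = w₀ x' := hD.leftLim_eq hx' (hIoo x' le_rfl)
    have hleftV : Function.leftLim (variationFn w₀) y = variationFn w₀ x' :=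
      leftLim_of_const hx' hVeq
    obtain ⟨a, ha⟩ := hw.mem_grid x'
    obtain ⟨b, hb⟩ := hw.mem_grid y
    have hjump : variationFn w₀ y = ε * (n + (b - a).natAbs : ℕ) := by
      rw [hD.variationFn_eq_add hx' (hIoo x' le_rfl), hn1, ha, hb, ← sub_mul, abs_mul,
        abs_of_pos hε, Nat.cast_add, Nat.cast_natAbs]
      push_cast
      ring
    -- For these waves the set whose infimum is the initial position is exactly `[y, ∞)`.
    have hpos : ∀ s : ℕ, n < s → s ≤ n + (b - a).natAbs → initPos ε w₀ s = y := by
      intro s h1 h2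
      have : {x | ε * s ≤ variationFn w₀ x} = Ici y := by
        ext z
        simp only [mem_ofPred_eq, mem_Ici]
        constructor
        · intro hz
          by_contra hlt
          have h3 := hVlt z (not_le.1 hlt)
          rw [hn1] at h3
          have h4 : ε * (n : ℝ) < ε * s := by
            have : (n : ℝ) < s := by exact_mod_cast h1
            exact mul_lt_mul_of_pos_left this hε
          linarith
        · intro hz
          refine le_trans ?_ (variationFn_mono hbv hz)
          rw [hjump]
          have : (s : ℝ) ≤ (n + (b - a).natAbs : ℕ) := by exact_mod_cast h2
          exact mul_le_mul_of_nonneg_left this hε.le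
      unfold initPos
      rw [this, csInf_Ici]
    have hsgn : ∀ s : ℕ, n < s → s ≤ n + (b - a).natAbs →
        waveSign ε w₀ s = (b - a).sign ∧ intSign ε w₀ s = (b - a).sign := by
      intro s h1 h2
      have e : waveSign ε w₀ s = (b - a).sign := by
        unfold waveSign
        rw [hpos s h1 h2, hleft, ha, hb, ← sub_mul]
        rcases lt_trichotomy (b - a) 0 with h' | h' | h'
        · rw [Int.sign_eq_neg_one_of_neg h', Real.sign_of_neg]
          · simp
          · have : ((b - a : ℤ) : ℝ) < 0 := by exact_mod_cast h'
            push_cast at this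
            nlinarith
        · rw [h'] at h2; simp at h2; omega
        · rw [Int.sign_eq_one_of_pos h', Real.sign_of_pos]
          · simp
          · have : (0 : ℝ) < ((b - a : ℤ) : ℝ) := by exact_mod_cast h'
            push_cast at this
            positivity
      refine ⟨e, ?_⟩
      unfold intSign
      rw [e]
      rcases lt_trichotomy (b - a) 0 with h' | h' | h'
      · rw [Int.sign_eq_neg_one_of_neg h']; norm_num
      · rw [h'] at h2; simp at h2; omega
      · rw [Int.sign_eq_one_of_pos h']; norm_num
    have hsumsgn : ∀ m : ℕ, m ≤ (b - a).natAbs →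
        ∑ i ∈ Finset.Icc 1 (n + m), intSign ε w₀ i =
          ∑ i ∈ Finset.Icc 1 n, intSign ε w₀ i + m * (b - a).sign := by
      intro m
      induction m with
      | zero => intro _; simp
      | succ m ihm =>
        intro hm
        rw [← add_assoc, Finset.sum_Icc_succ_top (by omega), ihm (by omega),
          (hsgn (n + m + 1) (by omega) (by omega)).2]
        push_cast; ring
    have hsuma : (a : ℝ) * ε = ε * (∑ i ∈ Finset.Icc 1 n, intSign ε w₀ i : ℤ) := by rw [← ha, hn2]
    have habs : ((b - a).natAbs : ℤ) * (b - a).sign = b - a := by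
      rw [mul_comm]; exact Int.sign_mul_natAbs _
    refine ⟨n + (b - a).natAbs, hVx.trans hjump, ?_, ?_⟩
    · rw [← hwx, hsumsgn _ le_rfl, habs, hb]
      push_cast at hsuma ⊢
      linear_combination hsuma
    · intro s hs
      rw [Finset.mem_Icc] at hs
      rcases le_or_gt s n with hsn | hsn
      · exact hn3 s (Finset.mem_Icc.2 ⟨hs.1, hsn⟩)
      have hp := hpos s hsn hs.2
      obtain ⟨hg1, hg2⟩ := hsgn s hsn hs.2
      obtain ⟨m, rfl⟩ := Nat.exists_eq_add_of_le hsn.le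
      have hm : m ≤ (b - a).natAbs := by omega
      have hm1 : 1 ≤ m := by omega
      have hr : rightState ε w₀ (n + m) = (a + m * (b - a).sign : ℤ) * ε := by
        unfold rightState
        rw [hp, hleft, hleftV, hg1, hn1, ha]
        push_cast
        ring
      -- Intermediate states of a jump need not be values of `w₀`, but they lie between two such
      -- values and hence in `A`.
      have hbetween : ∀ q : ℤ, 0 ≤ q → q ≤ (b - a).natAbs → ((a + q * (b - a).sign : ℤ) : ℝ) * ε ∈ A := by
        intro q hq0 hq
        have hAa : (a : ℝ) * ε ∈ A := ha ▸ hwA x'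
        have hAb : (b : ℝ) * ε ∈ A := hb ▸ hwA y
        have key : ∀ u v r : ℤ, u ≤ r → r ≤ v → (u : ℝ) * ε ∈ A → (v : ℝ) * ε ∈ A → (r : ℝ) * ε ∈ A := by
          intro u v r h1 h2 h3 h4
          refine hA.out h3 h4 ⟨?_, ?_⟩
          · exact mul_le_mul_of_nonneg_right (by exact_mod_cast h1) hε.le
          · exact mul_le_mul_of_nonneg_right (by exact_mod_cast h2) hε.le
        rcases lt_trichotomy (b - a) 0 with h' | h' | h'
        · rw [Int.sign_eq_neg_one_of_neg h']
          exact key b a _ (by omega) (by omega) hAb hAa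
        · rw [h']; simpa using hAa
        · rw [Int.sign_eq_one_of_pos h']
          exact key a b _ (by omega) (by omega) hAa hAb
      refine ⟨?_, ?_, ?_, ?_, ?_, ?_⟩
      · rw [hp, hjump]
        exact mul_le_mul_of_nonneg_left (by exact_mod_cast hs.2) hε.le
      · rw [hp]
        intro z hz
        refine (hVlt z hz).trans_lt ?_
        rw [hn1]
        exact mul_lt_mul_of_pos_left (by exact_mod_cast hsn) hε
      · rw [hg1, hg2]
      · rw [hr, hsumsgn m hm]
        push_cast at hsuma ⊢
        linear_combination hsuma
      · rw [hr]
        exact_mod_cast hbetween m (by omega) (by omega)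
      · rw [hr, hg1]
        have := hbetween (m - 1) (by omega) (by omega)
        convert this using 1
        push_cast
        ring

/-- The waves at the initial time. -/
theorem initial_waves {ε : ℝ} (hε : 0 < ε) {w₀ : ℝ → ℝ} (hw : GridData ε w₀) {A : Set ℝ}
    (hA : A.OrdConnected) (hwA : ∀ x, w₀ x ∈ A) :
    totVar w₀ = ε * (waves ε w₀).card ∧ waves ε w₀ = Finset.Icc 1 (waves ε w₀).card ∧
      (∀ s ∈ waves ε w₀, InitialWave ε w₀ A s) ∧
      ∀ x, w₀ x = ε * (∑ i ∈ waves ε w₀ with initPos ε w₀ i ≤ x, intSign ε w₀ i : ℤ) := by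
  classical
  obtain ⟨D, hD⟩ := hw.piecewise_const
  replace hD : IsStep D w₀ := hD
  have hbv := hD.boundedVariationOn
  have haux := fun x => initial_waves_aux hε hw hA hwA hD _ x le_rfl
  obtain ⟨X, hX⟩ : ∃ X, ∀ d ∈ D, d ≤ X := D.exists_le
  obtain ⟨N, hN1, -, hN3⟩ := haux X
  rw [hD.variationFn_eq_totVar hX] at hN1
  have hwaves : waves ε w₀ = Finset.Icc 1 N := by
    unfold waves
    rw [hN1, mul_div_cancel_left₀ _ hε.ne', Nat.floor_natCast]
  have hcard : (waves ε w₀).card = N := by rw [hwaves]; simp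
  refine ⟨by rw [hcard, hN1], by rw [hcard, hwaves], by rw [hwaves]; exact hN3, fun x => ?_⟩
  obtain ⟨n, hn1, hn2, -⟩ := haux x
  rw [hn2]
  congr 2
  refine Finset.sum_congr ?_ fun _ _ => rfl
  have hnN : n ≤ N := by
    have h1 : variationFn w₀ x ≤ totVar w₀ := by
      rw [← hD.variationFn_eq_totVar (x := max x X) fun d hd => (hX d hd).trans (le_max_right _ _)]
      exact variationFn_mono hbv (le_max_left _ _)
    rw [hn1, hN1] at h1
    exact_mod_cast le_of_mul_le_mul_left h1 hε
  ext s
  rw [Finset.mem_filter, hwaves, Finset.mem_Icc, Finset.mem_Icc]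
  constructor
  · rintro ⟨h1, h2⟩
    refine ⟨⟨h1, h2.trans hnN⟩, ?_⟩
    by_contra hlt
    have := (hN3 s (Finset.mem_Icc.2 ⟨h1, h2.trans hnN⟩)).variation_lt x (not_le.1 hlt)
    rw [hn1] at this
    have h3 := lt_of_mul_lt_mul_left this hε.le
    have h4 : n < s := by exact_mod_cast h3
    omega
  · rintro ⟨⟨h1, h2⟩, h3⟩
    refine ⟨h1, ?_⟩
    have := (hN3 s (Finset.mem_Icc.2 ⟨h1, h2⟩)).le_variation.trans (variationFn_mono hbv h3)
    rw [hn1] at this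
    exact_mod_cast le_of_mul_le_mul_left this hε

theorem initPos_mono {ε : ℝ} (hε : 0 < ε) {w₀ : ℝ → ℝ} {A : Set ℝ} {s s' : ℕ}
    (hs : InitialWave ε w₀ A s) (hs' : InitialWave ε w₀ A s') (h : s ≤ s') :
    initPos ε w₀ s ≤ initPos ε w₀ s' := by
  by_contra hlt
  have h1 := hs.variation_lt _ (not_le.1 hlt)
  have h2 := hs'.le_variation
  have h3 : ε * (s : ℝ) ≤ ε * s' := mul_le_mul_of_nonneg_left (by exact_mod_cast h) hε.le
  linarith

theorem intSign_eq_of_initPos_eq {ε : ℝ} {w₀ : ℝ → ℝ} {s s' : ℕ}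
    (h : initPos ε w₀ s = initPos ε w₀ s') : intSign ε w₀ s = intSign ε w₀ s' := by
  unfold intSign waveSign
  rw [h]

/-! ### Configurations of waves -/

/-- The profile `p` is the superposition of the waves in `W`, at the positions `X`: `sgn s` is the sign
and `r s` the right state of `s` in units of `ε`. Waves at the same position may have different
signs. -/
structure PreConfig (ε : ℝ) (sgn r : ℕ → ℤ) (W : Finset ℕ) (X : ℕ → ℝ) (p : ℝ → ℝ) : Prop where
  sgn_eq : ∀ s, sgn s = 1 ∨ sgn s = -1
  mono : ∀ s ∈ W, ∀ s' ∈ W, s ≤ s' → X s ≤ X s'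
  profile : ∀ x, p x = ε * (∑ i ∈ W with X i ≤ x, sgn i : ℤ)
  right_state : ∀ s ∈ W, r s = ∑ i ∈ W with i ≤ s, sgn i

/-- The waves in `W` at the same position have the same sign. -/
structure Config (ε : ℝ) (sgn r : ℕ → ℤ) (W : Finset ℕ) (X : ℕ → ℝ) (p : ℝ → ℝ) : Prop extends
    PreConfig ε sgn r W X p where
  sign : ∀ s ∈ W, ∀ s' ∈ W, X s = X s' → sgn s = sgn s'

/-- The index of the cell of a wave with sign `η` and right state `r`. -/
def waveCell (sgn r : ℕ → ℤ) (s : ℕ) : ℤ := if sgn s = 1 then r s - 1 else r s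

/-! ### Ranks within a group, and hulls of groups. -/

/-- The number of the elements of `G` before `s`. -/
def rankIn (G : Finset ℕ) (s : ℕ) : ℕ := (G.filter (· < s)).card

theorem rankIn_lt {G : Finset ℕ} {s s' : ℕ} (hs : s ∈ G) (h : s < s') :
    rankIn G s < rankIn G s' := by
  refine Finset.card_lt_card ⟨fun i hi => ?_, fun hsub => ?_⟩
  · rw [Finset.mem_filter] at hi ⊢
    exact ⟨hi.1, hi.2.trans h⟩
  · have := hsub (Finset.mem_filter.2 ⟨hs, h⟩)
    simp at this

theorem rankIn_le {G : Finset ℕ} {s s' : ℕ} (h : s ≤ s') : rankIn G s ≤ rankIn G s' :=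
  Finset.card_le_card fun i hi => by
    rw [Finset.mem_filter] at hi ⊢
    exact ⟨hi.1, hi.2.trans_le h⟩

theorem rankIn_injOn (G : Finset ℕ) : InjOn (rankIn G) G := by
  intro s hs s' hs' h
  rcases lt_trichotomy s s' with h' | h' | h'
  · exact absurd h (rankIn_lt hs h').ne
  · exact h'
  · exact absurd h (rankIn_lt hs' h').ne'

theorem rankIn_lt_card {G : Finset ℕ} {s : ℕ} (hs : s ∈ G) : rankIn G s < G.card :=
  Finset.card_lt_card ⟨Finset.filter_subset _ _, fun hsub => by
    have := hsub hs
    simp at this⟩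

theorem image_rankIn (G : Finset ℕ) : G.image (rankIn G) = Finset.range G.card := by
  refine Finset.eq_of_subset_of_card_le (fun i hi => ?_) ?_
  · obtain ⟨s, hs, rfl⟩ := Finset.mem_image.1 hi
    exact Finset.mem_range.2 (rankIn_lt_card hs)
  · rw [Finset.card_image_of_injOn (rankIn_injOn G), Finset.card_range]

theorem exists_rankIn_eq {G : Finset ℕ} {i : ℕ} (hi : i < G.card) : ∃ s ∈ G, rankIn G s = i := by
  have := Finset.mem_range.2 hi
  rw [← image_rankIn G] at this
  exact Finset.mem_image.1 this

theorem rankIn_lt_iff {G : Finset ℕ} {s s' : ℕ} (hs : s ∈ G) :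
    rankIn G s < rankIn G s' ↔ s < s' :=
  ⟨fun h => lt_of_not_ge fun h' => absurd (rankIn_le (G := G) h') (not_le.2 h),
    fun h => rankIn_lt hs h⟩

theorem card_filter_le {G : Finset ℕ} {s : ℕ} (hs : s ∈ G) :
    (G.filter (· ≤ s)).card = rankIn G s + 1 := by
  have : G.filter (· ≤ s) = insert s (G.filter (· < s)) := by
    ext i
    simp only [Finset.mem_filter, Finset.mem_insert, le_iff_lt_or_eq]
    constructor
    · rintro ⟨h1, h2 | h2⟩
      · exact Or.inr ⟨h1, h2⟩
      · exact Or.inl h2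
    · rintro (rfl | ⟨h1, h2⟩)
      · exact ⟨hs, Or.inr rfl⟩
      · exact ⟨h1, Or.inl h2⟩
  rw [this, Finset.card_insert_of_notMem (by simp), rankIn]

/-- Sums over the part of `G` between two of its elements. -/
theorem sum_between {G A : Finset ℕ} {p q : ℕ} (hq : q ∈ G) (hpq : p ≤ q)
    (hA : ∀ s, s ∈ A ↔ s ∈ G ∧ p ≤ s ∧ s ≤ q) (h : ℕ → ℝ) :
    ∑ s ∈ A, h (rankIn G s) = ∑ i ∈ Finset.range (rankIn G q + 1), h i -
      ∑ i ∈ Finset.range (rankIn G p), h i := by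
  have hinj : InjOn (rankIn G) A := (rankIn_injOn G).mono fun s hs => ((hA s).1 hs).1
  have himage : A.image (rankIn G) = Finset.Ico (rankIn G p) (rankIn G q + 1) := by
    ext i
    rw [Finset.mem_image, Finset.mem_Ico]
    constructor
    · rintro ⟨s, hs, rfl⟩
      obtain ⟨-, h1, h2⟩ := (hA s).1 hs
      exact ⟨rankIn_le h1, Nat.lt_succ_of_le (rankIn_le h2)⟩
    · rintro ⟨h1, h2⟩
      obtain ⟨s, hs, rfl⟩ := exists_rankIn_eq (G := G) (i := i)
        (by have := rankIn_lt_card hq; omega)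
      refine ⟨s, (hA s).2 ⟨hs, ?_, ?_⟩, rfl⟩
      · by_contra hlt
        have := rankIn_lt hs (not_le.1 hlt)
        omega
      · by_contra hlt
        have := rankIn_lt hq (not_le.1 hlt)
        omega
  rw [← Finset.sum_image (f := h) hinj, himage, Finset.sum_Ico_eq_sub _
    (by have := rankIn_le (G := G) hpq; omega)]

/-- `A` is a run of consecutive elements of `G`. At its right end the hull touches the partial sums
of `ψ`, at its left end it lies below them. -/
theorem IsHull.tail_le {G : Finset ℕ} {ψ σ : ℕ → ℝ} (h : IsHull G.card ψ σ) {c : ℝ}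
    {A : Finset ℕ} (hA : ∀ s ∈ A, s ∈ G ∧ σ (rankIn G s) ≤ c)
    (hA' : ∀ s ∈ A, ∀ i ∈ G, s ≤ i → σ (rankIn G i) ≤ c → i ∈ A) :
    ∑ s ∈ A, ψ (rankIn G s) ≤ ∑ s ∈ A, σ (rankIn G s) := by
  rcases A.eq_empty_or_nonempty with rfl | hne
  · simp
  have hp := Finset.min'_mem A hne
  have hq := Finset.max'_mem A hne
  have hpq : A.min' hne ≤ A.max' hne := Finset.min'_le A _ hq
  have hmem : ∀ s, s ∈ A ↔ s ∈ G ∧ A.min' hne ≤ s ∧ s ≤ A.max' hne := by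
    refine fun s => ⟨fun hs => ⟨(hA s hs).1, Finset.min'_le A s hs, Finset.le_max' A s hs⟩, ?_⟩
    rintro ⟨h1, h2, h3⟩
    exact hA' _ hp s h1 h2 ((h.mono _ _ (rankIn_le h3) (rankIn_lt_card (hA _ hq).1)).trans
      (hA _ hq).2)
  rw [sum_between (hA _ hq).1 hpq hmem, sum_between (hA _ hq).1 hpq hmem]
  have hlt := rankIn_lt_card (hA _ hq).1
  have h1 := h.sum_le (rankIn G (A.min' hne)) (rankIn_lt_card (hA _ hp).1).le
  have h2 : ∑ l ∈ Finset.range (rankIn G (A.max' hne) + 1), σ l =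
      ∑ l ∈ Finset.range (rankIn G (A.max' hne) + 1), ψ l := by
    -- Either the slope jumps strictly after the last element of `A`, since otherwise the next one
    -- would also belong to `A`, or the group ends there.
    rcases Nat.lt_or_ge (rankIn G (A.max' hne) + 1) G.card with h3 | h3
    · refine h.touch _ h3 (lt_of_not_ge fun hge => ?_)
      obtain ⟨i, hi, hri⟩ := exists_rankIn_eq h3
      have hlt' : A.max' hne < i := (rankIn_lt_iff (hA _ hq).1).1 (by omega)
      have := Finset.le_max' A i (hA' _ hq i hi hlt'.le (by rw [hri]; exact hge.trans (hA _ hq).2))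
      omega
    · rw [show rankIn G (A.max' hne) + 1 = G.card by omega]
      exact h.sum_eq
  linarith

theorem IsHull.head_le {G : Finset ℕ} {ψ σ : ℕ → ℝ} (h : IsHull G.card ψ σ) {c : ℝ}
    {A : Finset ℕ} (hA : ∀ s ∈ A, s ∈ G ∧ c ≤ σ (rankIn G s))
    (hA' : ∀ s ∈ A, ∀ i ∈ G, i ≤ s → c ≤ σ (rankIn G i) → i ∈ A) :
    ∑ s ∈ A, σ (rankIn G s) ≤ ∑ s ∈ A, ψ (rankIn G s) := by
  rcases A.eq_empty_or_nonempty with rfl | hne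
  · simp
  have hp := Finset.min'_mem A hne
  have hq := Finset.max'_mem A hne
  have hpq : A.min' hne ≤ A.max' hne := Finset.min'_le A _ hq
  have hmem : ∀ s, s ∈ A ↔ s ∈ G ∧ A.min' hne ≤ s ∧ s ≤ A.max' hne := by
    refine fun s => ⟨fun hs => ⟨(hA s hs).1, Finset.min'_le A s hs, Finset.le_max' A s hs⟩, ?_⟩
    rintro ⟨h1, h2, h3⟩
    exact hA' _ hq s h1 h3 ((hA _ hp).2.trans (h.mono _ _ (rankIn_le h2) (rankIn_lt_card h1)))
  rw [sum_between (hA _ hq).1 hpq hmem, sum_between (hA _ hq).1 hpq hmem]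
  have hlt := rankIn_lt_card (hA _ hp).1
  have h1 := h.sum_le (rankIn G (A.max' hne) + 1) (rankIn_lt_card (hA _ hq).1)
  have h2 : ∑ l ∈ Finset.range (rankIn G (A.min' hne)), σ l =
      ∑ l ∈ Finset.range (rankIn G (A.min' hne)), ψ l := by
    rcases Nat.eq_zero_or_pos (rankIn G (A.min' hne)) with h3 | h3
    · rw [h3]; simp
    · obtain ⟨l, hl⟩ := Nat.exists_eq_add_of_lt h3
      rw [zero_add] at hl
      rw [hl]
      refine h.touch l (by omega) (lt_of_not_ge fun hge => ?_)
      obtain ⟨i, hi, hri⟩ := exists_rankIn_eq (G := G) (i := l) (by omega)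
      have hlt' : i < A.min' hne := (rankIn_lt_iff hi).1 (by omega)
      have := Finset.min'_le A i (hA' _ hp i hi hlt'.le (by
        have h5 := (hA _ hp).2
        rw [hl] at h5
        rw [hri]
        exact h5.trans hge))
      omega
  linarith

/-! ### States of a superposition of waves. -/

namespace PreConfig

variable {ε : ℝ} {sgn r : ℕ → ℤ} {W : Finset ℕ} {X : ℕ → ℝ} {p : ℝ → ℝ}

open Classical in
/-- The waves at the position `y`. -/
noncomputable def groupAt (W : Finset ℕ) (X : ℕ → ℝ) (y : ℝ) : Finset ℕ := {i ∈ W | X i = y}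

open Classical in
/-- The state on the left of `y`, in units of `ε`. -/
noncomputable def leftState (sgn : ℕ → ℤ) (W : Finset ℕ) (X : ℕ → ℝ) (y : ℝ) : ℤ :=
  ∑ i ∈ W with X i < y, sgn i

theorem mem_groupAt {y : ℝ} {s : ℕ} : s ∈ groupAt W X y ↔ s ∈ W ∧ X s = y := by
  simp [groupAt]

theorem leftLim_eq (c : PreConfig ε sgn r W X p) (y : ℝ) :
    Function.leftLim p y = ε * leftState sgn W X y := by
  classical
  obtain ⟨x, hx, hx'⟩ := exists_lt_forall_notMem_Ico (W.image X) y
  refine leftLim_of_const hx fun z hz => ?_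
  rw [c.profile, leftState]
  congr 2
  refine Finset.sum_congr (Finset.filter_congr fun i hi => ?_) fun _ _ => rfl
  refine ⟨fun h => h.trans_lt hz.2, fun h => ?_⟩
  by_contra hlt
  exact hx' (X i) (Finset.mem_image_of_mem X hi) ⟨hz.1.trans (not_le.1 hlt).le, h⟩

theorem profile_eq (c : PreConfig ε sgn r W X p) (y : ℝ) :
    p y = ε * (leftState sgn W X y + ∑ i ∈ groupAt W X y, sgn i : ℤ) := by
  classical
  rw [c.profile, leftState, groupAt, ← Finset.sum_union]
  · congr 3
    ext i
    simp only [Finset.mem_filter, Finset.mem_union, le_iff_lt_or_eq]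
    tauto
  · rw [Finset.disjoint_filter]
    intro i _ h1 h2
    exact absurd h2 h1.ne

theorem lt_of_pos_lt (c : PreConfig ε sgn r W X p) {s s' : ℕ} (hs : s ∈ W) (hs' : s' ∈ W)
    (h : X s < X s') : s < s' :=
  lt_of_not_ge fun h' => absurd (c.mono s' hs' s hs h') (not_le.2 h)

theorem right_state_eq_sum (c : PreConfig ε sgn r W X p) {s : ℕ} (hs : s ∈ W) :
    r s = leftState sgn W X (X s) + ∑ i ∈ groupAt W X (X s) with i ≤ s, sgn i := by
  classical
  rw [c.right_state s hs, leftState, ← Finset.sum_union]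
  · refine Finset.sum_congr ?_ fun _ _ => rfl
    ext i
    simp only [Finset.mem_filter, Finset.mem_union, mem_groupAt]
    constructor
    · rintro ⟨h1, h2⟩
      rcases (c.mono i h1 s hs h2).lt_or_eq with h | h
      · exact Or.inl ⟨h1, h⟩
      · exact Or.inr ⟨⟨h1, h⟩, h2⟩
    · rintro (⟨h1, h2⟩ | ⟨⟨h1, h2⟩, h3⟩)
      · exact ⟨h1, (c.lt_of_pos_lt h1 hs h2).le⟩
      · exact ⟨h1, h3⟩
  · rw [Finset.disjoint_left]
    intro i hi hi'
    exact absurd (mem_groupAt.1 (Finset.mem_filter.1 hi').1).2 (Finset.mem_filter.1 hi).2.ne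

end PreConfig

/-! ### Riemann problems of the groups. -/

namespace Config

variable {ε : ℝ} {sgn r : ℕ → ℤ} {W : Finset ℕ} {X : ℕ → ℝ} {p : ℝ → ℝ}

open PreConfig

theorem sum_sgn_eq (c : Config ε sgn r W X p) {s : ℕ} (hs : s ∈ W) {G : Finset ℕ}
    (hG : G ⊆ groupAt W X (X s)) : ∑ i ∈ G, sgn i = sgn s * G.card := by
  rw [Finset.sum_congr rfl fun i hi => c.sign i (mem_groupAt.1 (hG hi)).1 s hs
    (mem_groupAt.1 (hG hi)).2, Finset.sum_const, nsmul_eq_mul, mul_comm]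

theorem right_state_eq (c : Config ε sgn r W X p) {s : ℕ} (hs : s ∈ W) :
    r s = leftState sgn W X (X s) + sgn s * (rankIn (groupAt W X (X s)) s + 1) := by
  rw [c.right_state_eq_sum hs, c.sum_sgn_eq hs (Finset.filter_subset _ _),
    card_filter_le (mem_groupAt.2 ⟨hs, rfl⟩)]
  push_cast
  rfl

/-- The cells of a jump with left state `a` and sign `η`, counted from the left. -/
def cellAt (η a : ℤ) (i : ℕ) : ℤ := if η = 1 then a + i else a - 1 - i

theorem waveCell_eq (c : Config ε sgn r W X p) {s : ℕ} (hs : s ∈ W) :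
    waveCell sgn r s =
      cellAt (sgn s) (leftState sgn W X (X s)) (rankIn (groupAt W X (X s)) s) := by
  unfold waveCell cellAt
  rw [c.right_state_eq hs]
  rcases c.sgn_eq s with h | h <;> rw [h] <;> norm_num <;> ring

/-- The cells are counted from the left state in the direction of the jump. Thus for a decreasing
jump, too, the speeds form a hull of the slopes in this order. -/
theorem cellSpeed_eq_hull (hε : 0 < ε) (g : ℝ → ℝ) {η a : ℤ} (hη : η = 1 ∨ η = -1) {n : ℕ}
    {σ : ℕ → ℝ} (hull : IsHull n (fun i => cellSlope ε g (cellAt η a i)) σ) {i : ℕ} (hi : i < n) :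
    cellSpeed ε g (ε * a) (ε * (a + η * n : ℤ)) (cellAt η a i) = σ i := by
  have hn : (0 : ℝ) < n := by exact_mod_cast lt_of_le_of_lt (Nat.zero_le i) hi
  have hnode : ∀ k : ℤ, gridInterp ε g (k * ε) = g (k * ε) := fun k => by
    rw [gridInterp_eq hε g k ⟨le_rfl, by nlinarith⟩]; ring
  rcases hη with rfl | rfl
  · simp only [cellAt, if_true] at hull ⊢
    unfold cellSpeed
    rw [if_pos (by push_cast; nlinarith)]
    have := deriv_convEnv_of_hull hε (G := gridInterp ε g) (a := ε * a) (n := n) (fun i _ u hu => by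
      have e1 : ε * (a : ℝ) + i * ε = ((a + i : ℤ) : ℝ) * ε := by push_cast; ring
      have e2 : ε * (a : ℝ) + (i + 1) * ε = (((a + i : ℤ) : ℝ) + 1) * ε := by push_cast; ring
      rw [e1, e2] at hu
      rw [e1, hnode, gridInterp_eq hε g _ hu]
      rfl) hull hi
    convert this using 2
    · push_cast; ring_nf
    · push_cast; ring
  · simp only [cellAt, show (-1 : ℤ) ≠ 1 by norm_num, if_false] at hull ⊢
    unfold cellSpeed
    rw [if_neg (by push_cast; nlinarith)]
    have := deriv_concEnv_of_hull hε (G := gridInterp ε g) (a := ε * a) (n := n) (fun i _ u hu => by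
      have e1 : ε * (a : ℝ) - i * ε = (((a - 1 - i : ℤ) : ℝ) + 1) * ε := by push_cast; ring
      have e2 : ε * (a : ℝ) - (i + 1) * ε = ((a - 1 - i : ℤ) : ℝ) * ε := by push_cast; ring
      rw [e1, e2] at hu
      have h1 := gridInterp_eq hε g _ hu
      have h2 := gridInterp_eq hε g (a - 1 - i) (u := (((a - 1 - i : ℤ) : ℝ) + 1) * ε)
        ⟨by nlinarith, le_rfl⟩
      rw [e1, h1, h2]
      unfold cellSlope
      ring) hull hi
    convert this using 2
    · push_cast; ring_nf
    · push_cast; ring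

theorem mem_cells_iff (hε : 0 < ε) {η a : ℤ} (hη : η = 1 ∨ η = -1) {n : ℕ} {k : ℤ} :
    k ∈ cells ε (ε * a) (ε * (a + η * n : ℤ)) ↔ ∃ i < n, cellAt η a i = k := by
  have key : ∀ u v : ℤ, (ε * (u : ℝ) ≤ k * ε ∧ ((k : ℝ) + 1) * ε ≤ ε * v) ↔ u ≤ k ∧ k + 1 ≤ v := by
    intro u v
    rw [mul_comm ε (u : ℝ), mul_comm ε (v : ℝ), mul_le_mul_iff_left₀ hε, mul_le_mul_iff_left₀ hε]
    norm_cast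
  unfold cells
  rw [mem_ofPred_eq]
  rcases hη with rfl | rfl
  · have h : ε * (a : ℝ) ≤ ε * (a + 1 * n : ℤ) := by
      push_cast
      have : (0 : ℝ) ≤ n := Nat.cast_nonneg n
      nlinarith
    rw [min_eq_left h, max_eq_right h, key]
    simp only [cellAt, if_true]
    constructor
    · rintro ⟨h1, h2⟩
      exact ⟨(k - a).toNat, by omega, by omega⟩
    · rintro ⟨i, h1, h2⟩
      omega
  · have h : ε * (a + (-1) * n : ℤ) ≤ ε * (a : ℝ) := by
      push_cast
      have : (0 : ℝ) ≤ n := Nat.cast_nonneg n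
      nlinarith
    rw [min_eq_right h, max_eq_left h, key]
    simp only [cellAt, show (-1 : ℤ) ≠ 1 by norm_num, if_false]
    constructor
    · rintro ⟨h1, h2⟩
      exact ⟨(a - 1 - k).toNat, by omega, by omega⟩
    · rintro ⟨i, h1, h2⟩
      omega

theorem profile_group (c : Config ε sgn r W X p) {s : ℕ} (hs : s ∈ W) :
    p (X s) = ε * (leftState sgn W X (X s) + sgn s * (groupAt W X (X s)).card : ℤ) := by
  rw [c.profile_eq, c.sum_sgn_eq hs (Finset.Subset.refl _)]

theorem sgn_congr (c : Config ε sgn r W X p) {s s' : ℕ} (hs : s ∈ W) (hs' : s' ∈ groupAt W X (X s)) :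
    sgn s' = sgn s :=
  c.sign s' (mem_groupAt.1 hs').1 s hs (mem_groupAt.1 hs').2

/-- The speed of the wave `s` when the jump at its position is resolved with the flux `g`. -/
noncomputable def speed (ε : ℝ) (sgn r : ℕ → ℤ) (X : ℕ → ℝ) (p : ℝ → ℝ) (g : ℝ → ℝ) (s : ℕ) : ℝ :=
  cellSpeed ε g (Function.leftLim p (X s)) (p (X s)) (waveCell sgn r s)

theorem speed_eq_of_hull (hε : 0 < ε) (c : Config ε sgn r W X p) (g : ℝ → ℝ) {s : ℕ} (hs : s ∈ W)
    {σ : ℕ → ℝ} (hull : IsHull (groupAt W X (X s)).card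
      (fun i => cellSlope ε g (cellAt (sgn s) (leftState sgn W X (X s)) i)) σ) :
    ∀ i ∈ groupAt W X (X s), speed ε sgn r X p g i = σ (rankIn (groupAt W X (X s)) i) := by
  intro i hi
  obtain ⟨hiW, hiX⟩ := mem_groupAt.1 hi
  unfold speed
  rw [c.waveCell_eq hiW, c.sgn_congr hs hi, c.leftLim_eq, hiX, c.profile_group hs]
  exact cellSpeed_eq_hull hε g (c.sgn_eq s) hull (rankIn_lt_card hi)

theorem cellSlope_eq (c : Config ε sgn r W X p) (g : ℝ → ℝ) {s : ℕ} (hs : s ∈ W) :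
    ∀ i ∈ groupAt W X (X s), cellSlope ε g (waveCell sgn r i) =
      cellSlope ε g (cellAt (sgn s) (leftState sgn W X (X s)) (rankIn (groupAt W X (X s)) i)) := by
  intro i hi
  obtain ⟨hiW, hiX⟩ := mem_groupAt.1 hi
  rw [c.waveCell_eq hiW, c.sgn_congr hs hi, hiX]

theorem speed_mono (hε : 0 < ε) (c : Config ε sgn r W X p) (g : ℝ → ℝ) {s s' : ℕ} (hs : s ∈ W)
    (hs' : s' ∈ W) (hX : X s = X s') (h : s ≤ s') :
    speed ε sgn r X p g s ≤ speed ε sgn r X p g s' := by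
  obtain ⟨σ, hσ⟩ := exists_isHull (groupAt W X (X s)).card
    (fun i => cellSlope ε g (cellAt (sgn s) (leftState sgn W X (X s)) i))
  have hm : s ∈ groupAt W X (X s) := mem_groupAt.2 ⟨hs, rfl⟩
  have hm' : s' ∈ groupAt W X (X s) := mem_groupAt.2 ⟨hs', hX.symm⟩
  rw [c.speed_eq_of_hull hε g hs hσ s hm, c.speed_eq_of_hull hε g hs hσ s' hm']
  exact hσ.mono _ _ (rankIn_le h) (rankIn_lt_card hm')

theorem tail_le (hε : 0 < ε) (c : Config ε sgn r W X p) (g : ℝ → ℝ) {y b : ℝ} {A : Finset ℕ}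
    (hA : ∀ s ∈ A, s ∈ W ∧ X s = y ∧ speed ε sgn r X p g s ≤ b)
    (hA' : ∀ s ∈ A, ∀ i ∈ W, X i = y → s ≤ i → speed ε sgn r X p g i ≤ b → i ∈ A) :
    ∑ s ∈ A, cellSlope ε g (waveCell sgn r s) ≤ ∑ s ∈ A, speed ε sgn r X p g s := by
  rcases A.eq_empty_or_nonempty with rfl | ⟨s₀, hs₀⟩
  · simp
  obtain ⟨hs₀W, rfl, -⟩ := hA s₀ hs₀
  obtain ⟨σ, hσ⟩ := exists_isHull (groupAt W X (X s₀)).card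
    (fun i => cellSlope ε g (cellAt (sgn s₀) (leftState sgn W X (X s₀)) i))
  have hsp := c.speed_eq_of_hull hε g hs₀W hσ
  have hmem : ∀ s ∈ A, s ∈ groupAt W X (X s₀) := fun s hs =>
    mem_groupAt.2 ⟨(hA s hs).1, (hA s hs).2.1⟩
  rw [Finset.sum_congr rfl fun s hs => c.cellSlope_eq g hs₀W s (hmem s hs),
    Finset.sum_congr rfl fun s hs => hsp s (hmem s hs)]
  refine hσ.tail_le (c := b) (fun s hs => ⟨hmem s hs, hsp s (hmem s hs) ▸ (hA s hs).2.2⟩) ?_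
  intro s hs i hi hsi hle
  exact hA' s hs i (mem_groupAt.1 hi).1 (mem_groupAt.1 hi).2 hsi (by rw [hsp i hi]; exact hle)

theorem head_le (hε : 0 < ε) (c : Config ε sgn r W X p) (g : ℝ → ℝ) {y b : ℝ} {A : Finset ℕ}
    (hA : ∀ s ∈ A, s ∈ W ∧ X s = y ∧ b ≤ speed ε sgn r X p g s)
    (hA' : ∀ s ∈ A, ∀ i ∈ W, X i = y → i ≤ s → b ≤ speed ε sgn r X p g i → i ∈ A) :
    ∑ s ∈ A, speed ε sgn r X p g s ≤ ∑ s ∈ A, cellSlope ε g (waveCell sgn r s) := by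
  rcases A.eq_empty_or_nonempty with rfl | ⟨s₀, hs₀⟩
  · simp
  obtain ⟨hs₀W, rfl, -⟩ := hA s₀ hs₀
  obtain ⟨σ, hσ⟩ := exists_isHull (groupAt W X (X s₀)).card
    (fun i => cellSlope ε g (cellAt (sgn s₀) (leftState sgn W X (X s₀)) i))
  have hsp := c.speed_eq_of_hull hε g hs₀W hσ
  have hmem : ∀ s ∈ A, s ∈ groupAt W X (X s₀) := fun s hs =>
    mem_groupAt.2 ⟨(hA s hs).1, (hA s hs).2.1⟩
  rw [Finset.sum_congr rfl fun s hs => c.cellSlope_eq g hs₀W s (hmem s hs),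
    Finset.sum_congr rfl fun s hs => hsp s (hmem s hs)]
  refine hσ.head_le (c := b) (fun s hs => ⟨hmem s hs, hsp s (hmem s hs) ▸ (hA s hs).2.2⟩) ?_
  intro s hs i hi hsi hle
  exact hA' s hs i (mem_groupAt.1 hi).1 (mem_groupAt.1 hi).2 hsi (by rw [hsp i hi]; exact hle)

/-- A group moves with a single speed if that speed is at most the average slope of all its initial
parts, and equal to the average slope of the whole group. -/
theorem speed_eq_const (hε : 0 < ε) (c : Config ε sgn r W X p) (g : ℝ → ℝ) {s : ℕ} (hs : s ∈ W)
    {b : ℝ} (hle : ∀ B ⊆ groupAt W X (X s), (∀ i ∈ B, ∀ i' ∈ groupAt W X (X s), i' ≤ i → i' ∈ B) →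
      B.card * b ≤ ∑ i ∈ B, cellSlope ε g (waveCell sgn r i))
    (heq : (groupAt W X (X s)).card * b =
      ∑ i ∈ groupAt W X (X s), cellSlope ε g (waveCell sgn r i)) :
    speed ε sgn r X p g s = b := by
  classical
  -- Every initial segment of the cells of the jump is the set of cells of an initial part of the
  -- group.
  have hsum : ∀ l ≤ (groupAt W X (X s)).card, ∃ B ⊆ groupAt W X (X s),
      (∀ i ∈ B, ∀ i' ∈ groupAt W X (X s), i' ≤ i → i' ∈ B) ∧ B.card = l ∧
      ∑ i ∈ B, cellSlope ε g (waveCell sgn r i) = ∑ i ∈ Finset.range l,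
        cellSlope ε g (cellAt (sgn s) (leftState sgn W X (X s)) i) := by
    intro l hl
    let B := (groupAt W X (X s)).filter fun i => rankIn (groupAt W X (X s)) i < l
    have hB : B ⊆ groupAt W X (X s) := Finset.filter_subset _ _
    have himage : B.image (rankIn (groupAt W X (X s))) = Finset.range l := by
      ext i
      rw [Finset.mem_image, Finset.mem_range]
      constructor
      · rintro ⟨j, hj, rfl⟩
        exact (Finset.mem_filter.1 hj).2
      · intro hi
        obtain ⟨j, hj, rfl⟩ := exists_rankIn_eq (hi.trans_le hl)
        exact ⟨j, Finset.mem_filter.2 ⟨hj, hi⟩, rfl⟩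
    have hinj : InjOn (rankIn (groupAt W X (X s))) B := (rankIn_injOn _).mono hB
    refine ⟨B, hB, fun i hi i' hi' h => ?_, ?_, ?_⟩
    · exact Finset.mem_filter.2 ⟨hi', (rankIn_le h).trans_lt (Finset.mem_filter.1 hi).2⟩
    · rw [← Finset.card_image_of_injOn hinj, himage, Finset.card_range]
    · rw [← himage, Finset.sum_image hinj]
      exact Finset.sum_congr rfl fun i hi => c.cellSlope_eq g hs i (hB hi)
  have hull : IsHull (groupAt W X (X s)).card
      (fun i => cellSlope ε g (cellAt (sgn s) (leftState sgn W X (X s)) i)) (fun _ => b) := by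
    refine IsHull.const (fun l hl => ?_) ?_
    · obtain ⟨B, hB1, hB2, hB3, hB4⟩ := hsum l hl
      rw [← hB4, ← hB3]
      exact hle B hB1 hB2
    · obtain ⟨B, hB1, hB2, hB3, hB4⟩ := hsum _ le_rfl
      rw [← hB4, Finset.eq_of_subset_of_card_le hB1 hB3.ge]
      exact heq
  exact c.speed_eq_of_hull hε g hs hull s (mem_groupAt.2 ⟨hs, rfl⟩)

theorem mem_cells (hε : 0 < ε) (c : Config ε sgn r W X p) {y : ℝ} {k : ℤ} :
    k ∈ cells ε (Function.leftLim p y) (p y) ↔ ∃ s ∈ groupAt W X y, waveCell sgn r s = k := by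
  rcases (groupAt W X y).eq_empty_or_nonempty with h | ⟨s₀, hs₀⟩
  · rw [c.leftLim_eq, c.profile_eq, h]
    have := mem_cells_iff hε (η := 1) (a := leftState sgn W X y) (Or.inl rfl) (n := 0) (k := k)
    simp only [Nat.cast_zero, mul_zero, Nat.not_lt_zero, false_and, exists_false] at this
    simpa using this
  obtain ⟨hs₀W, rfl⟩ := mem_groupAt.1 hs₀
  rw [c.leftLim_eq, c.profile_group hs₀W, mem_cells_iff hε (c.sgn_eq s₀)]
  constructor
  · rintro ⟨i, hi, rfl⟩
    obtain ⟨s, hs, rfl⟩ := exists_rankIn_eq hi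
    refine ⟨s, hs, ?_⟩
    rw [c.waveCell_eq (mem_groupAt.1 hs).1, c.sgn_congr hs₀W hs, (mem_groupAt.1 hs).2]
  · rintro ⟨s, hs, rfl⟩
    refine ⟨_, rankIn_lt_card hs, ?_⟩
    rw [c.waveCell_eq (mem_groupAt.1 hs).1, c.sgn_congr hs₀W hs, (mem_groupAt.1 hs).2]

theorem waveCell_injOn (c : Config ε sgn r W X p) (y : ℝ) :
    InjOn (waveCell sgn r) (groupAt W X y) := by
  intro s hs s' hs' h
  have hs : s ∈ groupAt W X y := hs
  have hs' : s' ∈ groupAt W X y := hs'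
  obtain ⟨hsW, rfl⟩ := mem_groupAt.1 hs
  rw [c.waveCell_eq hsW, c.waveCell_eq (mem_groupAt.1 hs').1, c.sgn_congr hsW hs',
    (mem_groupAt.1 hs').2] at h
  refine rankIn_injOn _ hs hs' ?_
  unfold cellAt at h
  split_ifs at h <;> omega

theorem sign_jump (hε : 0 < ε) (c : Config ε sgn r W X p) {s : ℕ} (hs : s ∈ W) :
    Real.sign (p (X s) - Function.leftLim p (X s)) = sgn s := by
  have hpos : (0 : ℝ) < (groupAt W X (X s)).card := by
    exact_mod_cast Finset.card_pos.2 ⟨s, mem_groupAt.2 ⟨hs, rfl⟩⟩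
  rw [c.leftLim_eq, c.profile_group hs]
  rcases c.sgn_eq s with h | h <;> rw [h]
  · rw [Real.sign_of_pos]
    · simp
    · push_cast; nlinarith
  · rw [Real.sign_of_neg]
    · simp
    · push_cast; nlinarith

-- Waves at `y` correspond one to one to the cells of the jump at `y`, so counting the cells that
-- have been passed is counting the waves with speed at most `ξ`.
open Classical in
theorem riemann_sub_leftLim (hε : 0 < ε) (c : Config ε sgn r W X p) (g : ℝ → ℝ) (y ξ : ℝ) :
    riemann ε g (Function.leftLim p y) (p y) ξ - Function.leftLim p y =
      ε * (∑ i ∈ groupAt W X y with speed ε sgn r X p g i ≤ ξ, sgn i : ℤ) := by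
  rcases (groupAt W X y).eq_empty_or_nonempty with h | ⟨s₀, hs₀⟩
  · unfold riemann
    rw [c.leftLim_eq, c.profile_eq, h]
    simp
  obtain ⟨hs₀W, rfl⟩ := mem_groupAt.1 hs₀
  set F := (groupAt W X (X s₀)).filter (fun i => speed ε sgn r X p g i ≤ ξ) with hF
  have hFsub : F ⊆ groupAt W X (X s₀) := Finset.filter_subset _ _
  have hset : {k ∈ cells ε (Function.leftLim p (X s₀)) (p (X s₀)) |
      cellSpeed ε g (Function.leftLim p (X s₀)) (p (X s₀)) k ≤ ξ} =
      ↑(F.image (waveCell sgn r)) := by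
    ext k
    rw [Finset.coe_image, Set.mem_image, mem_ofPred_eq, c.mem_cells hε]
    constructor
    · rintro ⟨⟨s, hs, rfl⟩, h2⟩
      refine ⟨s, Finset.mem_coe.2 (Finset.mem_filter.2 ⟨hs, ?_⟩), rfl⟩
      unfold speed
      rwa [(mem_groupAt.1 hs).2]
    · rintro ⟨s, hs, rfl⟩
      obtain ⟨h1, h2⟩ := Finset.mem_filter.1 (Finset.mem_coe.1 hs)
      unfold speed at h2
      rw [(mem_groupAt.1 h1).2] at h2
      exact ⟨⟨s, h1, rfl⟩, h2⟩
  have hsign := c.sign_jump hε hs₀W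
  unfold riemann
  rw [hset, Set.ncard_coe_finset, Finset.card_image_of_injOn
    ((c.waveCell_injOn _).mono hFsub), hsign, c.sum_sgn_eq hs₀W hFsub]
  push_cast
  ring

open Classical in
/-- The profile after the elapsed time `τ`. -/
theorem glue_eq (hε : 0 < ε) (c : Config ε sgn r W X p) (f : ℝ × ℝ → ℝ) (q : ℝ → ℝ) {τ : ℝ}
    (hτ : 0 < τ) (x : ℝ) :
    glue f ε q p τ x = ε * (∑ i ∈ W with
      X i + speed ε sgn r X p (fun w => f (w, q (X i))) i * τ ≤ x, sgn i : ℤ) := by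
  unfold glue
  simp only [c.riemann_sub_leftLim hε]
  -- Only positions of waves contribute: elsewhere the profile has no jump.
  rw [finsum_eq_sum_of_support_subset (s := W.image X)]
  · rw [← Finset.mul_sum, ← Int.cast_sum]
    congr 2
    rw [← Finset.sum_fiberwise_of_maps_to (s := W.filter _) (t := W.image X) (g := X)
      (fun i hi => Finset.mem_image_of_mem X (Finset.mem_filter.1 hi).1)]
    refine Finset.sum_congr rfl fun y _ => Finset.sum_congr ?_ fun _ _ => rfl
    ext i
    simp only [Finset.mem_filter, mem_groupAt]
    constructor
    · rintro ⟨⟨h1, rfl⟩, h2⟩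
      rw [le_div_iff₀ hτ] at h2
      exact ⟨⟨h1, by linarith⟩, rfl⟩
    · rintro ⟨⟨h1, h2⟩, rfl⟩
      refine ⟨⟨h1, rfl⟩, ?_⟩
      rw [le_div_iff₀ hτ]
      linarith
  · intro y hy
    by_contra hy'
    refine hy ?_
    have : groupAt W X y = ∅ := by
      refine Finset.eq_empty_of_forall_notMem fun i hi => hy' ?_
      rw [← (mem_groupAt.1 hi).2]
      exact_mod_cast Finset.mem_image_of_mem X (mem_groupAt.1 hi).1
    simp [this]

end Config

open PreConfig

/-! ### Evolution of a configuration up to the next collision -/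

namespace PreConfig

variable {ε : ℝ} {sgn r : ℕ → ℤ} {W : Finset ℕ} {X : ℕ → ℝ} {p : ℝ → ℝ}

/-- Waves whose signs add up to zero may be removed from a point if the waves which are left lie on
one side of them. -/
theorem sdiff (c : PreConfig ε sgn r W X p) {E : Finset ℕ} (hE : E ⊆ W) {x : ℝ}
    (hx : ∀ i ∈ E, X i = x) (hsum : ∑ i ∈ E, sgn i = 0)
    (hside : ∀ s ∈ W \ E, (∀ i ∈ E, s < i) ∨ ∀ i ∈ E, i < s) :
    PreConfig ε sgn r (W \ E) X p := by
  classical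
  have hsub : W \ E ⊆ W := Finset.sdiff_subset
  have hfilter : ∀ P : ℕ → Prop, ∑ i ∈ E with P i, sgn i = 0 →
      ∑ i ∈ W with P i, sgn i = ∑ i ∈ W \ E with P i, sgn i := by
    intro P hP
    have : W.filter P = (W \ E).filter P ∪ E.filter P := by
      rw [← Finset.filter_union, Finset.sdiff_union_of_subset hE]
    rw [this, Finset.sum_union, hP, add_zero]
    exact Finset.disjoint_filter_filter Finset.sdiff_disjoint
  have hall : ∀ P : ℕ → Prop, ((∀ i ∈ E, P i) ∨ ∀ i ∈ E, ¬ P i) → ∑ i ∈ E with P i, sgn i = 0 := by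
    rintro P (h | h)
    · rw [Finset.filter_true_of_mem h, hsum]
    · rw [Finset.filter_false_of_mem h, Finset.sum_empty]
  refine ⟨c.sgn_eq, fun s hs s' hs' => c.mono s (hsub hs) s' (hsub hs'), fun y => ?_, fun s hs => ?_⟩
  · rw [c.profile, hfilter (fun i => X i ≤ y)]
    refine hall _ ?_
    by_cases h : x ≤ y
    · exact Or.inl fun i hi => (hx i hi).trans_le h
    · exact Or.inr fun i hi hle => h ((hx i hi).symm.trans_le hle)
  · rw [c.right_state s (hsub hs)]
    convert hfilter (· ≤ s) (hall _ ?_)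
    rcases hside s hs with h | h
    · exact Or.inr fun i hi => not_le.2 (h i hi)
    · exact Or.inl fun i hi => (h i hi).le

end PreConfig

/-- A wave with sign `η` and right state `ρ` fits between the states on the two sides of `x`. -/
def Fits (ε : ℝ) (p : ℝ → ℝ) (x : ℝ) (η ρ : ℤ) : Prop :=
  η * Function.leftLim p x ≤ η * (ε * ρ) - ε ∧ η * (ε * ρ) ≤ η * p x

theorem fits_iff {ε : ℝ} (hε : 0 < ε) {p : ℝ → ℝ} {x : ℝ} {η ρ a b : ℤ}
    (ha : Function.leftLim p x = ε * a) (hb : p x = ε * b) :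
    Fits ε p x η ρ ↔ η * a ≤ η * ρ - 1 ∧ η * ρ ≤ η * b := by
  unfold Fits
  rw [ha, hb]
  have e1 : (η : ℝ) * (ε * a) ≤ η * (ε * ρ) - ε ↔ η * a ≤ η * ρ - 1 := by
    rw [show (η : ℝ) * (ε * a) = ε * ((η * a : ℤ) : ℝ) by push_cast; ring,
      show (η : ℝ) * (ε * ρ) - ε = ε * ((η * ρ - 1 : ℤ) : ℝ) by push_cast; ring,
      mul_le_mul_iff_right₀ hε]
    norm_cast
  have e2 : (η : ℝ) * (ε * ρ) ≤ η * (ε * b) ↔ η * ρ ≤ η * b := by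
    rw [show (η : ℝ) * (ε * ρ) = ε * ((η * ρ : ℤ) : ℝ) by push_cast; ring,
      show (η : ℝ) * (ε * b) = ε * ((η * b : ℤ) : ℝ) by push_cast; ring,
      mul_le_mul_iff_right₀ hε]
    norm_cast
  rw [e1, e2]

/-- The waves in `W` move with the speeds `σ` given by the Riemann problems, and the next collision
takes place after the time `τ` at the point `x`; there two wavefronts meet. -/
structure Step (f : ℝ × ℝ → ℝ) (ε : ℝ) (q p : ℝ → ℝ) (τ x : ℝ) (sgn r : ℕ → ℤ) (W : Finset ℕ)
    (X σ : ℕ → ℝ) : Prop where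
  conf : Config ε sgn r W X p
  eps_pos : 0 < ε
  speed_eq : ∀ s, σ s = Config.speed ε sgn r X p (fun w => f (w, q (X s))) s
  time_pos : 0 < τ
  least : ∀ τ' y, IsCollision f ε q p τ' y → τ ≤ τ'
  unique : ∀ y, IsCollision f ε q p τ y → y = x
  binary : (arriving f ε q p τ x).ncard = 2

namespace Step

variable {f : ℝ × ℝ → ℝ} {ε : ℝ} {q p : ℝ → ℝ} {τ x : ℝ} {sgn r : ℕ → ℤ} {W : Finset ℕ}
  {X σ : ℕ → ℝ}

theorem isFront (S : Step f ε q p τ x sgn r W X σ) {s : ℕ} (hs : s ∈ W) :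
    IsFront f ε q p ⟨Family.second, X s, σ s⟩ :=
  ⟨waveCell sgn r s, (S.conf.mem_cells S.eps_pos).2 ⟨s, mem_groupAt.2 ⟨hs, rfl⟩, rfl⟩,
    S.speed_eq s⟩

theorem exists_wave (S : Step f ε q p τ x sgn r W X σ) {y v : ℝ}
    (h : IsFront f ε q p ⟨Family.second, y, v⟩) : ∃ s ∈ W, X s = y ∧ σ s = v := by
  obtain ⟨k, hk, hv⟩ := h
  obtain ⟨s, hs, rfl⟩ := (S.conf.mem_cells S.eps_pos).1 hk
  obtain ⟨hsW, hsX⟩ := mem_groupAt.1 hs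
  refine ⟨s, hsW, hsX, ?_⟩
  rw [S.speed_eq s, Config.speed, hsX]
  exact hv.symm

theorem mem_arriving (S : Step f ε q p τ x sgn r W X σ) {s : ℕ} (hs : s ∈ W) (τ' : ℝ) :
    (⟨Family.second, X s, σ s⟩ : Front) ∈ arriving f ε q p τ' (X s + σ s * τ') :=
  ⟨S.isFront hs, rfl⟩

theorem isCollision (S : Step f ε q p τ x sgn r W X σ) {s s' : ℕ} (hs : s ∈ W) (hs' : s' ∈ W)
    {τ' : ℝ} (hτ' : 0 < τ') (h : X s + σ s * τ' = X s' + σ s' * τ')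
    (hne : ¬ (X s = X s' ∧ σ s = σ s')) : IsCollision f ε q p τ' (X s + σ s * τ') := by
  refine ⟨hτ', _, S.mem_arriving hs τ', ⟨Family.second, X s', σ s'⟩, ?_, ?_⟩
  · rw [h]; exact S.mem_arriving hs' τ'
  · intro heq
    rw [Front.mk.injEq] at heq
    exact hne heq.2

theorem speed_mono (S : Step f ε q p τ x sgn r W X σ) {s s' : ℕ} (hs : s ∈ W) (hs' : s' ∈ W)
    (hX : X s = X s') (h : s ≤ s') : σ s ≤ σ s' := by
  rw [S.speed_eq s, S.speed_eq s', ← hX]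
  exact S.conf.speed_mono S.eps_pos _ hs hs' hX h

/-- Waves at different positions could change their order only by meeting strictly before the time
`τ`, which would be an earlier collision. -/
theorem mono (S : Step f ε q p τ x sgn r W X σ) {s s' : ℕ} (hs : s ∈ W) (hs' : s' ∈ W)
    (h : s ≤ s') : X s + σ s * τ ≤ X s' + σ s' * τ := by
  have hτ := S.time_pos
  rcases (S.conf.mono s hs s' hs' h).eq_or_lt with hX | hX
  · have := mul_le_mul_of_nonneg_right (S.speed_mono hs hs' hX h) hτ.le
    linarith
  by_contra hlt
  rw [not_le] at hlt
  have hσ : 0 < σ s - σ s' := by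
    by_contra hle
    nlinarith
  have hτ' : 0 < (X s' - X s) / (σ s - σ s') := div_pos (by linarith) hσ
  have hmeet : X s + σ s * ((X s' - X s) / (σ s - σ s')) =
      X s' + σ s' * ((X s' - X s) / (σ s - σ s')) := by
    field_simp
    ring
  have h1 := S.least _ _ (S.isCollision hs hs' hτ' hmeet fun h => hX.ne h.1)
  rw [le_div_iff₀ hσ] at h1
  linarith

theorem same_front (S : Step f ε q p τ x sgn r W X σ) {s s' : ℕ} (hs : s ∈ W) (hs' : s' ∈ W)
    (h : X s + σ s * τ = X s' + σ s' * τ) (hx : X s + σ s * τ ≠ x) : X s = X s' ∧ σ s = σ s' := by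
  by_contra hne
  exact hx (S.unique _ (S.isCollision hs hs' S.time_pos h hne))

/-- The two possible kinds of collision. -/
theorem collision_cases (S : Step f ε q p τ x sgn r W X σ) :
    ((∃ F ∈ arriving f ε q p τ x, F.family = Family.first) ∧
      ∀ s ∈ W, ∀ s' ∈ W, X s + σ s * τ = x → X s' + σ s' * τ = x → X s = X s' ∧ σ s = σ s') ∨
    ((∀ F ∈ arriving f ε q p τ x, F.family = Family.second) ∧ ∃ s₁ ∈ W, ∃ s₂ ∈ W, X s₁ < X s₂ ∧
      X s₁ + σ s₁ * τ = x ∧ X s₂ + σ s₂ * τ = x ∧ ∀ s ∈ W, X s + σ s * τ = x →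
        (X s = X s₁ ∧ σ s = σ s₁) ∨ (X s = X s₂ ∧ σ s = σ s₂)) := by
  obtain ⟨F, G, hFG, hset⟩ := Set.ncard_eq_two.1 S.binary
  have hτ := S.time_pos
  have hF : F ∈ arriving f ε q p τ x := by rw [hset]; simp
  have hG : G ∈ arriving f ε q p τ x := by rw [hset]; simp
  have hwave : ∀ s ∈ W, X s + σ s * τ = x → (⟨Family.second, X s, σ s⟩ : Front) = F ∨
      (⟨Family.second, X s, σ s⟩ : Front) = G := by
    intro s hs hx
    have := S.mem_arriving hs τ
    rw [hx, hset] at this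
    simpa using this
  -- If one of the two wavefronts is of the first family, all the waves arriving at `x` belong to
  -- the other one.
  have hmixed : ∀ F G : Front, F.family = Family.first → (∀ s ∈ W, X s + σ s * τ = x →
      (⟨Family.second, X s, σ s⟩ : Front) = F ∨ (⟨Family.second, X s, σ s⟩ : Front) = G) →
      ∀ s ∈ W, ∀ s' ∈ W, X s + σ s * τ = x → X s' + σ s' * τ = x → X s = X s' ∧ σ s = σ s' := by
    intro F G hFf hw s hs s' hs' hx hx'
    have h1 : (⟨Family.second, X s, σ s⟩ : Front) = G :=
      (hw s hs hx).resolve_left fun h => by rw [← h] at hFf; cases hFf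
    have h2 : (⟨Family.second, X s', σ s'⟩ : Front) = G :=
      (hw s' hs' hx').resolve_left fun h => by rw [← h] at hFf; cases hFf
    have := h1.trans h2.symm
    rw [Front.mk.injEq] at this
    exact this.2
  rcases hFf : F.family with _ | _
  · exact Or.inl ⟨⟨F, hF, hFf⟩, hmixed F G hFf hwave⟩
  rcases hGf : G.family with _ | _
  · exact Or.inl ⟨⟨G, hG, hGf⟩, hmixed G F hGf fun s hs hx => (hwave s hs hx).symm⟩
  right
  refine ⟨fun H hH => ?_, ?_⟩
  · rw [hset] at hH
    rcases hH with rfl | rfl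
    · exact hFf
    · exact hGf
  obtain ⟨Ff, Fp, Fs⟩ := F
  obtain ⟨Gf, Gp, Gs⟩ := G
  simp only at hFf hGf
  subst hFf hGf
  obtain ⟨s, hs, rfl, rfl⟩ := S.exists_wave hF.1
  obtain ⟨s', hs', rfl, rfl⟩ := S.exists_wave hG.1
  have hx : X s + σ s * τ = x := hF.2
  have hx' : X s' + σ s' * τ = x := hG.2
  have hw : ∀ i ∈ W, X i + σ i * τ = x →
      (X i = X s ∧ σ i = σ s) ∨ (X i = X s' ∧ σ i = σ s') := by
    intro i hi hix
    rcases hwave i hi hix with h | h <;> rw [Front.mk.injEq] at h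
    · exact Or.inl h.2
    · exact Or.inr h.2
  -- Two different wavefronts leaving the same point have different speeds and cannot meet again.
  rcases lt_trichotomy (X s) (X s') with h | h | h
  · exact ⟨s, hs, s', hs', h, hx, hx', hw⟩
  · exfalso
    refine hFG ?_
    have : σ s * τ = σ s' * τ := by linarith
    rw [h, mul_right_cancel₀ hτ.ne' this]
  · exact ⟨s', hs', s, hs, h, hx', hx, fun i hi hix => (hw i hi hix).symm⟩

/-- Before cancellations are taken into account, `x` may carry waves of both signs; hence only
`PreConfig`. -/
theorem preConfig (S : Step f ε q p τ x sgn r W X σ) :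
    PreConfig ε sgn r W (fun s => X s + σ s * τ) (glue f ε q p τ) where
  sgn_eq := S.conf.sgn_eq
  mono := fun s hs s' hs' h => S.mono hs hs' h
  profile := fun y => by
    classical
    rw [S.conf.glue_eq S.eps_pos f q S.time_pos]
    simp only [S.speed_eq]
  right_state := S.conf.right_state

/-- If no waves of opposite signs meet, then all the waves stay. -/
theorem config_of_same_sign (S : Step f ε q p τ x sgn r W X σ)
    (h : ∀ s ∈ W, ∀ s' ∈ W, X s + σ s * τ = x → X s' + σ s' * τ = x → sgn s = sgn s') :
    Config ε sgn r W (fun s => X s + σ s * τ) (glue f ε q p τ) where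
  toPreConfig := S.preConfig
  sign := fun s hs s' hs' hX => by
    by_cases hx : X s + σ s * τ = x
    · exact h s hs s' hs' hx (hX.symm.trans hx)
    · exact S.conf.sign s hs s' hs' (S.same_front hs hs' hX hx).1

theorem _root_.WavefrontTracking.Config.fits (hε : 0 < ε) (c : Config ε sgn r W X p) {s : ℕ}
    (hs : s ∈ W) : Fits ε p (X s) (sgn s) (r s) := by
  rw [fits_iff hε (c.leftLim_eq _) (c.profile_group hs), c.right_state_eq hs]
  have hlt := rankIn_lt_card (mem_groupAt.2 ⟨hs, rfl⟩ : s ∈ groupAt W X (X s))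
  rcases c.sgn_eq s with h | h <;> rw [h] <;> constructor <;> omega

/-- The configuration after the collision: the waves at `x` which do not fit are canceled. If
waves of a wavefront are canceled then it has met waves of the opposite sign. -/
theorem next_config (S : Step f ε q p τ x sgn r W X σ) {W' : Finset ℕ}
    (hW' : ∀ s, s ∈ W' ↔ s ∈ W ∧
      ¬ (X s + σ s * τ = x ∧ ¬ Fits ε (glue f ε q p τ) x (sgn s) (r s))) :
    Config ε sgn r W' (fun s => X s + σ s * τ) (glue f ε q p τ) ∧
    (∀ s ∈ W', ∀ i ∈ W, s ≤ i → X i = X s → σ i = σ s → i ∉ W' → ∃ m ∈ W, sgn m ≠ sgn s ∧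
      (∀ s₀ ∈ W', X s₀ + σ s₀ * τ = X s + σ s * τ → s₀ ≤ m) ∧
      ∀ s' ∈ W', X s + σ s * τ < X s' + σ s' * τ → m ≤ s') ∧
    (∀ s ∈ W', ∀ i ∈ W, i ≤ s → X i = X s → σ i = σ s → i ∉ W' → ∃ m ∈ W, sgn m ≠ sgn s ∧
      (∀ s₀ ∈ W', X s₀ + σ s₀ * τ = X s + σ s * τ → m ≤ s₀) ∧
      ∀ s' ∈ W', X s' + σ s' * τ < X s + σ s * τ → s' ≤ m) := by
  classical
  set X' : ℕ → ℝ := fun s => X s + σ s * τ with hX'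
  set p' := glue f ε q p τ with hp'
  have hε := S.eps_pos
  by_cases hsame : ∀ s ∈ W, ∀ s' ∈ W, X' s = x → X' s' = x → sgn s = sgn s'
  · have hc : Config ε sgn r W X' p' := S.config_of_same_sign hsame
    have hWW : W' = W := by
      ext s
      rw [hW']
      refine ⟨fun h => h.1, fun h => ⟨h, fun ⟨h1, h2⟩ => h2 ?_⟩⟩
      have h3 : X' s = x := h1
      rw [← h3]
      exact hc.fits hε h
    rw [hWW]
    exact ⟨hc, fun s hs i hi _ _ _ h => absurd hi h, fun s hs i hi _ _ _ h => absurd hi h⟩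
  obtain ⟨s₁, hs₁, s₂, hs₂, hlt, hx₁, hx₂, hw⟩ : ∃ s₁ ∈ W, ∃ s₂ ∈ W, X s₁ < X s₂ ∧
      X s₁ + σ s₁ * τ = x ∧ X s₂ + σ s₂ * τ = x ∧ ∀ s ∈ W, X s + σ s * τ = x →
        (X s = X s₁ ∧ σ s = σ s₁) ∨ (X s = X s₂ ∧ σ s = σ s₂) := by
    rcases S.collision_cases with ⟨-, h⟩ | ⟨-, h⟩
    · exact absurd (fun s hs s' hs' h1 h2 => S.conf.sign s hs s' hs' (h s hs s' hs' h1 h2).1) hsame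
    · exact h
  have hpc : PreConfig ε sgn r W X' p' := S.preConfig
  let L := W.filter fun s => X' s = x ∧ X s = X s₁
  let R := W.filter fun s => X' s = x ∧ X s = X s₂
  have hL : ∀ s, s ∈ L ↔ s ∈ W ∧ X' s = x ∧ X s = X s₁ := fun s => Finset.mem_filter
  have hR : ∀ s, s ∈ R ↔ s ∈ W ∧ X' s = x ∧ X s = X s₂ := fun s => Finset.mem_filter
  clear_value L R
  have hLR : ∀ s ∈ W, X' s = x → s ∈ L ∨ s ∈ R := fun s hs hx => by
    rcases hw s hs hx with h | h
    · exact Or.inl ((hL s).2 ⟨hs, hx, h.1⟩)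
    · exact Or.inr ((hR s).2 ⟨hs, hx, h.1⟩)
  have hLltR : ∀ s ∈ L, ∀ s' ∈ R, s < s' := fun s hs s' hs' =>
    S.conf.lt_of_pos_lt ((hL s).1 hs).1 ((hR s').1 hs').1
      (by rw [((hL s).1 hs).2.2, ((hR s').1 hs').2.2]; exact hlt)
  have hs₁L : s₁ ∈ L := (hL s₁).2 ⟨hs₁, hx₁, rfl⟩
  have hs₂R : s₂ ∈ R := (hR s₂).2 ⟨hs₂, hx₂, rfl⟩
  have hsgnL : ∀ s ∈ L, sgn s = sgn s₁ := fun s hs =>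
    S.conf.sign s ((hL s).1 hs).1 s₁ hs₁ ((hL s).1 hs).2.2
  have hsgn12 : sgn s₂ = -sgn s₁ := by
    have hne : sgn s₁ ≠ sgn s₂ := by
      intro heq
      refine hsame fun s hs s' hs' hx hx' => ?_
      have hall : ∀ s ∈ W, X' s = x → sgn s = sgn s₁ := fun s hs hx => by
        rcases hLR s hs hx with h | h
        · exact hsgnL s h
        · rw [heq]; exact S.conf.sign s hs s₂ hs₂ ((hR s).1 h).2.2
      rw [hall s hs hx, hall s' hs' hx']
    rcases S.conf.sgn_eq s₁ with h | h <;> rcases S.conf.sgn_eq s₂ with h' | h' <;>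
      rw [h, h'] at hne ⊢ <;> simp at hne ⊢
  have hsgnR : ∀ s ∈ R, sgn s = -sgn s₁ := fun s hs => by
    rw [← hsgn12]
    exact S.conf.sign s ((hR s).1 hs).1 s₂ hs₂ ((hR s).1 hs).2.2
  set η := sgn s₁ with hη
  have hηη : η * η = 1 := by rcases S.conf.sgn_eq s₁ with h | h <;> rw [hη, h] <;> norm_num
  have hdisj : Disjoint L R := Finset.disjoint_left.2 fun s h1 h2 => absurd (hLltR s h1 s h2) (by simp)
  have hgroup : groupAt W X' x = L ∪ R := by
    ext s
    rw [mem_groupAt, Finset.mem_union]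
    exact ⟨fun ⟨h1, h2⟩ => hLR s h1 h2, fun h => h.elim
      (fun h => ⟨((hL s).1 h).1, ((hL s).1 h).2.1⟩) fun h => ⟨((hR s).1 h).1, ((hR s).1 h).2.1⟩⟩
  set a := leftState sgn W X' x with ha
  have hsumL : ∀ E ⊆ L, ∑ i ∈ E, sgn i = η * E.card := fun E hE => by
    rw [Finset.sum_congr rfl fun i hi => hsgnL i (hE hi), Finset.sum_const, nsmul_eq_mul, mul_comm]
  have hsumR : ∀ E ⊆ R, ∑ i ∈ E, sgn i = -η * E.card := fun E hE => by
    rw [Finset.sum_congr rfl fun i hi => hsgnR i (hE hi), Finset.sum_const, nsmul_eq_mul, mul_comm]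
  have hright : p' x = ε * (a + η * L.card - η * R.card : ℤ) := by
    rw [hpc.profile_eq, hgroup, Finset.sum_union hdisj, hsumL L (Finset.Subset.refl _),
      hsumR R (Finset.Subset.refl _), ← ha]
    push_cast
    ring
  have hrL : ∀ s ∈ L, r s = a + η * (rankIn L s + 1) := by
    intro s hs
    obtain ⟨hsW, hsx, -⟩ := (hL s).1 hs
    rw [hpc.right_state_eq_sum hsW, hsx, hgroup]
    have : (L ∪ R).filter (· ≤ s) = L.filter (· ≤ s) := by
      rw [Finset.filter_union, Finset.filter_false_of_mem (s := R), Finset.union_empty]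
      exact fun i hi => not_le.2 (hLltR s hs i hi)
    rw [this, hsumL _ (Finset.filter_subset _ _), card_filter_le hs]
    push_cast
    rfl
  have hrR : ∀ s ∈ R, r s = a + η * L.card - η * (rankIn R s + 1) := by
    intro s hs
    obtain ⟨hsW, hsx, -⟩ := (hR s).1 hs
    rw [hpc.right_state_eq_sum hsW, hsx, hgroup]
    have : (L ∪ R).filter (· ≤ s) = L ∪ R.filter (· ≤ s) := by
      rw [Finset.filter_union, Finset.filter_true_of_mem (s := L)]
      exact fun i hi => (hLltR i hi s hs).le
    rw [this, Finset.sum_union (Finset.disjoint_of_subset_right (Finset.filter_subset _ _) hdisj),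
      hsumL _ (Finset.Subset.refl _), hsumR _ (Finset.filter_subset _ _), card_filter_le hs]
    push_cast
    ring
  -- Of the left wavefront exactly the first `|L| - |R|` waves fit, and below, of the right one, the
  -- last `|R| - |L|`. So survivors on one side exclude survivors on the other.
  have hfitL : ∀ s ∈ L, (Fits ε p' x (sgn s) (r s) ↔ rankIn L s + R.card < L.card) := by
    intro s hs
    rw [fits_iff hε (hpc.leftLim_eq x) hright, hsgnL s hs, hrL s hs, ← ha]
    rw [show η * (a + η * (rankIn L s + 1)) = η * a + η * η * (rankIn L s + 1) by ring,
      show η * (a + η * (L.card : ℤ) - η * R.card) =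
        η * a + η * η * L.card - η * η * R.card by ring, hηη]
    omega
  have hfitR : ∀ s ∈ R, (Fits ε p' x (sgn s) (r s) ↔ L.card ≤ rankIn R s) := by
    intro s hs
    have hlt := rankIn_lt_card hs
    rw [fits_iff hε (hpc.leftLim_eq x) hright, hsgnR s hs, hrR s hs, ← ha]
    rw [show -η * (a + η * (L.card : ℤ) - η * (rankIn R s + 1)) =
        -η * a - η * η * L.card + η * η * (rankIn R s + 1) by ring,
      show -η * (a + η * (L.card : ℤ) - η * R.card) =
        -η * a - η * η * L.card + η * η * R.card by ring, hηη]
    omega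
  have hWL : ∀ s ∈ L, (s ∈ W' ↔ rankIn L s + R.card < L.card) := fun s hs => by
    rw [hW', ← hfitL s hs]
    have h1 := (hL s).1 hs
    exact ⟨fun h => by_contra fun hn => h.2 ⟨h1.2.1, hn⟩, fun h => ⟨h1.1, fun hn => hn.2 h⟩⟩
  have hWR : ∀ s ∈ R, (s ∈ W' ↔ L.card ≤ rankIn R s) := fun s hs => by
    rw [hW', ← hfitR s hs]
    have h1 := (hR s).1 hs
    exact ⟨fun h => by_contra fun hn => h.2 ⟨h1.2.1, hn⟩, fun h => ⟨h1.1, fun hn => hn.2 h⟩⟩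
  have hWother : ∀ s ∈ W, X' s ≠ x → s ∈ W' := fun s hs hx => (hW' s).2 ⟨hs, fun h => hx h.1⟩
  have hW'W : ∀ s ∈ W', s ∈ W := fun s hs => ((hW' s).1 hs).1
  have hnotboth : ∀ s ∈ W', ∀ s' ∈ W', s ∈ L → s' ∈ R → False := by
    intro s hs s' hs' hsL hsR
    have h1 := (hWL s hsL).1 hs
    have h2 := (hWR s' hsR).1 hs'
    have h3 := rankIn_lt_card hsR
    omega
  let E := W \ W'
  have hE : ∀ s, s ∈ E ↔ s ∈ W ∧ s ∉ W' := fun s => Finset.mem_sdiff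
  have hEx : ∀ i ∈ E, X' i = x := fun i hi => by
    by_contra hne
    exact ((hE i).1 hi).2 (hWother i ((hE i).1 hi).1 hne)
  have hWE : W \ E = W' := Finset.sdiff_sdiff_eq_self hW'W
  have hcardlt : ∀ (G : Finset ℕ) (n : ℕ), n ≤ G.card →
      (G.filter fun s => rankIn G s < n).card = n := by
    intro G n hn
    have himage : (G.filter fun s => rankIn G s < n).image (rankIn G) = Finset.range n := by
      ext i
      rw [Finset.mem_image, Finset.mem_range]
      constructor
      · rintro ⟨j, hj, rfl⟩
        exact (Finset.mem_filter.1 hj).2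
      · intro hi
        obtain ⟨j, hj, rfl⟩ := exists_rankIn_eq (hi.trans_le hn)
        exact ⟨j, Finset.mem_filter.2 ⟨hj, hi⟩, rfl⟩
    rw [← Finset.card_image_of_injOn ((rankIn_injOn G).mono (Finset.filter_subset _ _)), himage,
      Finset.card_range]
  -- Each wavefront loses `min |L| |R|` waves, and the signs are opposite.
  have hsumE : ∑ i ∈ E, sgn i = 0 := by
    have hEeq : E = (L.filter fun s => ¬ rankIn L s < L.card - R.card) ∪
        R.filter fun s => rankIn R s < L.card := by
      ext s
      rw [hE, Finset.mem_union, Finset.mem_filter, Finset.mem_filter]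
      constructor
      · rintro ⟨h1, h2⟩
        rcases hLR s h1 (hEx s ((hE s).2 ⟨h1, h2⟩)) with h | h
        · rw [hWL s h] at h2
          exact Or.inl ⟨h, by omega⟩
        · rw [hWR s h] at h2
          exact Or.inr ⟨h, by omega⟩
      · rintro (⟨h1, h2⟩ | ⟨h1, h2⟩)
        · exact ⟨((hL s).1 h1).1, by rw [hWL s h1]; omega⟩
        · exact ⟨((hR s).1 h1).1, by rw [hWR s h1]; omega⟩
    have hc1 := Finset.card_filter_add_card_filter_not (s := L) (fun s => rankIn L s < L.card - R.card)
    rw [hcardlt L _ (Nat.sub_le _ _)] at hc1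
    have hc2 : (R.filter fun s => rankIn R s < L.card).card = min L.card R.card := by
      rcases le_total L.card R.card with h | h
      · rw [hcardlt R _ h, min_eq_left h]
      · rw [Finset.filter_true_of_mem fun s hs => (rankIn_lt_card hs).trans_le h, min_eq_right h]
    rw [hEeq, Finset.sum_union (Finset.disjoint_of_subset_left (Finset.filter_subset _ _)
      (Finset.disjoint_of_subset_right (Finset.filter_subset _ _) hdisj)),
      hsumL _ (Finset.filter_subset _ _), hsumR _ (Finset.filter_subset _ _), hc2]
    have : (L.filter fun s => ¬ rankIn L s < L.card - R.card).card = min L.card R.card := by omega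
    rw [this]
    ring
  have hside : ∀ s ∈ W', (∀ i ∈ E, s < i) ∨ ∀ i ∈ E, i < s := by
    intro s hs
    rcases lt_trichotomy (X' s) x with h | h | h
    · exact Or.inl fun i hi => hpc.lt_of_pos_lt (hW'W s hs) ((hE i).1 hi).1 (by rw [hEx i hi]; exact h)
    · rcases hLR s (hW'W s hs) h with h' | h'
      · left
        intro i hi
        rcases hLR i ((hE i).1 hi).1 (hEx i hi) with h'' | h''
        · have h1 := (hWL s h').1 hs
          have h2 := mt (hWL i h'').2 ((hE i).1 hi).2
          exact (rankIn_lt_iff h').1 (by omega)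
        · exact hLltR s h' i h''
      · right
        intro i hi
        rcases hLR i ((hE i).1 hi).1 (hEx i hi) with h'' | h''
        · exact hLltR i h'' s h'
        · have h1 := (hWR s h').1 hs
          have h2 := mt (hWR i h'').2 ((hE i).1 hi).2
          exact (rankIn_lt_iff h'').1 (by omega)
    · exact Or.inr fun i hi => hpc.lt_of_pos_lt ((hE i).1 hi).1 (hW'W s hs) (by rw [hEx i hi]; exact h)
  have hpc' : PreConfig ε sgn r W' X' p' := by
    have := hpc.sdiff (E := E) Finset.sdiff_subset hEx hsumE (by rw [hWE]; exact hside)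
    rwa [hWE] at this
  refine ⟨⟨hpc', fun s hs s' hs' hX => ?_⟩, ?_, ?_⟩
  · by_cases hx : X' s = x
    · rcases hLR s (hW'W s hs) hx with h | h <;>
        rcases hLR s' (hW'W s' hs') (hX.symm.trans hx) with h' | h'
      · rw [hsgnL s h, hsgnL s' h']
      · exact (hnotboth s hs s' hs' h h').elim
      · exact (hnotboth s' hs' s hs h' h).elim
      · rw [hsgnR s h, hsgnR s' h']
    · exact S.conf.sign s (hW'W s hs) s' (hW'W s' hs')
        (S.same_front (hW'W s hs) (hW'W s' hs') hX hx).1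
  · intro s hs i hi hsi hXi hσi hiW
    have hix : X' i = x := hEx i ((hE i).2 ⟨hi, hiW⟩)
    have hsx : X' s = x := by rw [← hix]; simp only [hX', hXi, hσi]
    -- In the right wavefront every wave after a survivor survives, so `s` must belong to the left
    -- one. Then all of `R` is canceled and `s₂` is a witness.
    have hsL : s ∈ L := by
      rcases hLR s (hW'W s hs) hsx with h | h
      · exact h
      · have hiR : i ∈ R := (hR i).2 ⟨hi, hix, hXi.trans ((hR s).1 h).2.2⟩
        have h1 := (hWR s h).1 hs
        exact absurd ((hWR i hiR).2 (h1.trans (rankIn_le hsi))) hiW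
    refine ⟨s₂, hs₂, ?_, fun s₀ hs₀ h => ?_, fun s' hs' h => ?_⟩
    · rw [hsgn12, hsgnL s hsL]
      rcases S.conf.sgn_eq s₁ with h | h <;> rw [hη, h] <;> norm_num
    · rcases hLR s₀ (hW'W s₀ hs₀) (h.trans hsx) with h' | h'
      · exact (hLltR s₀ h' s₂ hs₂R).le
      · exact (hnotboth s hs s₀ hs₀ hsL h').elim
    · refine (hpc.lt_of_pos_lt hs₂ (hW'W s' hs') ?_).le
      have h3 : X' s₂ = x := hx₂
      rw [h3, ← hsx]
      exact h
  · intro s hs i hi hsi hXi hσi hiW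
    have hix : X' i = x := hEx i ((hE i).2 ⟨hi, hiW⟩)
    have hsx : X' s = x := by rw [← hix]; simp only [hX', hXi, hσi]
    have hsR : s ∈ R := by
      rcases hLR s (hW'W s hs) hsx with h | h
      · have hiL : i ∈ L := (hL i).2 ⟨hi, hix, hXi.trans ((hL s).1 h).2.2⟩
        have h1 := (hWL s h).1 hs
        have h2 := rankIn_le (G := L) hsi
        exact absurd ((hWL i hiL).2 (by omega)) hiW
      · exact h
    refine ⟨s₁, hs₁, ?_, fun s₀ hs₀ h => ?_, fun s' hs' h => ?_⟩
    · rw [hsgnR s hsR]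
      rcases S.conf.sgn_eq s₁ with h | h <;> rw [hη, h] <;> norm_num
    · rcases hLR s₀ (hW'W s₀ hs₀) (h.trans hsx) with h' | h'
      · exact (hnotboth s₀ hs₀ s hs h' hsR).elim
      · exact (hLltR s₁ hs₁L s₀ h').le
    · refine (hpc.lt_of_pos_lt (hW'W s' hs') hs₁ ?_).le
      have h3 : X' s₁ = x := hx₁
      rw [h3, ← hsx]
      exact h

end Step

open PreConfig

/-! ### Distances between cells. -/

namespace Config

variable {ε : ℝ} {sgn r : ℕ → ℤ} {W : Finset ℕ} {X : ℕ → ℝ} {p : ℝ → ℝ}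

theorem abs_waveCell_sub_le (c : Config ε sgn r W X p) {s s' : ℕ} (hs : s ∈ W) (hs' : s' ∈ W)
    (hX : X s' = X s) :
    |waveCell sgn r s - waveCell sgn r s'| ≤ (groupAt W X (X s)).card := by
  have hm : s ∈ groupAt W X (X s) := mem_groupAt.2 ⟨hs, rfl⟩
  have hm' : s' ∈ groupAt W X (X s) := mem_groupAt.2 ⟨hs', hX⟩
  rw [c.waveCell_eq hs, c.waveCell_eq hs', c.sgn_congr hs hm', hX, abs_le]
  have h1 := rankIn_lt_card hm
  have h2 := rankIn_lt_card hm'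
  unfold cellAt
  split_ifs <;> constructor <;> omega

/-- Without a change of sign between `s` and `s'` the right states of the living waves are monotone
in the index, also across different positions. -/
theorem abs_waveCell_add (c : Config ε sgn r W X p) {s m s' : ℕ} (hs : s ∈ W) (hm : m ∈ W)
    (hs' : s' ∈ W) (h1 : s ≤ m) (h2 : m ≤ s')
    (hsgn : ∀ i ∈ W, s ≤ i → i ≤ s' → sgn i = sgn s) :
    |waveCell sgn r s - waveCell sgn r s'| =
      |waveCell sgn r s - waveCell sgn r m| + |waveCell sgn r m - waveCell sgn r s'| := by
  have hdiff : ∀ a ∈ W, ∀ b ∈ W, a ≤ b → s ≤ a → b ≤ s' →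
      ∃ n : ℕ, r b - r a = sgn s * n := by
    intro a ha b hb hab hsa hbs
    refine ⟨(W.filter fun i => i ≤ b ∧ ¬ i ≤ a).card, ?_⟩
    have hsplit : W.filter (· ≤ b) = W.filter (· ≤ a) ∪ W.filter fun i => i ≤ b ∧ ¬ i ≤ a := by
      ext i
      simp only [Finset.mem_union, Finset.mem_filter]
      constructor
      · rintro ⟨h, h'⟩
        by_cases hia : i ≤ a
        · exact Or.inl ⟨h, hia⟩
        · exact Or.inr ⟨h, h', hia⟩
      · rintro (⟨h, h'⟩ | ⟨h, h', -⟩)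
        · exact ⟨h, h'.trans hab⟩
        · exact ⟨h, h'⟩
    rw [c.right_state b hb, c.right_state a ha, hsplit, Finset.sum_union, add_sub_cancel_left,
      Finset.sum_congr rfl fun i hi => hsgn i (Finset.mem_filter.1 hi).1
        (hsa.trans (not_le.1 (Finset.mem_filter.1 hi).2.2).le)
        ((Finset.mem_filter.1 hi).2.1.trans hbs), Finset.sum_const, nsmul_eq_mul, mul_comm]
    rw [Finset.disjoint_filter]
    exact fun i _ h h' => h'.2 h
  obtain ⟨n₁, hn₁⟩ := hdiff s hs m hm h1 le_rfl h2
  obtain ⟨n₂, hn₂⟩ := hdiff m hm s' hs' h2 h1 le_rfl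
  unfold waveCell
  rw [hsgn m hm h1 h2, hsgn s' hs' (h1.trans h2) le_rfl]
  rcases c.sgn_eq s with h | h <;> rw [h] at hn₁ hn₂ ⊢
  · simp only [if_true]
    rw [abs_of_nonpos (by omega), abs_of_nonpos (by omega), abs_of_nonpos (by omega)]
    omega
  · simp only [show (-1 : ℤ) ≠ 1 by norm_num, if_false]
    rw [abs_of_nonneg (by omega), abs_of_nonneg (by omega), abs_of_nonneg (by omega)]
    omega

end Config

/-! ### Speeds before and after a collision. -/

namespace Step

variable {f : ℝ × ℝ → ℝ} {ε : ℝ} {q p : ℝ → ℝ} {τ x : ℝ} {sgn r : ℕ → ℤ} {W : Finset ℕ}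
  {X σ : ℕ → ℝ}

theorem _root_.WavefrontTracking.Config.tail_le_cellSlope (hε : 0 < ε) (c : Config ε sgn r W X p)
    (hσ : ∀ s, σ s = Config.speed ε sgn r X p (fun w => f (w, q (X s))) s) {y b : ℝ} {A : Finset ℕ}
    (hA : ∀ s ∈ A, s ∈ W ∧ X s = y ∧ σ s ≤ b)
    (hA' : ∀ s ∈ A, ∀ i ∈ W, X i = y → s ≤ i → σ i ≤ b → i ∈ A) :
    ∑ s ∈ A, cellSlope ε (fun w => f (w, q y)) (waveCell sgn r s) ≤ ∑ s ∈ A, σ s := by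
  have hσ' : ∀ i, X i = y → Config.speed ε sgn r X p (fun w => f (w, q y)) i = σ i :=
    fun i h => by rw [hσ i, h]
  rw [← Finset.sum_congr rfl fun s hs => hσ' s (hA s hs).2.1]
  refine c.tail_le hε _ (y := y) (b := b) (fun s hs => ?_) fun s hs i hi hX hsi hle => ?_
  · rw [hσ' s (hA s hs).2.1]
    exact hA s hs
  · rw [hσ' i hX] at hle
    exact hA' s hs i hi hX hsi hle

theorem _root_.WavefrontTracking.Config.head_le_cellSlope (hε : 0 < ε) (c : Config ε sgn r W X p)
    (hσ : ∀ s, σ s = Config.speed ε sgn r X p (fun w => f (w, q (X s))) s) {y b : ℝ} {A : Finset ℕ}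
    (hA : ∀ s ∈ A, s ∈ W ∧ X s = y ∧ b ≤ σ s)
    (hA' : ∀ s ∈ A, ∀ i ∈ W, X i = y → i ≤ s → b ≤ σ i → i ∈ A) :
    ∑ s ∈ A, σ s ≤ ∑ s ∈ A, cellSlope ε (fun w => f (w, q y)) (waveCell sgn r s) := by
  have hσ' : ∀ i, X i = y → Config.speed ε sgn r X p (fun w => f (w, q y)) i = σ i :=
    fun i h => by rw [hσ i, h]
  rw [← Finset.sum_congr rfl fun s hs => hσ' s (hA s hs).2.1]
  refine c.head_le hε _ (y := y) (b := b) (fun s hs => ?_) fun s hs i hi hX hsi hle => ?_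
  · rw [hσ' s (hA s hs).2.1]
    exact hA s hs
  · rw [hσ' i hX] at hle
    exact hA' s hs i hi hX hsi hle

theorem front_head_le (S : Step f ε q p τ x sgn r W X σ) {y b : ℝ} {B : Finset ℕ}
    (hB : ∀ s ∈ B, s ∈ W ∧ X s = y ∧ σ s = b)
    (hB' : ∀ s ∈ B, ∀ i ∈ W, X i = y → σ i = b → i ≤ s → i ∈ B) :
    B.card * b ≤ ∑ s ∈ B, cellSlope ε (fun w => f (w, q y)) (waveCell sgn r s) := by
  refine le_trans (le_of_eq ?_) (S.conf.head_le_cellSlope S.eps_pos S.speed_eq (b := b) (fun s hs => ⟨(hB s hs).1, (hB s hs).2.1,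
    (hB s hs).2.2.ge⟩) fun s hs i hi hX hsi hle => hB' s hs i hi hX (le_antisymm ?_ hle) hsi)
  · rw [Finset.sum_congr rfl fun s hs => (hB s hs).2.2]
    simp
  · rw [← (hB s hs).2.2]
    exact S.speed_mono hi (hB s hs).1 (hX.trans (hB s hs).2.1.symm) hsi

theorem front_eq (S : Step f ε q p τ x sgn r W X σ) {y b : ℝ} {B : Finset ℕ}
    (hB : ∀ s, s ∈ B ↔ s ∈ W ∧ X s = y ∧ σ s = b) :
    B.card * b = ∑ s ∈ B, cellSlope ε (fun w => f (w, q y)) (waveCell sgn r s) := by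
  refine le_antisymm (S.front_head_le (fun s hs => (hB s).1 hs)
    fun s _ i hi hX hσ _ => (hB i).2 ⟨hi, hX, hσ⟩) ?_
  refine (S.conf.tail_le_cellSlope S.eps_pos S.speed_eq (b := b) (fun s hs => ⟨((hB s).1 hs).1, ((hB s).1 hs).2.1,
    ((hB s).1 hs).2.2.le⟩) fun s hs i hi hX hsi hle => (hB i).2 ⟨hi, hX, le_antisymm hle ?_⟩).trans
      (le_of_eq ?_)
  · rw [← ((hB s).1 hs).2.2]
    exact S.speed_mono ((hB s).1 hs).1 hi (((hB s).1 hs).2.1.trans hX.symm) hsi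
  · rw [Finset.sum_congr rfl fun s hs => ((hB s).1 hs).2.2]
    simp

/-- The speed is the average of the slopes on the cells of the wavefront. -/
theorem neg_one_lt_speed (S : Step f ε q p τ x sgn r W X σ)
    (hφ : ∀ s ∈ W, ∀ y, -1 < cellSlope ε (fun w => f (w, q y)) (waveCell sgn r s)) {s : ℕ}
    (hs : s ∈ W) : -1 < σ s := by
  classical
  let B := W.filter fun i => X i = X s ∧ σ i = σ s
  have hB : ∀ i, i ∈ B ↔ i ∈ W ∧ X i = X s ∧ σ i = σ s := fun i => Finset.mem_filter
  have heq := S.front_eq hB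
  have hne : B.Nonempty := ⟨s, (hB s).2 ⟨hs, rfl, rfl⟩⟩
  have hlt : ∑ i ∈ B, (-1 : ℝ) < ∑ i ∈ B, cellSlope ε (fun w => f (w, q (X s))) (waveCell sgn r i) :=
    Finset.sum_lt_sum_of_nonempty hne fun i hi => hφ i ((hB i).1 hi).1 _
  rw [← heq, Finset.sum_const, nsmul_eq_mul] at hlt
  exact lt_of_mul_lt_mul_left hlt (Nat.cast_nonneg _)

/-- Without wavefronts of the first family at the collision point, no wave meets one. -/
theorem flux_parameter_eq (S : Step f ε q p τ x sgn r W X σ) {v : ℝ → ℝ} {D : Finset ℝ}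
    (hv : IsStep D v) {t₀ : ℝ} (hq : ∀ y, q y = v (y + t₀))
    (hsecond : ∀ F ∈ arriving f ε q p τ x, F.family = Family.second) {s : ℕ} (hs : s ∈ W)
    (hσ : -1 < σ s) : v (X s + σ s * τ + (t₀ + τ)) = q (X s) := by
  by_contra hne
  have hτ := S.time_pos
  rw [hq] at hne
  -- The label of the wave increases; if the flux parameter changes, the label passes a jump `d` of
  -- `v`.
  obtain ⟨d, hd, hjump⟩ := hv.exists_jump (x := X s + t₀) (y := X s + σ s * τ + (t₀ + τ))
    (by nlinarith) (Ne.symm hne)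
  have hqjump : d - t₀ ∈ jumpSet q := by
    obtain ⟨z, hz, hz'⟩ := exists_lt_forall_notMem_Ico D d
    have h1 : Function.leftLim v d = v z :=
      hv.leftLim_eq hz fun e he he' => hz' e he ⟨he'.1.le, he'.2⟩
    have h2 : Function.leftLim q (d - t₀) = v z := by
      refine leftLim_of_const (x := z - t₀) (by linarith) fun u hu => ?_
      rw [hq]
      refine (hv.eq_of_le (by linarith [hu.1]) fun e he he' => hz' e he ⟨he'.1.le, ?_⟩).symm
      linarith [he'.2, hu.2]
    have h3 : q (d - t₀) = v d := by rw [hq]; ring_nf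
    show Function.leftLim q (d - t₀) ≠ q (d - t₀)
    rw [h2, h3, ← h1]
    exact hjump
  have hpos : 0 < σ s + 1 := by linarith
  -- The time at which the wave meets the wavefront of the first family leaving `d - t₀`. As `τ` is
  -- the first collision time, this meeting takes place at `τ`, hence at `x`.
  set τ' := (d - t₀ - X s) / (σ s + 1) with hτ'
  have hτ'pos : 0 < τ' := div_pos (by linarith [hd.1]) hpos
  have hτ'le : τ' ≤ τ := by
    rw [hτ', div_le_iff₀ hpos]
    linarith [hd.2]
  have hmul : τ' * (σ s + 1) = d - t₀ - X s := by rw [hτ']; field_simp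
  have hmem : (⟨Family.first, d - t₀, -1⟩ : Front) ∈ arriving f ε q p τ' (X s + σ s * τ') :=
    ⟨⟨hqjump, rfl⟩, by simp only; linarith⟩
  have hcol : IsCollision f ε q p τ' (X s + σ s * τ') :=
    ⟨hτ'pos, _, S.mem_arriving hs τ', _, hmem, fun h => by
      rw [Front.mk.injEq] at h
      exact absurd h.1 (by simp)⟩
  have heq : τ' = τ := le_antisymm hτ'le (S.least _ _ hcol)
  rw [heq] at hcol hmem
  rw [S.unique _ hcol] at hmem
  have := hsecond _ hmem
  simp at this

/-- The waves of two wavefronts of the same sign which meet get the average speed, the others do not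
change their speeds. -/
theorem interaction (S : Step f ε q p τ x sgn r W X σ) {q' : ℝ → ℝ} {σ' : ℕ → ℝ}
    (hc' : Config ε sgn r W (fun s => X s + σ s * τ) (glue f ε q p τ))
    (hσ' : ∀ s, σ' s = Config.speed ε sgn r (fun s => X s + σ s * τ) (glue f ε q p τ)
      (fun w => f (w, q' (X s + σ s * τ))) s)
    (hflux : ∀ s ∈ W, q' (X s + σ s * τ) = q (X s)) {s₁ s₂ : ℕ} (hs₁ : s₁ ∈ W) (hs₂ : s₂ ∈ W)
    (hlt : X s₁ < X s₂) (hx₁ : X s₁ + σ s₁ * τ = x) (hx₂ : X s₂ + σ s₂ * τ = x)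
    (hw : ∀ s ∈ W, X s + σ s * τ = x →
      (X s = X s₁ ∧ σ s = σ s₁) ∨ (X s = X s₂ ∧ σ s = σ s₂))
    {L R : Finset ℕ} (hL : ∀ s, s ∈ L ↔ s ∈ W ∧ X s = X s₁ ∧ σ s = σ s₁)
    (hR : ∀ s, s ∈ R ↔ s ∈ W ∧ X s = X s₂ ∧ σ s = σ s₂) :
    (L.card + R.card) * ∑ s ∈ W, |σ' s - σ s| =
      2 * ∑ s ∈ L, ∑ s' ∈ R, (cellSlope ε (fun w => f (w, q' x)) (waveCell sgn r s) -
        cellSlope ε (fun w => f (w, q' x)) (waveCell sgn r s')) ∧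
    ∀ s ∈ L, ∀ s' ∈ R, |waveCell sgn r s - waveCell sgn r s'| ≤ L.card + R.card := by
  classical
  set X' : ℕ → ℝ := fun s => X s + σ s * τ with hX'
  have hτ := S.time_pos
  have hε := S.eps_pos
  have hq1 : q' x = q (X s₁) := by rw [← hflux s₁ hs₁, hx₁]
  have hq2 : q' x = q (X s₂) := by rw [← hflux s₂ hs₂, hx₂]
  have hLx : ∀ s ∈ L, X' s = x := fun s hs => by
    simp only [hX']; rw [((hL s).1 hs).2.1, ((hL s).1 hs).2.2, hx₁]
  have hRx : ∀ s ∈ R, X' s = x := fun s hs => by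
    simp only [hX']; rw [((hR s).1 hs).2.1, ((hR s).1 hs).2.2, hx₂]
  have hLltR : ∀ s ∈ L, ∀ s' ∈ R, s < s' := fun s hs s' hs' =>
    S.conf.lt_of_pos_lt ((hL s).1 hs).1 ((hR s').1 hs').1
      (by rw [((hL s).1 hs).2.1, ((hR s').1 hs').2.1]; exact hlt)
  have hdisj : Disjoint L R := Finset.disjoint_left.2 fun s h1 h2 => absurd (hLltR s h1 s h2) (by simp)
  have hgroup : groupAt W X' x = L ∪ R := by
    ext s
    rw [mem_groupAt, Finset.mem_union]
    constructor
    · rintro ⟨h1, h2⟩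
      rcases hw s h1 h2 with h | h
      · exact Or.inl ((hL s).2 ⟨h1, h⟩)
      · exact Or.inr ((hR s).2 ⟨h1, h⟩)
    · rintro (h | h)
      · exact ⟨((hL s).1 h).1, hLx s h⟩
      · exact ⟨((hR s).1 h).1, hRx s h⟩
  have hcard : (groupAt W X' x).card = L.card + R.card := by
    rw [hgroup, Finset.card_union_of_disjoint hdisj]
  have hL1 : (0 : ℝ) < L.card := by
    exact_mod_cast Finset.card_pos.2 ⟨s₁, (hL s₁).2 ⟨hs₁, rfl, rfl⟩⟩
  have hR1 : (0 : ℝ) < R.card := by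
    exact_mod_cast Finset.card_pos.2 ⟨s₂, (hR s₂).2 ⟨hs₂, rfl, rfl⟩⟩
  set l := σ s₁ with hl
  set ρ := σ s₂ with hρ
  -- The left wavefront catches up with the right one.
  have hlρ : ρ ≤ l := by
    have : (l - ρ) * τ = X s₂ - X s₁ := by linarith
    by_contra hlt'
    nlinarith
  set φ : ℕ → ℝ := fun s => cellSlope ε (fun w => f (w, q' x)) (waveCell sgn r s) with hφ
  have hsumL : L.card * l = ∑ s ∈ L, φ s := by
    have := S.front_eq hL
    rwa [← hq1] at this
  have hsumR : R.card * ρ = ∑ s ∈ R, φ s := by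
    have := S.front_eq hR
    rwa [← hq2] at this
  set n : ℝ := L.card + R.card with hn
  have hn0 : 0 < n := by positivity
  set b := (L.card * l + R.card * ρ) / n with hb
  have hnb : n * b = L.card * l + R.card * ρ := by rw [hb]; field_simp
  have hbl : b ≤ l := by
    rw [hb, div_le_iff₀ hn0, hn]
    nlinarith
  have hbρ : ρ ≤ b := by
    rw [hb, le_div_iff₀ hn0, hn]
    nlinarith
  have hnew : ∀ s ∈ W, X' s = x → σ' s = b := by
    intro s hs hsx
    have hsx' : X s + σ s * τ = x := hsx
    rw [hσ' s, hsx']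
    refine hc'.speed_eq_const hε _ hs ?_ ?_
    · intro B hB hB'
      change B ⊆ groupAt W X' (X' s) at hB
      change ∀ i ∈ B, ∀ i' ∈ groupAt W X' (X' s), i' ≤ i → i' ∈ B at hB'
      rw [hsx, hgroup] at hB hB'
      have hBsplit : B = B ∩ L ∪ B ∩ R := by
        rw [← Finset.inter_union_distrib_left, Finset.inter_eq_left.2 hB]
      have hBdisj : Disjoint (B ∩ L) (B ∩ R) :=
        Finset.disjoint_of_subset_left Finset.inter_subset_right
          (Finset.disjoint_of_subset_right Finset.inter_subset_right hdisj)
      have h1 : (B ∩ L).card * l ≤ ∑ i ∈ B ∩ L, φ i := by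
        have := S.front_head_le (y := X s₁) (b := l) (B := B ∩ L)
          (fun i hi => (hL i).1 (Finset.mem_inter.1 hi).2) fun i hi i' hi' hX hσ hle => by
            have : i' ∈ L := (hL i').2 ⟨hi', hX, hσ⟩
            exact Finset.mem_inter.2 ⟨hB' i (Finset.mem_inter.1 hi).1 i'
              (Finset.mem_union_left _ this) hle, this⟩
        rwa [← hq1] at this
      have h2 : (B ∩ R).card * ρ ≤ ∑ i ∈ B ∩ R, φ i := by
        have := S.front_head_le (y := X s₂) (b := ρ) (B := B ∩ R)
          (fun i hi => (hR i).1 (Finset.mem_inter.1 hi).2) fun i hi i' hi' hX hσ hle => by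
            have : i' ∈ R := (hR i').2 ⟨hi', hX, hσ⟩
            exact Finset.mem_inter.2 ⟨hB' i (Finset.mem_inter.1 hi).1 i'
              (Finset.mem_union_right _ this) hle, this⟩
        rwa [← hq2] at this
      have hcardB : (B.card : ℝ) = (B ∩ L).card + (B ∩ R).card := by
        rw [← Nat.cast_add, ← Finset.card_union_of_disjoint hBdisj, ← hBsplit]
      have hsumB : ∑ i ∈ B, φ i = ∑ i ∈ B ∩ L, φ i + ∑ i ∈ B ∩ R, φ i := by
        rw [← Finset.sum_union hBdisj, ← hBsplit]
      change B.card * b ≤ ∑ i ∈ B, φ i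
      rw [hsumB, hcardB]
      -- An initial part of the merged group either lies in `L`, where `b ≤ l` suffices, or contains
      -- all of `L`. In the second case `B ∩ R` has at most `|R|` waves; as `ρ ≤ b`, they lose no
      -- more than the `|L| (l - b) = |R| (b - ρ)` gained on `L`.
      rcases (B ∩ R).eq_empty_or_nonempty with he | ⟨i, hi⟩
      · rw [he] at h2 ⊢
        have : ((B ∩ L).card : ℝ) * b ≤ (B ∩ L).card * l :=
          mul_le_mul_of_nonneg_left hbl (Nat.cast_nonneg _)
        simp only [Finset.card_empty, Nat.cast_zero, add_zero, Finset.sum_empty]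
        linarith
      · have hLB : B ∩ L = L := Finset.inter_eq_right.2 fun i' hi' =>
          hB' i (Finset.mem_inter.1 hi).1 i' (Finset.mem_union_left _ hi')
            (hLltR i' hi' i (Finset.mem_inter.1 hi).2).le
        rw [hLB] at h1 ⊢
        have hle : ((B ∩ R).card : ℝ) ≤ R.card := by
          exact_mod_cast Finset.card_le_card Finset.inter_subset_right
        nlinarith
    · change (groupAt W X' (X' s)).card * b = ∑ i ∈ groupAt W X' (X' s), φ i
      rw [hsx, hcard, hgroup, Finset.sum_union hdisj, ← hsumL, ← hsumR, Nat.cast_add]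
      exact hnb
  -- Away from `x` a new group is one old wavefront with the same flux parameter.
  have hold : ∀ s ∈ W, X' s ≠ x → σ' s = σ s := by
    intro s hs hsx
    have hg : ∀ i, i ∈ groupAt W X' (X' s) ↔ i ∈ W ∧ X i = X s ∧ σ i = σ s := by
      intro i
      rw [mem_groupAt]
      constructor
      · rintro ⟨h1, h2⟩
        exact ⟨h1, S.same_front h1 hs h2 (fun h => hsx (h2.symm.trans h))⟩
      · rintro ⟨h1, h2, h3⟩
        refine ⟨h1, ?_⟩
        simp only [hX']
        rw [h2, h3]
    rw [hσ' s, hflux s hs]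
    refine hc'.speed_eq_const hε _ hs ?_ ?_
    · intro B hB hB'
      change B ⊆ groupAt W X' (X' s) at hB
      change ∀ i ∈ B, ∀ i' ∈ groupAt W X' (X' s), i' ≤ i → i' ∈ B at hB'
      exact S.front_head_le (fun i hi => (hg i).1 (hB hi)) fun i hi i' hi' hX hσ hle =>
        hB' i hi i' ((hg i').2 ⟨hi', hX, hσ⟩) hle
    · exact S.front_eq hg
  constructor
  · have hW : ∑ s ∈ W, |σ' s - σ s| = ∑ s ∈ groupAt W X' x, |σ' s - σ s| := by
      refine (Finset.sum_subset (fun s hs => (mem_groupAt.1 hs).1) fun s hs hs' => ?_).symm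
      rw [hold s hs fun h => hs' (mem_groupAt.2 ⟨hs, h⟩)]
      simp
    have e1 : ∑ s ∈ L, |σ' s - σ s| = L.card * (l - b) := by
      rw [Finset.sum_congr rfl (g := fun _ => l - b), Finset.sum_const, nsmul_eq_mul]
      intro s hs
      rw [hnew s ((hL s).1 hs).1 (hLx s hs), ((hL s).1 hs).2.2, abs_of_nonpos (by linarith)]
      ring
    have e2 : ∑ s ∈ R, |σ' s - σ s| = R.card * (b - ρ) := by
      rw [Finset.sum_congr rfl (g := fun _ => b - ρ), Finset.sum_const, nsmul_eq_mul]
      intro s hs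
      rw [hnew s ((hR s).1 hs).1 (hRx s hs), ((hR s).1 hs).2.2, abs_of_nonneg (by linarith)]
    -- The double sum is `|L| |R| (l - ρ)`. The changes of speed add up to `|L| (l - b) + |R| (b -
    -- ρ)`, which is twice that number over `n`.
    have e3 : ∑ s ∈ L, ∑ s' ∈ R, (φ s - φ s') = R.card * (L.card * l) - L.card * (R.card * ρ) := by
      simp only [Finset.sum_sub_distrib, Finset.sum_const, nsmul_eq_mul, hsumL, hsumR,
        Finset.mul_sum]
    change n * ∑ s ∈ W, |σ' s - σ s| = 2 * ∑ s ∈ L, ∑ s' ∈ R, (φ s - φ s')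
    rw [hW, hgroup, Finset.sum_union hdisj, e1, e2, e3]
    linear_combination ((R.card : ℝ) - L.card) * hnb + (L.card * l - R.card * ρ) * hn
  · intro s hs s' hs'
    have := hc'.abs_waveCell_sub_le ((hL s).1 hs).1 ((hR s').1 hs').1
      (show X' s' = X' s by rw [hLx s hs, hRx s' hs'])
    change _ ≤ ((groupAt W X' (X' s)).card : ℤ) at this
    rw [hLx s hs, hcard] at this
    exact_mod_cast this

end Step

/-! ### The waves of the wavefront solution -/

/-- The right state of a wave in units of `ε`. -/
noncomputable def intState (ε : ℝ) (w₀ : ℝ → ℝ) (s : ℕ) : ℤ :=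
  ∑ i ∈ Finset.Icc 1 s, intSign ε w₀ i

/-- The position of the wave `s` at the time `t j`, without regard to cancellations. -/
noncomputable def trackPos (f : ℝ × ℝ → ℝ) (ε : ℝ) (w₀ v₀ : ℝ → ℝ) (t : ℕ → ℝ) : ℕ → ℕ → ℝ
  | 0, s => initPos ε w₀ s
  | j + 1, s => trackPos f ε w₀ v₀ t j s +
      Config.speed ε (intSign ε w₀) (intState ε w₀) (trackPos f ε w₀ v₀ t j) (wAt f ε w₀ v₀ t j)
        (fun w => f (w, vAt v₀ t j (trackPos f ε w₀ v₀ t j s))) s * (t (j + 1) - t j)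

/-- The speed of the wave `s` at the time `t j`. -/
noncomputable def trackSpeed (f : ℝ × ℝ → ℝ) (ε : ℝ) (w₀ v₀ : ℝ → ℝ) (t : ℕ → ℝ) (j s : ℕ) : ℝ :=
  Config.speed ε (intSign ε w₀) (intState ε w₀) (trackPos f ε w₀ v₀ t j) (wAt f ε w₀ v₀ t j)
    (fun w => f (w, vAt v₀ t j (trackPos f ε w₀ v₀ t j s))) s

variable {f : ℝ × ℝ → ℝ} {ε : ℝ} {w₀ v₀ : ℝ → ℝ} {A B : Set ℝ} {J : ℕ} {t x : ℕ → ℝ}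

theorem trackPos_succ (j : ℕ) : trackPos f ε w₀ v₀ t (j + 1) = fun s =>
    trackPos f ε w₀ v₀ t j s + trackSpeed f ε w₀ v₀ t j s * (t (j + 1) - t j) := rfl

theorem Config.initial (hε : 0 < ε) (hw : GridData ε w₀) (hA : A.OrdConnected)
    (hwA : ∀ x, w₀ x ∈ A) :
    Config ε (intSign ε w₀) (intState ε w₀) (waves ε w₀) (initPos ε w₀) w₀ := by
  obtain ⟨-, hW, hwave, hprof⟩ := initial_waves hε hw hA hwA
  refine ⟨⟨intSign_eq ε w₀, fun s hs s' hs' h => initPos_mono hε (hwave s hs) (hwave s' hs') h, ?_,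
    fun s hs => ?_⟩, fun s _ s' _ h => intSign_eq_of_initPos_eq h⟩
  · intro x
    rw [hprof x]
  · refine Finset.sum_congr ?_ fun _ _ => rfl
    rw [hW] at hs ⊢
    ext i
    simp only [Finset.mem_Icc, Finset.mem_filter] at hs ⊢
    omega

/-- One side chooses the envelope by the sign of the wave, the other by the order of the two states.
They agree because a jump has the sign of the waves at it. -/
theorem speedAt_eq (hε : 0 < ε) {W : Finset ℕ} {X : ℕ → ℝ} {j s : ℕ}
    (c : Config ε (intSign ε w₀) (intState ε w₀) W X (wAt f ε w₀ v₀ t j)) (hs : s ∈ W)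
    (hi : InitialWave ε w₀ A s) :
    speedAt f ε w₀ v₀ t j s (X s) = Config.speed ε (intSign ε w₀) (intState ε w₀) X
      (wAt f ε w₀ v₀ t j) (fun w => f (w, vAt v₀ t j (X s))) s := by
  have hjump := c.sign_jump hε hs
  unfold speedAt Config.speed cellSpeed waveCell
  rw [hi.sign_eq, hi.rightState_eq, ← intState]
  set a := Function.leftLim (wAt f ε w₀ v₀ t j) (X s)
  set b := wAt f ε w₀ v₀ t j (X s)
  rcases intSign_eq ε w₀ s with h | h
  · have hab : a ≤ b := by
      by_contra hlt
      rw [Real.sign_of_neg (by linarith), h] at hjump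
      norm_num at hjump
    rw [h, if_pos (by norm_num), if_pos hab, if_pos rfl]
    congr 1
    push_cast
    ring
  · have hab : ¬ a ≤ b := by
      intro hle
      rcases hle.eq_or_lt with heq | hlt
      · rw [heq, sub_self, Real.sign_zero, h] at hjump
        norm_num at hjump
      · rw [Real.sign_of_pos (by linarith), h] at hjump
        norm_num at hjump
    rw [h, if_neg (by norm_num), if_neg hab, if_neg (by norm_num)]
    congr 1
    ring

theorem survives_iff_fits {j s : ℕ} (hi : InitialWave ε w₀ A s) :
    Survives f ε w₀ v₀ t x j s ↔
      Fits ε (wAt f ε w₀ v₀ t j) (x j) (intSign ε w₀ s) (intState ε w₀ s) := by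
  unfold Survives Fits
  rw [hi.sign_eq, hi.rightState_eq, intState]

theorem mem_realWaves {j s : ℕ} :
    s ∈ realWaves f ε w₀ v₀ t x j ↔ s ∈ waves ε w₀ ∧ wavePos f ε w₀ v₀ t x j s ≠ ⊤ := by
  simp [realWaves]

theorem realWaves_subset (j : ℕ) : realWaves f ε w₀ v₀ t x j ⊆ waves ε w₀ :=
  fun _ hs => (mem_realWaves.1 hs).1

open Classical in
theorem wavePos_succ_of_coe {j s : ℕ} {y : ℝ} (h : wavePos f ε w₀ v₀ t x j s = y) :
    wavePos f ε w₀ v₀ t x (j + 1) s =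
      if y + speedAt f ε w₀ v₀ t j s y * (t (j + 1) - t j) = x (j + 1) ∧
          ¬ Survives f ε w₀ v₀ t x (j + 1) s
      then ⊤
      else ((y + speedAt f ε w₀ v₀ t j s y * (t (j + 1) - t j) : ℝ) : WithTop ℝ) := by
  rw [wavePos, h]

theorem wavePos_succ_of_top {j s : ℕ} (h : wavePos f ε w₀ v₀ t x j s = ⊤) :
    wavePos f ε w₀ v₀ t x (j + 1) s = ⊤ := by
  rw [wavePos, h]

/-- At the time `t j` the profile of `w` is the superposition of the waves which are alive, and
the positions of these are given by `trackPos`. -/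
structure Tracked (f : ℝ × ℝ → ℝ) (ε : ℝ) (w₀ v₀ : ℝ → ℝ) (t x : ℕ → ℝ) (j : ℕ) : Prop where
  conf : Config ε (intSign ε w₀) (intState ε w₀) (realWaves f ε w₀ v₀ t x j)
    (trackPos f ε w₀ v₀ t j) (wAt f ε w₀ v₀ t j)
  wavePos_eq : ∀ s ∈ realWaves f ε w₀ v₀ t x j,
    wavePos f ε w₀ v₀ t x j s = (trackPos f ε w₀ v₀ t j s : WithTop ℝ)

namespace Tracked

variable {j : ℕ}

theorem zero (hε : 0 < ε) (hw : GridData ε w₀) (hA : A.OrdConnected) (hwA : ∀ x, w₀ x ∈ A) :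
    Tracked f ε w₀ v₀ t x 0 where
  conf := by
    have : realWaves f ε w₀ v₀ t x 0 = waves ε w₀ := by
      ext s
      simp [mem_realWaves, wavePos]
    rw [this]
    exact Config.initial hε hw hA hwA
  wavePos_eq := fun _ _ => rfl

theorem step (T : Tracked f ε w₀ v₀ t x j) (hε : 0 < ε) (hj : j < J)
    (hcol : IsCollisionSequence f ε w₀ v₀ J t x) :
    Step f ε (vAt v₀ t j) (wAt f ε w₀ v₀ t j) (t (j + 1) - t j) (x (j + 1)) (intSign ε w₀)
      (intState ε w₀) (realWaves f ε w₀ v₀ t x j) (trackPos f ε w₀ v₀ t j)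
      (trackSpeed f ε w₀ v₀ t j) where
  conf := T.conf
  eps_pos := hε
  speed_eq := fun _ => rfl
  time_pos := by
    obtain ⟨y, hy⟩ := (hcol.next j hj).1
    exact hy.1
  least := fun τ' y h => by
    have : t (j + 1) ≤ τ' + t j := (hcol.next j hj).2 ⟨y, by rwa [add_sub_cancel_right]⟩
    linarith
  unique := hcol.unique j hj
  binary := hcol.binary j hj

theorem speedAt_eq (T : Tracked f ε w₀ v₀ t x j) (hε : 0 < ε) {s : ℕ}
    (hs : s ∈ realWaves f ε w₀ v₀ t x j) (hi : InitialWave ε w₀ A s) :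
    speedAt f ε w₀ v₀ t j s (trackPos f ε w₀ v₀ t j s) = trackSpeed f ε w₀ v₀ t j s :=
  WavefrontTracking.speedAt_eq hε T.conf hs hi

theorem waveSpeed_eq (T : Tracked f ε w₀ v₀ t x j) (hε : 0 < ε) {s : ℕ}
    (hs : s ∈ realWaves f ε w₀ v₀ t x j) (hi : InitialWave ε w₀ A s) :
    waveSpeed f ε w₀ v₀ t x j s = trackSpeed f ε w₀ v₀ t j s := by
  rw [waveSpeed, T.wavePos_eq s hs]
  exact T.speedAt_eq hε hs hi

theorem mem_realWaves_succ (T : Tracked f ε w₀ v₀ t x j) (hε : 0 < ε)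
    (hwave : ∀ s ∈ waves ε w₀, InitialWave ε w₀ A s) (s : ℕ) :
    s ∈ realWaves f ε w₀ v₀ t x (j + 1) ↔ s ∈ realWaves f ε w₀ v₀ t x j ∧
      ¬ (trackPos f ε w₀ v₀ t j s + trackSpeed f ε w₀ v₀ t j s * (t (j + 1) - t j) = x (j + 1) ∧
        ¬ Fits ε (glue f ε (vAt v₀ t j) (wAt f ε w₀ v₀ t j) (t (j + 1) - t j)) (x (j + 1))
          (intSign ε w₀ s) (intState ε w₀ s)) := by
  classical
  by_cases hs : s ∈ realWaves f ε w₀ v₀ t x j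
  · have hsw := realWaves_subset j hs
    have hfit := survives_iff_fits (f := f) (v₀ := v₀) (t := t) (x := x) (j := j + 1) (hwave s hsw)
    rw [mem_realWaves, wavePos_succ_of_coe (T.wavePos_eq s hs), T.speedAt_eq hε hs (hwave s hsw),
      hfit]
    simp only [hsw, hs, true_and]
    rw [wAt]
    split_ifs with h
    · simp [h]
    · exact ⟨fun _ => h, fun _ => WithTop.coe_ne_top⟩
  · simp only [hs, false_and, iff_false]
    rw [mem_realWaves] at hs ⊢
    rintro ⟨h1, h2⟩
    exact hs ⟨h1, fun h => h2 (wavePos_succ_of_top h)⟩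

theorem succ (T : Tracked f ε w₀ v₀ t x j) (hε : 0 < ε) (hj : j < J)
    (hcol : IsCollisionSequence f ε w₀ v₀ J t x)
    (hwave : ∀ s ∈ waves ε w₀, InitialWave ε w₀ A s) : Tracked f ε w₀ v₀ t x (j + 1) where
  conf := ((T.step hε hj hcol).next_config (T.mem_realWaves_succ hε hwave)).1
  wavePos_eq := fun s hs => by
    classical
    have hs' := ((T.mem_realWaves_succ hε hwave s).1 hs).1
    have h := wavePos_succ_of_coe (T.wavePos_eq s hs')
    rw [h, if_neg, T.speedAt_eq hε hs' (hwave s (realWaves_subset j hs')), trackPos_succ]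
    intro hc
    rw [if_pos hc] at h
    exact (mem_realWaves.1 hs).2 h

theorem of_le (hε : 0 < ε) (hw : GridData ε w₀) (hA : A.OrdConnected) (hwA : ∀ x, w₀ x ∈ A)
    (hcol : IsCollisionSequence f ε w₀ v₀ J t x) : ∀ j ≤ J, Tracked f ε w₀ v₀ t x j
  | 0, _ => zero hε hw hA hwA
  | j + 1, hj => (of_le hε hw hA hwA hcol j (by omega)).succ hε hj hcol
      (initial_waves hε hw hA hwA).2.2.1

end Tracked

theorem neg_one_lt_cellSlope_wave (hf : ContDiff ℝ 3 f) (hε : 0 < ε) (hA : A.OrdConnected)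
    (hyp : ∀ a ∈ A, ∀ b ∈ B, -1 < deriv (fun w => f (w, b)) a) {s : ℕ} (hi : InitialWave ε w₀ A s)
    {b : ℝ} (hb : b ∈ B) :
    -1 < cellSlope ε (fun w => f (w, b)) (waveCell (intSign ε w₀) (intState ε w₀) s) := by
  have h1 := hi.right_mem
  have h2 := hi.left_mem
  rw [hi.rightState_eq, ← intState] at h1 h2
  rw [hi.sign_eq] at h2
  refine neg_one_lt_cellSlope hε ((contDiff_section hf b).differentiable (by norm_num)) hA
    (fun a ha => hyp a ha b hb) ?_ ?_ <;> unfold waveCell <;>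
    rcases intSign_eq ε w₀ s with h | h <;> rw [h] at h2 ⊢
  · convert h2 using 1; push_cast; simp; ring
  · convert h1 using 1; norm_num; ring
  · convert h1 using 1; push_cast; simp; ring
  · convert h2 using 1; norm_num; ring

/-- The waves of the wavefront solution form a system of waves. -/
noncomputable def waveDynamics (hf : ContDiff ℝ 3 f)
    (hbdd : ∀ k : ℕ, k ≤ 3 → ∃ C : ℝ, ∀ p : ℝ × ℝ, ‖iteratedFDeriv ℝ k f p‖ ≤ C) (hε : 0 < ε)
    (hw₀ : GridData ε w₀) (hv₀ : BoundedVariationOn v₀ univ) (hA : A.OrdConnected)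
    (hw₀A : ∀ x, w₀ x ∈ A) (hv₀B : ∀ x, v₀ x ∈ B)
    (hyp : ∀ a ∈ A, ∀ b ∈ B, -1 < deriv (fun w => f (w, b)) a)
    (hcol : IsCollisionSequence f ε w₀ v₀ J t x) : WaveDynamics J :=
  have hwave := (initial_waves hε hw₀ hA hw₀A).2.2.1
  have hT := Tracked.of_le hε hw₀ hA hw₀A hcol
  have hmem := fun j (hj : j < J) => (hT j hj.le).mem_realWaves_succ hε hwave
  have hnext := fun j (hj : j < J) => ((hT j hj.le).step hε hj hcol).next_config (hmem j hj)
  { W := realWaves f ε w₀ v₀ t x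
    X := trackPos f ε w₀ v₀ t
    σ := trackSpeed f ε w₀ v₀ t
    t := t
    sgn := intSign ε w₀
    k := waveCell (intSign ε w₀) (intState ε w₀)
    φ := fun z s => cellSlope ε (fun w => f (w, v₀ z)) (waveCell (intSign ε w₀) (intState ε w₀) s)
    T := variationBeyond v₀
    ε := ε
    K := normDww f
    M := normDwwv f
    Tinf := totVar v₀
    ε_nonneg := hε.le
    K_nonneg := normDww_nonneg f
    M_nonneg := normDwwv_nonneg f
    T_anti := variationBeyond_anti hv₀
    T_le := variationBeyond_le_totVar hv₀
    mono_pos := fun j hj => (hT j hj).conf.mono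
    sgn_eq := fun j hj => (hT j hj).conf.sign
    dist_add := fun j hj s hs m hm s' hs' h1 h2 h3 =>
      (hT j hj).conf.abs_waveCell_add hs hm hs' h1 h2 h3
    speed_mono := fun j hj s hs s' hs' hX h => by
      unfold trackSpeed
      rw [← hX]
      exact (hT j hj).conf.speed_mono hε _ hs hs' hX h
    tail := fun j hj y c E hE hE' =>
      (hT j hj).conf.tail_le_cellSlope hε (q := vAt v₀ t j) (fun _ => rfl) hE hE'
    head := fun j hj y c E hE hE' =>
      (hT j hj).conf.head_le_cellSlope hε (q := vAt v₀ t j) (fun _ => rfl) hE hE'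
    alive_succ := fun j hj s hs => ((hmem j hj s).1 hs).1
    -- This is the only field that uses the bound `-1 < ∂_w f`.
    label_mono := fun j hj s hs => by
      have S := (hT j hj.le).step hε hj hcol
      have hspeed : -1 < trackSpeed f ε w₀ v₀ t j s := S.neg_one_lt_speed
        (fun i hi y => neg_one_lt_cellSlope_wave hf hε hA hyp (hwave i (realWaves_subset j hi))
          (hv₀B _)) ((hmem j hj s).1 hs).1
      rw [trackPos_succ]
      nlinarith [S.time_pos]
    pos_succ := fun j hj s _ s' _ h1 h2 => by simp only [trackPos_succ, h1, h2]
    cancel_right := fun j hj => (hnext j hj).2.1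
    cancel_left := fun j hj => (hnext j hj).2.2
    flux_le := fun z s s' => by
      exact_mod_cast cellSlope_section_sub_le hf hbdd hε (v₀ z) _ _
    flux_diff_le := fun z z' h s s' => by
      have h1 := cellSlope_section_diff_le hf hbdd hε (v₀ z) (v₀ z')
        (waveCell (intSign ε w₀) (intState ε w₀) s) (waveCell (intSign ε w₀) (intState ε w₀) s')
      have h2 := mul_le_mul_of_nonneg_left (abs_sub_le_variationBeyond hv₀ h) (normDwwv_nonneg f)
      refine h1.trans (add_le_add_right (mul_le_mul_of_nonneg_right h2 ?_) _)
      exact mul_nonneg (by positivity) hε.le }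

/-- At an interaction point the change of the speeds is controlled by the decrease of the
potential. -/
theorem interaction_le (hf : ContDiff ℝ 3 f)
    (hbdd : ∀ k : ℕ, k ≤ 3 → ∃ C : ℝ, ∀ p : ℝ × ℝ, ‖iteratedFDeriv ℝ k f p‖ ≤ C) (hε : 0 < ε)
    (hw₀ : GridData ε w₀) (hv₀ : BoundedVariationOn v₀ univ) {D : Finset ℝ} (hD : IsStep D v₀)
    (hA : A.OrdConnected)
    (hw₀A : ∀ x, w₀ x ∈ A) (hv₀B : ∀ x, v₀ x ∈ B)
    (hyp : ∀ a ∈ A, ∀ b ∈ B, -1 < deriv (fun w => f (w, b)) a)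
    (hcol : IsCollisionSequence f ε w₀ v₀ J t x) {j : ℕ} (hj : j < J)
    (hinter : IsInteraction f ε w₀ v₀ t x j) :
    ∃ L ⊆ waves ε w₀, ∃ R ⊆ waves ε w₀,
      ∑ s ∈ realWaves f ε w₀ v₀ t x (j + 1),
        |waveSpeed f ε w₀ v₀ t x (j + 1) s - waveSpeed f ε w₀ v₀ t x j s| * ε ≤
      2 * ε ^ 2 * ∑ s ∈ L, ∑ s' ∈ R,
        ((waveDynamics hf hbdd hε hw₀ hv₀ hA hw₀A hv₀B hyp hcol).pot j s s' -
          (waveDynamics hf hbdd hε hw₀ hv₀ hA hw₀A hv₀B hyp hcol).pot (j + 1) s s') := by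
  classical
  have hwave := (initial_waves hε hw₀ hA hw₀A).2.2.1
  have T := Tracked.of_le hε hw₀ hA hw₀A hcol j hj.le
  have T' := Tracked.of_le hε hw₀ hA hw₀A hcol (j + 1) hj
  have S := T.step hε hj hcol
  have hsecond : ∀ F ∈ arriving f ε (vAt v₀ t j) (wAt f ε w₀ v₀ t j) (t (j + 1) - t j) (x (j + 1)),
      F.family = Family.second := fun F hF => (hinter F hF F hF).1
  rcases S.collision_cases with ⟨⟨F, hF, hF'⟩, -⟩ | ⟨-, s₁, hs₁, s₂, hs₂, hlt, hx₁, hx₂, hall⟩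
  · rw [hsecond F hF] at hF'
    cases hF'
  have hsame : ∀ s ∈ realWaves f ε w₀ v₀ t x j, ∀ s' ∈ realWaves f ε w₀ v₀ t x j,
      trackPos f ε w₀ v₀ t j s + trackSpeed f ε w₀ v₀ t j s * (t (j + 1) - t j) = x (j + 1) →
      trackPos f ε w₀ v₀ t j s' + trackSpeed f ε w₀ v₀ t j s' * (t (j + 1) - t j) = x (j + 1) →
      intSign ε w₀ s = intSign ε w₀ s' := by
    intro s hs s' hs' hx hx'
    have h := S.mem_arriving hs (t (j + 1) - t j)
    have h' := S.mem_arriving hs' (t (j + 1) - t j)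
    rw [hx] at h
    rw [hx'] at h'
    have := (hinter _ h _ h').2.2
    simp only at this
    rw [T.conf.sign_jump hε hs, T.conf.sign_jump hε hs'] at this
    exact_mod_cast this
  have hc' := S.config_of_same_sign hsame
  have hW : realWaves f ε w₀ v₀ t x (j + 1) = realWaves f ε w₀ v₀ t x j := by
    ext s
    rw [T.mem_realWaves_succ hε hwave]
    refine ⟨fun h => h.1, fun hs => ⟨hs, fun h => h.2 ?_⟩⟩
    rw [← h.1]
    exact hc'.fits hε hs
  have hspeed : ∀ s ∈ realWaves f ε w₀ v₀ t x j, -1 < trackSpeed f ε w₀ v₀ t j s := fun s hs =>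
    S.neg_one_lt_speed (fun i hi y => neg_one_lt_cellSlope_wave hf hε hA hyp
      (hwave i (realWaves_subset j hi)) (hv₀B _)) hs
  -- No wavefront of the first family is involved, so no wave crosses a jump of `v` up to and
  -- including this collision.
  have hflux : ∀ s ∈ realWaves f ε w₀ v₀ t x j,
      vAt v₀ t (j + 1) (trackPos f ε w₀ v₀ t j s +
        trackSpeed f ε w₀ v₀ t j s * (t (j + 1) - t j)) = vAt v₀ t j (trackPos f ε w₀ v₀ t j s) := by
    intro s hs
    rw [← S.flux_parameter_eq hD (t₀ := t j) (fun _ => rfl) hsecond hs (hspeed s hs), vAt,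
      add_sub_cancel]
  let L := (realWaves f ε w₀ v₀ t x j).filter fun s =>
    trackPos f ε w₀ v₀ t j s = trackPos f ε w₀ v₀ t j s₁ ∧
      trackSpeed f ε w₀ v₀ t j s = trackSpeed f ε w₀ v₀ t j s₁
  let R := (realWaves f ε w₀ v₀ t x j).filter fun s =>
    trackPos f ε w₀ v₀ t j s = trackPos f ε w₀ v₀ t j s₂ ∧
      trackSpeed f ε w₀ v₀ t j s = trackSpeed f ε w₀ v₀ t j s₂
  have hL : ∀ s, s ∈ L ↔ s ∈ realWaves f ε w₀ v₀ t x j ∧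
      trackPos f ε w₀ v₀ t j s = trackPos f ε w₀ v₀ t j s₁ ∧
      trackSpeed f ε w₀ v₀ t j s = trackSpeed f ε w₀ v₀ t j s₁ := fun s => Finset.mem_filter
  have hR : ∀ s, s ∈ R ↔ s ∈ realWaves f ε w₀ v₀ t x j ∧
      trackPos f ε w₀ v₀ t j s = trackPos f ε w₀ v₀ t j s₂ ∧
      trackSpeed f ε w₀ v₀ t j s = trackSpeed f ε w₀ v₀ t j s₂ := fun s => Finset.mem_filter
  obtain ⟨heq, hdist⟩ := S.interaction (q' := vAt v₀ t (j + 1))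
    (σ' := trackSpeed f ε w₀ v₀ t (j + 1)) hc' (fun _ => rfl) hflux hs₁ hs₂ hlt hx₁ hx₂ hall hL hR
  have hRne : R.Nonempty := ⟨s₂, (hR s₂).2 ⟨hs₂, rfl, rfl⟩⟩
  -- The bound `l` is the size of the merged jump, which contains the cells of all the waves in `L`
  -- and `R`. Its factor `|L| + |R|` cancels the one in `heq`.
  have hdrop := WaveDynamics.sum_slope_le_pot_drop
    (D := waveDynamics hf hbdd hε hw₀ hv₀ hA hw₀A hv₀B hyp hcol) hj hlt hL hR (x := x (j + 1))
    (l := (L.card + R.card) * ε)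
    (fun s hs => ⟨by rw [← hW] at hL; exact ((hL s).1 hs).1, by
      obtain ⟨-, h1, h2⟩ := (hL s).1 hs
      rw [← hx₁, ← h1, ← h2]; rfl⟩)
    (fun s hs => ⟨by rw [← hW] at hR; exact ((hR s).1 hs).1, by
      obtain ⟨-, h1, h2⟩ := (hR s).1 hs
      rw [← hx₂, ← h1, ← h2]; rfl⟩) hRne
    (fun s hs s' hs' => mul_le_mul_of_nonneg_right (by exact_mod_cast hdist s hs s' hs') hε.le)
  refine ⟨L, fun s hs => realWaves_subset j ((hL s).1 hs).1,
    R, fun s hs => realWaves_subset j ((hR s).1 hs).1, ?_⟩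
  have hsum : ∑ s ∈ realWaves f ε w₀ v₀ t x (j + 1),
      |waveSpeed f ε w₀ v₀ t x (j + 1) s - waveSpeed f ε w₀ v₀ t x j s| * ε =
      (∑ s ∈ realWaves f ε w₀ v₀ t x j,
        |trackSpeed f ε w₀ v₀ t (j + 1) s - trackSpeed f ε w₀ v₀ t j s|) * ε := by
    rw [← Finset.sum_mul, hW]
    congr 1
    refine Finset.sum_congr rfl fun s hs => ?_
    have hi := hwave s (realWaves_subset j hs)
    rw [T.waveSpeed_eq hε hs hi, T'.waveSpeed_eq hε (by rwa [hW]) hi]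
  rw [hsum]
  have hcard : (0 : ℝ) < L.card + R.card := by
    have : (0 : ℝ) < R.card := by exact_mod_cast Finset.card_pos.2 hRne
    positivity
  refine le_of_mul_le_mul_left ?_ hcard
  rw [← mul_assoc, heq]
  calc _ ≤ 2 * ((L.card + R.card) * ε * _) * ε :=
        mul_le_mul_of_nonneg_right (mul_le_mul_of_nonneg_left hdrop (by norm_num)) hε.le
    _ = _ := by ring

end WavefrontTracking

theorem mainTheorem2
    (f : ℝ × ℝ → ℝ) (hf : ContDiff ℝ 3 f)
    (hbdd : ∀ k : ℕ, k ≤ 3 → ∃ C : ℝ, ∀ p : ℝ × ℝ, ‖iteratedFDeriv ℝ k f p‖ ≤ C)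
    (ε : ℝ) (hε : 0 < ε)
    (w₀ v₀ : ℝ → ℝ) (hw₀ : GridData ε w₀) (hv₀ : GridData ε v₀)
    (A B : Set ℝ) (hA : A.OrdConnected) (hB : B.OrdConnected)
    (hw₀A : ∀ x, w₀ x ∈ A) (hv₀B : ∀ x, v₀ x ∈ B)
    (hyp : ∀ a ∈ A, ∀ b ∈ B, -1 < deriv (fun w => f (w, b)) a)
    (J : ℕ) (t x : ℕ → ℝ) (hcol : IsCollisionSequence f ε w₀ v₀ J t x) :
    ∑ j ∈ interactionIndices f ε w₀ v₀ t x J, ∑ s ∈ realWaves f ε w₀ v₀ t x (j + 1),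
        |waveSpeed f ε w₀ v₀ t x (j + 1) s - waveSpeed f ε w₀ v₀ t x j s| * ε
      ≤ 2 * (normDww f + 6 * Real.log 2 * normDwwv f * totVar v₀) * totVar w₀ ^ 2 := by
  classical
  obtain ⟨D, hD⟩ := hv₀.piecewise_const
  have hbv := IsStep.boundedVariationOn hD
  have hmem : ∀ j ∈ interactionIndices f ε w₀ v₀ t x J,
      j < J ∧ IsInteraction f ε w₀ v₀ t x j := fun j hj => by
    simpa [interactionIndices] using hj
  have hI : ∀ j, ∃ L R : Finset ℕ, j ∈ interactionIndices f ε w₀ v₀ t x J →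
      L ⊆ waves ε w₀ ∧ R ⊆ waves ε w₀ ∧ ∑ s ∈ realWaves f ε w₀ v₀ t x (j + 1),
        |waveSpeed f ε w₀ v₀ t x (j + 1) s - waveSpeed f ε w₀ v₀ t x j s| * ε ≤
      2 * ε ^ 2 * ∑ s ∈ L, ∑ s' ∈ R,
        ((waveDynamics hf hbdd hε hw₀ hbv hA hw₀A hv₀B hyp hcol).pot j s s' -
          (waveDynamics hf hbdd hε hw₀ hbv hA hw₀A hv₀B hyp hcol).pot (j + 1) s s') := by
    intro j
    by_cases hj : j ∈ interactionIndices f ε w₀ v₀ t x J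
    · obtain ⟨L, hL, R, hR, h⟩ := interaction_le hf hbdd hε hw₀ hbv hD hA hw₀A hv₀B hyp hcol
        (hmem j hj).1 (hmem j hj).2
      exact ⟨L, R, fun _ => ⟨hL, hR, h⟩⟩
    · exact ⟨∅, ∅, fun h => absurd h hj⟩
  choose L R hLR using hI
  have htot := WaveDynamics.sum_pot_drop_le
    (D := waveDynamics hf hbdd hε hw₀ hbv hA hw₀A hv₀B hyp hcol) (variationBeyond_nonneg v₀)
    (I := interactionIndices f ε w₀ v₀ t x J) (fun j hj => Finset.mem_range.2 (hmem j hj).1) L R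
    (waves ε w₀) (fun j hj => (hLR j hj).1) (fun j hj => (hLR j hj).2.1)
  have hT : 0 ≤ totVar v₀ := ENNReal.toReal_nonneg
  have hM := mul_nonneg (normDwwv_nonneg f) hT
  -- The potential gives the constant `1` in front of the mixed derivative; the stated constant is
  -- larger.
  have hlog : (1 : ℝ) ≤ 6 * Real.log 2 := by linarith [Real.log_two_gt_d9]
  calc _ ≤ ∑ j ∈ interactionIndices f ε w₀ v₀ t x J, 2 * ε ^ 2 * ∑ s ∈ L j, ∑ s' ∈ R j,
        ((waveDynamics hf hbdd hε hw₀ hbv hA hw₀A hv₀B hyp hcol).pot j s s' -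
          (waveDynamics hf hbdd hε hw₀ hbv hA hw₀A hv₀B hyp hcol).pot (j + 1) s s') :=
        Finset.sum_le_sum fun j hj => (hLR j hj).2.2
    _ ≤ 2 * ε ^ 2 * ((normDww f + normDwwv f * totVar v₀) * ((waves ε w₀).card : ℝ) ^ 2) := by
        rw [← Finset.mul_sum]
        exact mul_le_mul_of_nonneg_left htot (by positivity)
    _ = 2 * (normDww f + normDwwv f * totVar v₀) * totVar w₀ ^ 2 := by
        rw [(initial_waves hε hw₀ hA hw₀A).1]
        ring
    _ ≤ _ := by
        refine mul_le_mul_of_nonneg_right ?_ (sq_nonneg _)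
        nlinarith
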